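/- Let $(N,\omega)$ be a connected smooth symplectic surface without boundary (Hausdorff, second countable, not necessarily compact) with finite symplectic area, and let $H:N\to\mathbb R$ be a smooth, proper, non-constant function. Let $X_H$ be its Hamiltonian vector field, $\omega(X_H,\cdot)=-\mathrm dH$, with flow $\Phi_H$. Definitions. An embedded circle of $H$ at level $c$ is the support $L=\gamma(\mathbb R)$ of a non-constant periodic orbit $\gamma$ of $X_H$ with $H\circ\gamma\equiv c$. An orbit cylinder of $H$ is a smooth isotopy $c\mapsto L_c\subset N$ of embedded circles, parametrized over a non-degenerate interval $I\subset\mathbb R$, such that $L_c$ is an embedded circle of $H$ at level $c$ for every $c\in I$. It is maximal if it is not properly extended by another orbit cylinder. Let $T(c)$ be the (least) period of the orbit supported on $L_c$. The circle $L_{c}$ is non-resonant if $\frac{\mathrm dT}{\mathrm dc}(c)\neq0$ and resonant otherwise. The orbit cylinder is resonant if $L_c$ is resonant for every $c\in I$, and non-resonant if $L_{c}$ is non-resonant for some $c\in I$. Theorem. The set of maximal orbit cylinders of $H$ is non-empty and exactly one of the following two statements holds: (i) All maximal orbit cylinders are non-resonant. (ii) There is only one maximal orbit cylinder. This cylinder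 is resonant and $N$ is diffeomorphic to $S^2$. Moreover, $H$ has a unique maximum point $z_{\infty}$ and a unique minimum point $z_{-\infty}$, and $N$ is the union of the cylinder and $\{z_\infty,z_{-\infty}\}$. The critical points $z_\infty$ and $z_{-\infty}$ are non-degenerate, and $\Phi_H$ induces a Hamiltonian circle action on $N\cong S^2$ with fixed-point set $\{z_\infty,z_{-\infty}\}$; that is, for some $\tau>0$ the rule $e^{2\pi i t/\tau}\cdot z=\Phi_H^t(z)$ defines a smooth circle action on $N$. -/

import Mathlib

open Set Function MeasureTheory Bundle
open scoped Manifold ContDiff Topology ENNReal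

/-- A (smooth) symplectic form on a smooth surface `N` without boundary: a smooth, alternating,
pointwise nondegenerate two-form. Closedness is automatic, since every three-form on a surface
vanishes. Smoothness is that of a section of the bundle of bilinear forms on `TN`, exactly as in
Mathlib's `Bundle.ContMDiffRiemannianMetric`. -/
structure SymplecticForm (N : Type*) [TopologicalSpace N]
    [ChartedSpace (EuclideanSpace ℝ (Fin 2)) N] [IsManifold (𝓡 2) ∞ N] where
  /-- The bilinear form on each tangent plane. -/
  form (x : N) : TangentSpace (𝓡 2) x →L[ℝ] TangentSpace (𝓡 2) x →L[ℝ] ℝ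
  alternating (x : N) (v : TangentSpace (𝓡 2) x) : form x v v = 0
  nondegenerate (x : N) (v : TangentSpace (𝓡 2) x) (hv : ∀ w, form x v w = 0) : v = 0
  contMDiff : ContMDiff (𝓡 2)
    ((𝓡 2).prod 𝓘(ℝ, EuclideanSpace ℝ (Fin 2) →L[ℝ] EuclideanSpace ℝ (Fin 2) →L[ℝ] ℝ)) ∞
    (fun x ↦ TotalSpace.mk' (EuclideanSpace ℝ (Fin 2) →L[ℝ] EuclideanSpace ℝ (Fin 2) →L[ℝ] ℝ)
      (E := fun x : N ↦ TangentSpace (𝓡 2) x →L[ℝ] TangentSpace (𝓡 2) x →L[ℝ] ℝ) x (form x))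

section

variable {N : Type*} [TopologicalSpace N] [ChartedSpace (EuclideanSpace ℝ (Fin 2)) N]
  [IsManifold (𝓡 2) ∞ N]

/-- The density `|Ω(∂₁, ∂₂)|` of the symplectic form with respect to the coordinates given by the
chart around `x`, at the coordinate point `y`. -/
noncomputable def SymplecticForm.chartDensity (Ω : SymplecticForm N) (x : N)
    (y : EuclideanSpace ℝ (Fin 2)) : ℝ :=
  |Ω.form ((extChartAt (𝓡 2) x).symm y)
    (mfderiv 𝓘(ℝ, EuclideanSpace ℝ (Fin 2)) (𝓡 2) (extChartAt (𝓡 2) x).symm y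
      (EuclideanSpace.single (0 : Fin 2) (1 : ℝ)))
    (mfderiv 𝓘(ℝ, EuclideanSpace ℝ (Fin 2)) (𝓡 2) (extChartAt (𝓡 2) x).symm y
      (EuclideanSpace.single (1 : Fin 2) (1 : ℝ)))|

/-- The symplectic area, computed in coordinates, of a set `K` contained in the domain of the
chart around `x`. -/
noncomputable def SymplecticForm.chartArea (Ω : SymplecticForm N) (x : N) (K : Set N) : ℝ≥0∞ :=
  ∫⁻ y in extChartAt (𝓡 2) x '' K, ENNReal.ofReal (Ω.chartDensity x y)

/-- The total symplectic area `∫_N Ω` (for the orientation induced by `Ω`): the supremum of the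
sums `∑ i, ∫_{K i} Ω` over all finite families of pairwise disjoint Borel sets `K i`, each of them
contained in the domain of a chart. -/
noncomputable def SymplecticForm.area (Ω : SymplecticForm N) : ℝ≥0∞ :=
  ⨆ (n : ℕ) (x : Fin n → N) (K : Fin n → Set N)
    (_ : ∀ i, MeasurableSet[borel N] (K i) ∧ K i ⊆ (chartAt (EuclideanSpace ℝ (Fin 2)) (x i)).source)
    (_ : Pairwise (fun i j ↦ Disjoint (K i) (K j))), ∑ i, Ω.chartArea (x i) (K i)

theorem SymplecticForm.existsUnique_hamiltonianVector (Ω : SymplecticForm N) (H : N → ℝ) (x : N) :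
    ∃! X : TangentSpace (𝓡 2) x, ∀ v : TangentSpace (𝓡 2) x,
      Ω.form x X v = -(show ℝ from mfderiv (𝓡 2) 𝓘(ℝ, ℝ) H x v) := by
  have : FiniteDimensional ℝ (TangentSpace (𝓡 2) x) :=
    inferInstanceAs (FiniteDimensional ℝ (EuclideanSpace ℝ (Fin 2)))
  let B : TangentSpace (𝓡 2) x →ₗ[ℝ] Module.Dual ℝ (TangentSpace (𝓡 2) x) :=
    { toFun := fun v ↦ (Ω.form x v).toLinearMap
      map_add' := fun v w ↦ by ext u; simp
      map_smul' := fun c v ↦ by ext u; simp }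
  have hB : Injective B := by
    rw [injective_iff_map_eq_zero]
    intro v hv
    exact Ω.nondegenerate x v fun w ↦ LinearMap.congr_fun hv w
  have hB' : Surjective B :=
    (LinearMap.injective_iff_surjective_of_finrank_eq_finrank
      (Subspace.dual_finrank_eq (K := ℝ)).symm).1 hB
  let d : TangentSpace (𝓡 2) x →ₗ[ℝ] ℝ := (mfderiv (𝓡 2) 𝓘(ℝ, ℝ) H x).toLinearMap
  obtain ⟨X, hX⟩ := hB' (-d)
  have hX' : ∀ v, Ω.form x X v = -(d v) := fun v ↦ LinearMap.congr_fun hX v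
  refine ⟨X, hX', fun Y hY ↦ hB ?_⟩
  ext v
  exact (hY v).trans (hX' v).symm

/-- The Hamiltonian vector field `X_H` of `H`, determined by `Ω(X_H, ·) = -dH`. -/
noncomputable def SymplecticForm.hamiltonianVectorField (Ω : SymplecticForm N) (H : N → ℝ)
    (x : N) : TangentSpace (𝓡 2) x :=
  (Ω.existsUnique_hamiltonianVector H x).choose

theorem SymplecticForm.form_hamiltonianVectorField (Ω : SymplecticForm N) (H : N → ℝ) (x : N)
    (v : TangentSpace (𝓡 2) x) :
    Ω.form x (Ω.hamiltonianVectorField H x) v =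
      -(show ℝ from mfderiv (𝓡 2) 𝓘(ℝ, ℝ) H x v) :=
  (Ω.existsUnique_hamiltonianVector H x).choose_spec.1 v

/-- `L` is an embedded circle of `H` at level `c`: the support of a non-constant periodic
orbit of `X_H` on which `H` takes the value `c`. -/
def IsEmbeddedCircle (Ω : SymplecticForm N) (H : N → ℝ) (c : ℝ) (L : Set N) : Prop :=
  ∃ γ : ℝ → N, IsMIntegralCurve γ (Ω.hamiltonianVectorField H) ∧
    (∃ t, 0 < t ∧ Periodic γ t) ∧ (∃ s t, γ s ≠ γ t) ∧ (∀ t, H (γ t) = c) ∧ range γ = L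

/-- The (least) period of the periodic orbit of `X_H` supported on `L`. -/
noncomputable def orbitPeriod (Ω : SymplecticForm N) (H : N → ℝ) (L : Set N) : ℝ :=
  sInf {t : ℝ | 0 < t ∧ ∃ γ : ℝ → N, IsMIntegralCurve γ (Ω.hamiltonianVectorField H) ∧
    range γ = L ∧ Periodic γ t}

/-- `c ↦ L c`, `c ∈ I`, is a smooth isotopy of embedded circles in `N`: there is a family of
embeddings `F (c, ·)` of the circle, depending smoothly on `c`, with image `L c`. Because the
circle is compact, an embedding is the same as an injective immersion. -/
def IsSmoothIsotopyOfCircles (I : Set ℝ) (L : ℝ → Set N) : Prop :=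
  ∃ F : ℝ × Circle → N,
    ContMDiffOn (𝓘(ℝ, ℝ).prod (𝓡 1)) (𝓡 2) ∞ F (I ×ˢ univ) ∧
    ∀ c ∈ I, Injective (fun θ : Circle ↦ F (c, θ)) ∧
      (∀ θ : Circle, Injective (mfderiv (𝓡 1) (𝓡 2) (fun θ : Circle ↦ F (c, θ)) θ)) ∧
      range (fun θ : Circle ↦ F (c, θ)) = L c

/-- An orbit cylinder of `H`: a smooth isotopy `c ↦ L_c`, parametrized over a (nondegenerate)
interval `I`, such that `L_c` is an embedded circle of `H` at level `c` for every `c ∈ I`.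
The map `c ↦ L_c` is extended by the empty set outside `I`, so that two orbit cylinders are equal
if and only if they have the same interval and the same circles. -/
@[ext]
structure OrbitCylinder (Ω : SymplecticForm N) (H : N → ℝ) where
  /-- The interval `I` of parameters. -/
  interval : Set ℝ
  /-- The circle `L_c`. -/
  circle : ℝ → Set N
  ordConnected : interval.OrdConnected
  nontrivial : interval.Nontrivial
  isEmbeddedCircle : ∀ c ∈ interval, IsEmbeddedCircle Ω H c (circle c)
  isotopy : IsSmoothIsotopyOfCircles interval circle
  circle_eq_empty : ∀ c ∉ interval, circle c = ∅

/-- The order on orbit cylinders: `Γ ≤ Γ'` if the isotopy `Γ'` extends the isotopy `Γ`.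
The maximal orbit cylinders are the maximal elements (`IsMax`) for this order. -/
instance (Ω : SymplecticForm N) (H : N → ℝ) : PartialOrder (OrbitCylinder Ω H) where
  le Γ Γ' := Γ.interval ⊆ Γ'.interval ∧ EqOn Γ.circle Γ'.circle Γ.interval
  le_refl Γ := ⟨Subset.rfl, fun _ _ ↦ rfl⟩
  le_trans _ _ _ h h' := ⟨h.1.trans h'.1, fun _ hc ↦ (h.2 hc).trans (h'.2 (h.1 hc))⟩
  le_antisymm Γ Γ' h h' := by
    have hI : Γ.interval = Γ'.interval := h.1.antisymm h'.1
    refine OrbitCylinder.ext hI (funext fun c ↦ ?_)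
    by_cases hc : c ∈ Γ.interval
    · exact h.2 hc
    · rw [Γ.circle_eq_empty c hc, Γ'.circle_eq_empty c (hI ▸ hc)]

namespace OrbitCylinder

variable {Ω : SymplecticForm N} {H : N → ℝ}

/-- The subset `⋃ L_c` of the surface swept out by an orbit cylinder. -/
def support (Γ : OrbitCylinder Ω H) : Set N := ⋃ c ∈ Γ.interval, Γ.circle c

/-- The period `T(c)` of the orbit supported on `L_c`. -/
noncomputable def period (Γ : OrbitCylinder Ω H) (c : ℝ) : ℝ := orbitPeriod Ω H (Γ.circle c)

/-- The circle `L_c` of the cylinder is non-resonant if `dT/dc ≠ 0` at `c`. The derivative is taken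
within the interval of parameters, which is open if the cylinder is maximal. -/
def IsNonresonantAt (Γ : OrbitCylinder Ω H) (c : ℝ) : Prop :=
  derivWithin Γ.period Γ.interval c ≠ 0

/-- A cylinder is resonant if all its circles are resonant. -/
def IsResonant (Γ : OrbitCylinder Ω H) : Prop := ∀ c ∈ Γ.interval, ¬ Γ.IsNonresonantAt c

/-- A cylinder is non-resonant if at least one of its circles is non-resonant. -/
def IsNonresonant (Γ : OrbitCylinder Ω H) : Prop := ∃ c ∈ Γ.interval, Γ.IsNonresonantAt c

end OrbitCylinder

/-- `z` is a non-degenerate critical point of `H`: the differential of `H` vanishes at `z` and the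
Hessian of `H` at `z`, computed in a chart around `z`, is a nondegenerate bilinear form. -/
def IsNondegenerateCriticalPoint (H : N → ℝ) (z : N) : Prop :=
  mfderiv (𝓡 2) 𝓘(ℝ, ℝ) H z = 0 ∧
    ∀ v : EuclideanSpace ℝ (Fin 2),
      (∀ w : EuclideanSpace ℝ (Fin 2),
        fderiv ℝ (fderiv ℝ (H ∘ (extChartAt (𝓡 2) z).symm)) (extChartAt (𝓡 2) z z) v w = 0) →
      v = 0

/-- The Hamiltonian flow of `H` induces a circle action on `N` whose set of fixed points is `S`:
the flow `Φ_H` exists for all times, is periodic with some period `τ > 0`, and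
`exp (2πit/τ) • z = Φ_H^t(z)` defines a smooth action of the circle on `N` with set of fixed
points `S`. (For every `z` the curve `t ↦ exp (2πit/τ) • z` is the orbit of `X_H` starting at `z`;
in particular the action is Hamiltonian, with moment map `(τ/2π) H`.) -/
def InducesHamiltonianCircleAction (Ω : SymplecticForm N) (H : N → ℝ) (S : Set N) : Prop :=
  ∃ τ : ℝ, 0 < τ ∧ ∃ _ρ : MulAction Circle N,
    ContMDiffSMul (𝓡 1) (𝓡 2) ∞ Circle N ∧
    (∀ z : N, IsMIntegralCurve (fun t : ℝ ↦ Circle.exp (2 * Real.pi * t / τ) • z)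
      (Ω.hamiltonianVectorField H)) ∧
    MulAction.fixedPoints Circle N = S

end

/-! Let X be the Hamiltonian field of H. Since H is proper, X is complete, with a smooth flow Φ.
Choose a field Y on the regular points with dH(Y) = 1. An integral curve s of Y can be parametrized
by the level, H(s(c)) = c, and the flow box (c, t) ↦ Φ_t(s(c)) pulls the symplectic form back to dc
∧ dt, because Ω(∂_c, X) = dH(∂_c) = 1 (`SmoothFlow.form_mfderiv_box`). Symplectic area in a flow box
is therefore Lebesgue area. If no regular point were periodic, an infinite strip I × ℝ would embed
in a surface of finite area; hence there are periodic orbits (`SmoothFlow.periodicSet_nonempty`). A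
regular periodic orbit persists on neighbouring levels with smoothly varying least period, and the
union of all sections through it sweeps out a largest orbit cylinder
(`SmoothFlow.exists_orbitCylinder`). So maximal cylinders exist; their supports are open, and two of
them that meet are equal.

Suppose some maximal cylinder, with support U, is resonant. Its period is a constant τ, the box I ×
(0, τ) embeds, and so I is a bounded interval (a, b). A regular point in the closure of U is fixed
by Φ_τ, so it lies on a maximal cylinder whose open support meets U, that is, on U itself. The
remaining boundary points w of U are thus critical (`SmoothFlow.exists_isResonantFamily`). Fourier
analysis of a chart along the τ-periodic orbits yields a map G to ℂ, a local diffeomorphism at w,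
that turns Φ_t on the closure of U into rotation by 2πt/τ (`SmoothFlow.exists_linearization`).
Boundary points of U near w are fixed, hence zeros of G, hence equal to w; as a punctured disc is
connected, a punctured neighbourhood of w lies in U. It follows that each end of the cylinder
converges to a single point and that the closure of U is open, hence everything
(`SmoothFlow.IsResonantFamily.exists_extrema`). The surface is U together with a maximum and a
minimum, and Φ is τ-periodic. Nondegeneracy follows from dG(X) = (2πi/τ) G.

To recognize the sphere, the rotation-equivariant maps at the two poles are glued to a phase
function on U by cutoffs depending on H. This gives an equivariant G : N → ℂ vanishing exactly at
the poles and a local diffeomorphism there. On U, |G|² is a function v of H. A height K with K(a) <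
0 < K(b) and K/√v strictly increasing makes (G, K ∘ H) avoid the origin of ℂ × ℝ and meet every ray
at most once and transversally, so radial projection is a diffeomorphism to the sphere
(`SmoothFlow.IsResonantFamily.nonempty_diffeomorph_sphere`).

The analytic foundation, smooth dependence of integral curves on initial values, comes from the
inverse function theorem on spaces of continuous curves. -/

/-! ### Composition operators on spaces of continuous functions. -/

section Nemytskii

universe v
variable {K : Type*} [TopologicalSpace K] [CompactSpace K]
  {E : Type v} [NormedAddCommGroup E] [NormedSpace ℝ E]
  {F : Type v} [NormedAddCommGroup F] [NormedSpace ℝ F]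
  {G : Type v} [NormedAddCommGroup G] [NormedSpace ℝ G]

/-- Pointwise application of a bilinear map to a continuous function with values in the first
factor, as a continuous linear map in the other function. -/
noncomputable def ContinuousLinearMap.pointwise (B : G →L[ℝ] E →L[ℝ] F) (A : C(K, G)) :
    C(K, E) →L[ℝ] C(K, F) :=
  LinearMap.mkContinuous
    { toFun := fun α ↦ ⟨fun t ↦ B (A t) (α t), by fun_prop⟩
      map_add' := fun α β ↦ by ext t; simp
      map_smul' := fun c α ↦ by ext t; simp } (‖B‖ * ‖A‖)
    (fun α ↦ by
      rw [ContinuousMap.norm_le _ (by positivity)]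
      intro t
      refine (B.le_opNorm₂ (A t) (α t)).trans ?_
      gcongr
      · exact A.norm_coe_le_norm t
      · exact α.norm_coe_le_norm t)

theorem ContinuousLinearMap.pointwise_apply (B : G →L[ℝ] E →L[ℝ] F) (A : C(K, G)) (α : C(K, E))
    (t : K) : B.pointwise A α t = B (A t) (α t) := rfl

theorem ContinuousLinearMap.norm_pointwise_le (B : G →L[ℝ] E →L[ℝ] F) (A : C(K, G)) :
    ‖B.pointwise A‖ ≤ ‖B‖ * ‖A‖ := by
  refine ContinuousLinearMap.opNorm_le_bound _ (by positivity) fun α ↦ ?_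
  rw [ContinuousMap.norm_le _ (by positivity)]
  intro t
  rw [ContinuousLinearMap.pointwise_apply]
  refine (B.le_opNorm₂ (A t) (α t)).trans ?_
  gcongr
  · exact A.norm_coe_le_norm t
  · exact α.norm_coe_le_norm t

/-- `ContinuousLinearMap.pointwise` as a continuous linear map. -/
noncomputable def ContinuousLinearMap.pointwiseCLM (K : Type*) [TopologicalSpace K]
    [CompactSpace K] (B : G →L[ℝ] E →L[ℝ] F) : C(K, G) →L[ℝ] C(K, E) →L[ℝ] C(K, F) :=
  LinearMap.mkContinuous
    { toFun := fun A ↦ B.pointwise A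
      map_add' := fun A A' ↦ by
        apply ContinuousLinearMap.ext; intro α; ext t
        change B (A t + A' t) (α t) = B (A t) (α t) + B (A' t) (α t)
        simp
      map_smul' := fun c A ↦ by
        apply ContinuousLinearMap.ext; intro α; ext t
        change B (c • A t) (α t) = c • B (A t) (α t)
        simp } ‖B‖
    (fun A ↦ B.norm_pointwise_le A)

theorem ContinuousLinearMap.pointwiseCLM_apply (B : G →L[ℝ] E →L[ℝ] F) (A : C(K, G))
    (α : C(K, E)) (t : K) : B.pointwiseCLM K A α t = B (A t) (α t) := rfl

/-- The mean value inequality on the segment from α(t) to α(t) + β(t) bounds the remainder uniformly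
in t. What replaces uniform continuity of the derivative is continuity of the operator β ↦ f' ∘ β in
the sup norm. The bilinear map B is kept so that the derivative is a fixed continuous linear map
applied to another composition operator, which is the form needed for induction. -/
theorem ContinuousMap.hasFDerivAt_comp_left (B : G →L[ℝ] E →L[ℝ] F)
    (f : C(E, F)) (f' : C(E, G)) (hf : ∀ x, HasFDerivAt f (B (f' x)) x) (α : C(K, E)) :
    HasFDerivAt (fun β : C(K, E) ↦ f.comp β) (B.pointwiseCLM K (f'.comp α)) α := by
  rw [hasFDerivAt_iff_isLittleO_nhds_zero, Asymptotics.isLittleO_iff]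
  intro c hc
  have hcont : Continuous fun β : C(K, E) ↦ f'.comp β := ContinuousMap.continuous_postcomp f'
  obtain ⟨c', hc', hcc⟩ : ∃ c' > 0, ‖B‖ * c' ≤ c := by
    refine ⟨c / (‖B‖ + 1), by positivity, ?_⟩
    rw [mul_div_assoc', div_le_iff₀ (by positivity)]
    nlinarith
  obtain ⟨δ, hδ, h⟩ := Metric.continuous_iff.1 hcont α c' hc'
  filter_upwards [Metric.ball_mem_nhds (0 : C(K, E)) hδ] with β hβ
  rw [ContinuousMap.norm_le _ (by positivity)]
  intro t
  have hβ' : ‖β‖ < δ := by simpa using hβ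
  have key : ∀ x ∈ segment ℝ (α t) (α t + β t), ‖B (f' x) - B (f' (α t))‖ ≤ c := by
    intro x hx
    obtain ⟨s, hs, rfl⟩ : ∃ s ∈ Icc (0 : ℝ) 1, α t + s • β t = x := by
      rw [segment_eq_image'] at hx
      obtain ⟨s, hs, h⟩ := hx
      exact ⟨s, hs, by simpa using h⟩
    have h1 : dist (α + s • β) α < δ := by
      rw [dist_eq_norm, add_sub_cancel_left, norm_smul, Real.norm_eq_abs, abs_of_nonneg hs.1]
      nlinarith [norm_nonneg β, hs.2]
    have h2 : dist (f' (α t + s • β t)) (f' (α t)) ≤ c' :=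
      (ContinuousMap.dist_apply_le_dist t).trans (h _ h1).le
    rw [← map_sub]
    refine (B.le_opNorm _).trans (le_trans ?_ hcc)
    rw [dist_eq_norm] at h2
    gcongr
  have h3 := (convex_segment (α t) (α t + β t)).norm_image_sub_le_of_norm_hasFDerivWithin_le'
    (f := f) (f' := fun x ↦ B (f' x)) (φ := B (f' (α t))) (fun x _ ↦ (hf x).hasFDerivWithinAt) key
    (left_mem_segment ℝ _ _) (right_mem_segment ℝ _ _)
  have h4 : ‖f (α t + β t) - f (α t) - B (f' (α t)) (β t)‖ ≤ c * ‖β t‖ := by simpa using h3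
  rw [ContinuousMap.sub_apply, ContinuousMap.sub_apply, ContinuousLinearMap.pointwiseCLM_apply]
  exact h4.trans (mul_le_mul_of_nonneg_left (β.norm_coe_le_norm t) hc.le)

/-- Induction on the order of differentiability: the derivative of the operator of f is a continuous
linear map after the operator of f', so one derivative of f gives one derivative of the operator.
The target space is generalized because f' takes values in E →L[ℝ] F. -/
theorem ContinuousMap.contDiff_comp_left_nat (n : ℕ) :
    ∀ {F : Type v} [NormedAddCommGroup F] [NormedSpace ℝ F] (f : C(E, F)), ContDiff ℝ n f →
    ContDiff ℝ n (fun β : C(K, E) ↦ f.comp β) := by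
  induction n with
  | zero =>
    intro F _ _ f hf
    exact contDiff_zero.2 (ContinuousMap.continuous_postcomp f)
  | succ n ih =>
    intro F _ _ f hf
    push_cast at hf ⊢
    obtain ⟨f', hf', hd⟩ := contDiff_succ_iff_hasFDerivAt.1 hf
    have key : ∀ {G : Type v} [NormedAddCommGroup G] [NormedSpace ℝ G] (B : G →L[ℝ] E →L[ℝ] F)
        (f'' : E → G), ContDiff ℝ n f'' → (∀ x, HasFDerivAt f (B (f'' x)) x) →
        ContDiff ℝ (n + 1) (fun β : C(K, E) ↦ f.comp β) := fun B f'' hf'' hd'' ↦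
      contDiff_succ_iff_hasFDerivAt.2 ⟨_,
        (B.pointwiseCLM K).contDiff.comp (ih ⟨f'', hf''.continuous⟩ hf''),
        fun α ↦ ContinuousMap.hasFDerivAt_comp_left B f ⟨f'', hf''.continuous⟩ hd'' α⟩
    exact key (ContinuousLinearMap.id ℝ (E →L[ℝ] F)) f' hf' hd

/-- Composition with a smooth map is a smooth map between spaces of continuous functions. -/
theorem ContinuousMap.contDiff_comp_left (f : C(E, F)) (hf : ContDiff ℝ ∞ f) : ContDiff ℝ ∞ (fun β : C(K, E) ↦ f.comp β) :=
  contDiff_infty.2 fun n ↦ ContinuousMap.contDiff_comp_left_nat n f (contDiff_infty.1 hf n)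

end Nemytskii

/-! ### Smooth dependence of integral curves on time and initial value. -/

section Integral

variable {E : Type*} [NormedAddCommGroup E] [NormedSpace ℝ E]

/-- The primitive vanishing at `0`, as a continuous linear map on `C([0,1], E)`. -/
noncomputable def ContinuousMap.primitiveCLM (E : Type*) [NormedAddCommGroup E] [NormedSpace ℝ E] :
    C(Icc (0 : ℝ) 1, E) →L[ℝ] C(Icc (0 : ℝ) 1, E) :=
  LinearMap.mkContinuous
    { toFun := fun α ↦ ⟨fun t ↦ ∫ s in (0 : ℝ)..t, IccExtend zero_le_one α s, by
        have : Continuous fun t : ℝ ↦ ∫ s in (0 : ℝ)..t, IccExtend zero_le_one α s :=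
          intervalIntegral.continuous_primitive
            (fun a b ↦ (α.continuous.Icc_extend').intervalIntegrable a b) 0
        exact this.comp continuous_subtype_val⟩
      map_add' := fun α β ↦ by
        ext t
        have h := intervalIntegral.integral_add (μ := volume) (a := 0) (b := t)
          (α.continuous.Icc_extend' (h := zero_le_one) |>.intervalIntegrable _ _)
          (β.continuous.Icc_extend' (h := zero_le_one) |>.intervalIntegrable _ _)
        exact h
      map_smul' := fun c α ↦ by
        ext t
        exact intervalIntegral.integral_smul c (IccExtend zero_le_one α) } 1
    (fun α ↦ by
      rw [one_mul, ContinuousMap.norm_le _ (by positivity)]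
      intro t
      have h := intervalIntegral.norm_integral_le_of_norm_le_const (a := 0) (b := (t : ℝ))
        (f := IccExtend zero_le_one α) (C := ‖α‖) (fun s _ ↦ α.norm_coe_le_norm _)
      refine h.trans ?_
      have : |(t : ℝ) - 0| ≤ 1 := by
        rw [sub_zero, abs_of_nonneg t.2.1]; exact t.2.2
      nlinarith [norm_nonneg α])

end Integral

section LocalFlow

variable {E : Type*} [NormedAddCommGroup E] [NormedSpace ℝ E] [CompleteSpace E]

/-- The constant curves. -/
noncomputable def ContinuousMap.constCLM' (E : Type*) [NormedAddCommGroup E] [NormedSpace ℝ E] :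
    E →L[ℝ] C(Icc (0 : ℝ) 1, E) :=
  LinearMap.mkContinuous
    { toFun := fun x ↦ ContinuousMap.const _ x
      map_add' := fun _ _ ↦ rfl
      map_smul' := fun _ _ ↦ rfl } 1
    (fun x ↦ by
      rw [one_mul, ContinuousMap.norm_le _ (by positivity)]
      exact fun t ↦ le_rfl)

/-- Smooth dependence of the integral equation `α = x + ε ∫ f(α)` on `(ε, x)`, for small `ε`. -/
theorem exists_contDiffAt_integral_equation {f : E → E} (hf : ContDiff ℝ ∞ f) (x₀ : E) :
    ∃ A : ℝ × E → C(Icc (0 : ℝ) 1, E), ContDiffAt ℝ ∞ A (0, x₀) ∧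
      ∃ W ∈ 𝓝 ((0 : ℝ), x₀, ContinuousMap.const (Icc (0 : ℝ) 1) x₀), ∀ ε x α, (ε, x, α) ∈ W →
        (∀ t, α t = x + ε • ∫ s in (0 : ℝ)..t, f (IccExtend zero_le_one α s)) → α = A (ε, x) := by
  let fc : C(E, E) := ⟨f, hf.continuous⟩
  let N : C(Icc (0 : ℝ) 1, E) → C(Icc (0 : ℝ) 1, E) := fun β ↦ fc.comp β
  have hN : ContDiff ℝ ∞ N := ContinuousMap.contDiff_comp_left fc hf
  let I := ContinuousMap.primitiveCLM E
  let κ := ContinuousMap.constCLM' E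
  -- The first two components carry the parameters along, so that inverting G solves the integral
  -- equation with smooth dependence on (ε, x).
  let G : ℝ × E × C(Icc (0 : ℝ) 1, E) → ℝ × E × C(Icc (0 : ℝ) 1, E) :=
    fun p ↦ (p.1, p.2.1, p.2.2 - κ p.2.1 - p.1 • I (N p.2.2))
  have hG : ContDiff ℝ ∞ G := by
    refine contDiff_fst.prodMk (contDiff_snd.fst.prodMk ?_)
    refine (contDiff_snd.snd.sub (κ.contDiff.comp contDiff_snd.fst)).sub ?_
    exact contDiff_fst.smul (I.contDiff.comp (hN.comp contDiff_snd.snd))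
  let α₀ : C(Icc (0 : ℝ) 1, E) := ContinuousMap.const _ x₀
  let p₀ : ℝ × E × C(Icc (0 : ℝ) 1, E) := (0, x₀, α₀)
  let w := I (N α₀)
  -- At ε = 0 the derivative of the nonlinear term in the curve disappears, and what remains of DG
  -- is unipotent with an explicit inverse.
  let fwd : ℝ × E × C(Icc (0 : ℝ) 1, E) →L[ℝ] ℝ × E × C(Icc (0 : ℝ) 1, E) :=
    (ContinuousLinearMap.fst ℝ _ _).prod
      (((ContinuousLinearMap.fst ℝ _ _).comp (ContinuousLinearMap.snd ℝ _ _)).prod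
        ((ContinuousLinearMap.snd ℝ _ _).comp (ContinuousLinearMap.snd ℝ _ _) -
          κ.comp ((ContinuousLinearMap.fst ℝ _ _).comp (ContinuousLinearMap.snd ℝ _ _)) -
          (ContinuousLinearMap.fst ℝ _ _).smulRight w))
  let bwd : ℝ × E × C(Icc (0 : ℝ) 1, E) →L[ℝ] ℝ × E × C(Icc (0 : ℝ) 1, E) :=
    (ContinuousLinearMap.fst ℝ _ _).prod
      (((ContinuousLinearMap.fst ℝ _ _).comp (ContinuousLinearMap.snd ℝ _ _)).prod
        ((ContinuousLinearMap.snd ℝ _ _).comp (ContinuousLinearMap.snd ℝ _ _) +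
          κ.comp ((ContinuousLinearMap.fst ℝ _ _).comp (ContinuousLinearMap.snd ℝ _ _)) +
          (ContinuousLinearMap.fst ℝ _ _).smulRight w))
  let e : (ℝ × E × C(Icc (0 : ℝ) 1, E)) ≃L[ℝ] ℝ × E × C(Icc (0 : ℝ) 1, E) :=
    ContinuousLinearEquiv.equivOfInverse fwd bwd
      (fun p ↦ Prod.ext rfl (Prod.ext rfl (by
        change p.2.2 - κ p.2.1 - p.1 • w + κ p.2.1 + p.1 • w = p.2.2
        abel)))
      (fun p ↦ Prod.ext rfl (Prod.ext rfl (by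
        change p.2.2 + κ p.2.1 + p.1 • w - κ p.2.1 - p.1 • w = p.2.2
        abel)))
  have hd : HasFDerivAt G (e : _ →L[ℝ] _) p₀ := by
    have h1 : HasFDerivAt (fun p : ℝ × E × C(Icc (0 : ℝ) 1, E) ↦ p.1 • I (N p.2.2))
        (p₀.1 • fderiv ℝ (fun p : ℝ × E × C(Icc (0 : ℝ) 1, E) ↦ I (N p.2.2)) p₀ +
          (ContinuousLinearMap.fst ℝ ℝ (E × C(Icc (0 : ℝ) 1, E))).smulRight (I (N p₀.2.2))) p₀ := by
      have h0 : HasFDerivAt (fun p : ℝ × E × C(Icc (0 : ℝ) 1, E) ↦ p.1)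
        (ContinuousLinearMap.fst ℝ ℝ (E × C(Icc (0 : ℝ) 1, E))) p₀ := hasFDerivAt_fst
      have hI : ContDiff ℝ ∞ fun p : ℝ × E × C(Icc (0 : ℝ) 1, E) ↦ I (N p.2.2) :=
        I.contDiff.comp (hN.comp contDiff_snd.snd)
      exact h0.fun_smul (hI.contDiffAt.differentiableAt (by simp)).hasFDerivAt
    have h2 : p₀.1 = 0 := rfl
    rw [h2, zero_smul, zero_add] at h1
    have h3 : HasFDerivAt G fwd p₀ := by
      refine hasFDerivAt_fst.prodMk (hasFDerivAt_snd.fst.prodMk ?_)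
      exact (hasFDerivAt_snd.snd.sub (κ.hasFDerivAt.comp p₀ hasFDerivAt_snd.fst)).sub h1
    exact h3
  have hGa : ContDiffAt ℝ ∞ G p₀ := hG.contDiffAt
  have hne : (∞ : WithTop ℕ∞) ≠ 0 := by simp
  let L := hGa.localInverse hd hne
  have hG0 : G p₀ = (0, x₀, 0) := by
    have : α₀ - κ x₀ = 0 := sub_self _
    simp [G, p₀, this]
  have hL : ContDiffAt ℝ ∞ L (0, x₀, 0) := by
    have := hGa.to_localInverse hd hne
    rwa [hG0] at this
  have hLG : ∀ᶠ p in 𝓝 p₀, L (G p) = p :=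
    (hGa.hasStrictFDerivAt' hd hne).eventually_left_inverse
  refine ⟨fun q ↦ (L (q.1, q.2, 0)).2.2, ?_, _, hLG, ?_⟩
  · have h4 : ContDiff ℝ ∞ (fun q : ℝ × E ↦ ((q.1, q.2, 0) : ℝ × E × C(Icc (0 : ℝ) 1, E))) :=
      contDiff_fst.prodMk (contDiff_snd.prodMk contDiff_const)
    have h5 : ContDiffAt ℝ ∞ (fun q : ℝ × E ↦ L (q.1, q.2, 0)) (0, x₀) :=
      ContDiffAt.comp (0, x₀) (g := L) hL h4.contDiffAt
    exact contDiffAt_snd.snd.comp (0, x₀) h5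
  · intro ε x α hW hα
    have h6 : G (ε, x, α) = (ε, x, 0) := by
      have : α - κ x - ε • I (N α) = 0 := by
        ext t
        have := hα t
        simp only [ContinuousMap.sub_apply, ContinuousMap.smul_apply, ContinuousMap.zero_apply]
        rw [this]
        have h7 : κ x t = x := rfl
        have h8 : I (N α) t = ∫ s in (0 : ℝ)..t, f (IccExtend zero_le_one α s) := rfl
        rw [h7, h8]
        abel
      simp [G, this]
    have h9 : L (G (ε, x, α)) = (ε, x, α) := hW
    rw [h6] at h9
    simp [h9]

/-- Local existence of integral curves of a smooth vector field on a Banach space, with smooth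
dependence on time and on the initial condition. -/
theorem exists_local_flow_of_contDiff {f : E → E} (hf : ContDiff ℝ ∞ f) (x₀ : E) :
    ∃ φ : ℝ × E → E, ContDiffAt ℝ ∞ φ (0, x₀) ∧ ∀ᶠ p in 𝓝 ((0 : ℝ), x₀),
      φ (0, p.2) = p.2 ∧ HasDerivAt (fun t ↦ φ (t, p.2)) (f (φ p)) p.1 := by
  obtain ⟨ε, hε, a, r, L, K, hr, hpl⟩ := IsPicardLindelof.of_contDiffAt_one
    (hf.contDiffAt.of_le (by simp) : ContDiffAt ℝ 1 f x₀)
  obtain ⟨α, hα, hcont⟩ := (hpl 0).exists_forall_mem_closedBall_eq_hasDerivWithinAt_continuousOn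
  simp only [zero_sub, zero_add] at hα hcont
  have hα' : ∀ x ∈ Metric.closedBall x₀ (r : ℝ), ∀ t ∈ Ioo (-ε) ε,
      HasDerivAt (fun t ↦ α (x, t)) (f (α (x, t))) t := fun x hx t ht ↦
    ((hα x hx).2 t (Ioo_subset_Icc_self ht)).hasDerivAt (Icc_mem_nhds ht.1 ht.2)
  have hα0 : ∀ x ∈ Metric.closedBall x₀ (r : ℝ), α (x, 0) = x := fun x hx ↦ (hα x hx).1
  have hx₀ : x₀ ∈ Metric.closedBall x₀ (r : ℝ) := Metric.mem_closedBall_self r.2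
  have hgood : ∀ᶠ p in 𝓝 ((0 : ℝ), x₀), p.1 ∈ Ioo (-ε) ε ∧ p.2 ∈ Metric.closedBall x₀ (r : ℝ) := by
    have h1 : Ioo (-ε) ε ∈ 𝓝 (0 : ℝ) := Ioo_mem_nhds (by linarith) hε
    have h2 : Metric.closedBall x₀ (r : ℝ) ∈ 𝓝 x₀ := Metric.closedBall_mem_nhds _ (by exact_mod_cast hr)
    exact prod_mem_nhds h1 h2
  refine ⟨fun p ↦ α (p.2, p.1), ?_, ?_⟩
  · obtain ⟨A, hA, W, hW, hAW⟩ := exists_contDiffAt_integral_equation hf x₀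
    -- The rescaled curve s ↦ α(x, ts) solves the integral equation with ε = t. It therefore equals
    -- A(t, x), whose value at s = 1 is the flow at time t.
    let ev : C(Icc (0 : ℝ) 1, E) →L[ℝ] E := ContinuousMap.evalCLM ℝ ⟨1, by simp⟩
    have h1 : ContDiffAt ℝ ∞ (fun p ↦ ev (A p)) ((0 : ℝ), x₀) :=
      ev.contDiff.contDiffAt.comp _ hA
    refine h1.congr_of_eventuallyEq ?_
    obtain ⟨δ, hδ, hδW⟩ := Metric.mem_nhds_iff.1 hW
    have hcat : ContinuousAt α (x₀, 0) := hcont.continuousAt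
      (prod_mem_nhds (Metric.closedBall_mem_nhds _ (by exact_mod_cast hr))
        (Icc_mem_nhds (by linarith) hε))
    obtain ⟨η, hη, hηα⟩ := Metric.continuousAt_iff.1 hcat (δ / 2) (half_pos hδ)
    have hsmall : ∀ᶠ p in 𝓝 ((0 : ℝ), x₀), dist p ((0 : ℝ), x₀) < min (δ / 2) η :=
      Metric.ball_mem_nhds _ (lt_min (half_pos hδ) hη)
    filter_upwards [hgood, hsmall] with p hp hps
    obtain ⟨t, x⟩ := p
    rw [Prod.dist_eq, max_lt_iff, lt_min_iff, lt_min_iff] at hps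
    simp only [Real.dist_eq, sub_zero] at hps hp
    have hscale : ∀ s ∈ Icc (0 : ℝ) 1, t * s ∈ Ioo (-ε) ε ∧ |t * s| ≤ |t| := by
      intro s hs
      have h2 : |t * s| ≤ |t| := by
        rw [abs_mul, abs_of_nonneg hs.1]
        exact mul_le_of_le_one_right (abs_nonneg _) hs.2
      exact ⟨abs_lt.1 (h2.trans_lt (abs_lt.2 hp.1)), h2⟩
    have hβc : Continuous fun s : Icc (0 : ℝ) 1 ↦ α (x, t * s) := by
      refine hcont.comp_continuous (by fun_prop) fun s ↦ ⟨hp.2, ?_⟩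
      exact Ioo_subset_Icc_self (hscale s s.2).1
    let β : C(Icc (0 : ℝ) 1, E) := ⟨fun s ↦ α (x, t * s), hβc⟩
    have hβW : (t, x, β) ∈ W := by
      apply hδW
      rw [Metric.mem_ball, Prod.dist_eq, Prod.dist_eq, max_lt_iff, max_lt_iff]
      refine ⟨?_, ?_, ?_⟩
      · simp only [Real.dist_eq, sub_zero]; linarith [hps.1.1]
      · change dist x x₀ < δ
        linarith [hps.2.1]
      · refine lt_of_le_of_lt ((ContinuousMap.dist_le (half_pos hδ).le).2 fun s ↦ ?_) (half_lt_self hδ)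
        have h3 := @hηα (x, t * s) (by
          rw [Prod.dist_eq, max_lt_iff]
          refine ⟨hps.2.2, ?_⟩
          simp only [Real.dist_eq, sub_zero]
          exact (hscale s s.2).2.trans_lt hps.1.2)
        rw [hα0 x₀ hx₀] at h3
        exact h3.le
    have hβ := hAW t x β hβW (by
      intro s
      have h4 : ∀ u ∈ uIcc (0 : ℝ) s, HasDerivAt (fun u ↦ α (x, t * u))
          (t • f (IccExtend zero_le_one β u)) u := by
        intro u hu
        rw [uIcc_of_le s.2.1] at hu
        have hu' : u ∈ Icc (0 : ℝ) 1 := ⟨hu.1, hu.2.trans s.2.2⟩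
        rw [IccExtend_of_mem _ _ hu']
        have h5 := hα' x hp.2 (t * u) (hscale u hu').1
        have h6 : HasDerivAt (fun u : ℝ ↦ t * u) t u := by
          simpa using (hasDerivAt_id u).const_mul t
        exact h5.scomp u h6
      have h7 : Continuous fun u ↦ t • f (IccExtend zero_le_one β u) :=
        (hf.continuous.comp β.continuous.Icc_extend').const_smul t
      have h8 := intervalIntegral.integral_eq_sub_of_hasDerivAt h4 (h7.intervalIntegrable _ _)
      rw [intervalIntegral.integral_smul] at h8
      rw [h8, mul_zero, hα0 x hp.2]
      change α (x, t * s) = _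
      abel)
    change α (x, t) = ev (A (t, x))
    rw [← hβ]
    change α (x, t) = α (x, t * 1)
    rw [mul_one]
  · filter_upwards [hgood] with p hp
    exact ⟨hα0 _ hp.2, hα' _ hp.2 _ hp.1⟩

end LocalFlow

/-! ### Differentiation under the integral sign. -/

section ParametricIntegral

universe v
variable {E : Type v} [NormedAddCommGroup E] [NormedSpace ℝ E]
  {F : Type v} [NormedAddCommGroup F] [NormedSpace ℝ F]

/-- The integral is a composite: an affine map x ↦ (t ↦ (t, x)) into a space of curves, the
composition operator of f, the primitive, and evaluation at 1. Each factor is smooth, and the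
formula for the derivative is read off by evaluating at each t. -/
theorem contDiff_integral_zero_one {f : ℝ × E → F} (hf : ContDiff ℝ ∞ f) :
    ContDiff ℝ ∞ (fun x ↦ ∫ t in (0 : ℝ)..1, f (t, x)) ∧ ∀ x v,
      fderiv ℝ (fun x ↦ ∫ t in (0 : ℝ)..1, f (t, x)) x v =
        ∫ t in (0 : ℝ)..1, fderiv ℝ (fun y ↦ f (t, y)) x v := by
  let I := ContinuousMap.primitiveCLM F
  let one : Icc (0 : ℝ) 1 := ⟨1, by simp⟩
  let ev : ∀ t : Icc (0 : ℝ) 1, C(Icc (0 : ℝ) 1, F) →L[ℝ] F := fun t ↦ ContinuousMap.evalCLM ℝ t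
  let lin : E →L[ℝ] C(Icc (0 : ℝ) 1, ℝ × E) :=
    (ContinuousMap.constCLM' (ℝ × E)).comp (ContinuousLinearMap.inr ℝ ℝ E)
  let base : C(Icc (0 : ℝ) 1, ℝ × E) := ⟨fun t ↦ (t, 0), by fun_prop⟩
  let c : E → C(Icc (0 : ℝ) 1, F) := fun x ↦ (⟨f, hf.continuous⟩ : C(ℝ × E, F)).comp (base + lin x)
  have hc : ContDiff ℝ ∞ c := (ContinuousMap.contDiff_comp_left ⟨f, hf.continuous⟩ hf).comp
    (contDiff_const.add lin.contDiff)
  have hct : ∀ x t, c x t = f (t, x) := by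
    intro x t
    change f ((t : ℝ) + 0, 0 + x) = _
    rw [add_zero, zero_add]
  have hint : ∀ g : C(Icc (0 : ℝ) 1, F), ∀ h : ℝ → F, (∀ t : Icc (0 : ℝ) 1, g t = h t) →
      ev one (I g) = ∫ t in (0 : ℝ)..1, h t := by
    intro g h hgh
    change ∫ s in (0 : ℝ)..1, IccExtend zero_le_one g s = _
    refine intervalIntegral.integral_congr fun s hs ↦ ?_
    rw [uIcc_of_le zero_le_one] at hs
    rw [IccExtend_of_mem _ _ hs]
    exact hgh ⟨s, hs⟩
  have hG : (fun x ↦ ∫ t in (0 : ℝ)..1, f (t, x)) = fun x ↦ ev one (I (c x)) := by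
    funext x
    exact (hint (c x) (fun t ↦ f (t, x)) (hct x)).symm
  rw [hG]
  refine ⟨(ev one).contDiff.comp (I.contDiff.comp hc), fun x v ↦ ?_⟩
  have hd : HasFDerivAt c (fderiv ℝ c x) x := (hc.contDiffAt.differentiableAt (by simp)).hasFDerivAt
  have h1 : HasFDerivAt (fun x ↦ ev one (I (c x))) ((ev one).comp (I.comp (fderiv ℝ c x))) x :=
    (ev one).hasFDerivAt.comp x (I.hasFDerivAt.comp x hd)
  rw [h1.fderiv]
  refine hint (fderiv ℝ c x v) _ fun t ↦ ?_
  have h2 : HasFDerivAt (fun y ↦ ev t (c y)) ((ev t).comp (fderiv ℝ c x)) x :=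
    (ev t).hasFDerivAt.comp x hd
  have h3 : (fun y ↦ ev t (c y)) = fun y ↦ f (t, y) := funext fun y ↦ hct y t
  rw [h3] at h2
  rw [h2.fderiv]
  rfl

/-- Multiplying f by a bump function of x that is 1 near the given point and supported in V reduces
to the globally smooth case. -/
theorem contDiffAt_integral_zero_one [FiniteDimensional ℝ E] {f : ℝ × E → F} {V : Set E}
    (hV : IsOpen V) (hf : ContDiffOn ℝ ∞ f (univ ×ˢ V)) {x : E} (hx : x ∈ V) :
    ContDiffAt ℝ ∞ (fun x ↦ ∫ t in (0 : ℝ)..1, f (t, x)) x ∧ ∀ v,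
      fderiv ℝ (fun x ↦ ∫ t in (0 : ℝ)..1, f (t, x)) x v =
        ∫ t in (0 : ℝ)..1, fderiv ℝ (fun y ↦ f (t, y)) x v := by
  obtain ⟨ρ, hρ, hρs, hρ1⟩ : ∃ ρ : E → ℝ, ContDiff ℝ ∞ ρ ∧ tsupport ρ ⊆ V ∧ ρ =ᶠ[𝓝 x] 1 := by
    obtain ⟨R, hR, hRV⟩ := Metric.nhds_basis_closedBall.mem_iff.1 (hV.mem_nhds hx)
    let b : ContDiffBump x := ⟨R / 2, R, half_pos hR, half_lt_self hR⟩
    exact ⟨b, b.contDiff, by rw [b.tsupport_eq]; exact hRV, b.eventuallyEq_one⟩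
  let g : ℝ × E → F := fun p ↦ ρ p.2 • f p
  have hg : ContDiff ℝ ∞ g := by
    rw [contDiff_iff_contDiffAt]
    rintro ⟨t, y⟩
    by_cases hy : y ∈ V
    · exact (hρ.contDiffAt.comp _ contDiffAt_snd).smul
        (hf.contDiffAt ((isOpen_univ.prod hV).mem_nhds ⟨mem_univ _, hy⟩))
    · have h0 : ρ =ᶠ[𝓝 y] 0 := notMem_tsupport_iff_eventuallyEq.1 fun h ↦ hy (hρs h)
      have h1 : g =ᶠ[𝓝 (t, y)] fun _ ↦ 0 := by
        have h2 : Filter.Tendsto Prod.snd (𝓝 (t, y)) (𝓝 y) := continuous_snd.continuousAt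
        filter_upwards [h2.eventually h0] with p hp
        have hp' : ρ p.2 = 0 := hp
        simp [g, hp']
      exact contDiffAt_const.congr_of_eventuallyEq h1
  obtain ⟨h1, h2⟩ := contDiff_integral_zero_one hg
  have h3 : (fun x ↦ ∫ t in (0 : ℝ)..1, f (t, x)) =ᶠ[𝓝 x] fun x ↦ ∫ t in (0 : ℝ)..1, g (t, x) := by
    filter_upwards [hρ1] with y hy
    have hy' : ρ y = 1 := hy
    simp [g, hy']
  refine ⟨h1.contDiffAt.congr_of_eventuallyEq h3, fun v ↦ ?_⟩
  rw [h3.fderiv_eq, h2]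
  refine intervalIntegral.integral_congr fun t _ ↦ ?_
  have h4 : (fun y ↦ g (t, y)) =ᶠ[𝓝 x] fun y ↦ f (t, y) := by
    filter_upwards [hρ1] with y hy
    have hy' : ρ y = 1 := hy
    simp [g, hy']
  simp only [h4.fderiv_eq]

end ParametricIntegral

/-! ### Inverse functions, vector fields and curves on manifolds. -/

section ManifoldCalculus

variable {E : Type*} [NormedAddCommGroup E] [NormedSpace ℝ E]
  {HM : Type*} [TopologicalSpace HM] {I : ModelWithCorners ℝ E HM}
  {M : Type*} [TopologicalSpace M] [ChartedSpace HM M]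
  {E' : Type*} [NormedAddCommGroup E'] [NormedSpace ℝ E']
  {HM' : Type*} [TopologicalSpace HM'] {I' : ModelWithCorners ℝ E' HM'}
  {M' : Type*} [TopologicalSpace M'] [ChartedSpace HM' M']

/-- The inverse function theorem on manifolds without boundary. -/
theorem ContMDiffAt.exists_local_inverse [I.Boundaryless] [I'.Boundaryless] [CompleteSpace E] [CompleteSpace E'] {n : WithTop ℕ∞}
    [IsManifold I n M] [IsManifold I' n M'] (hn : n ≠ 0)
    {f : M → M'} {x : M} (hf : ContMDiffAt I I' n f x) (hbij : Bijective (mfderiv I I' f x)) :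
    ∃ g : M' → M, ContMDiffAt I' I n g (f x) ∧ (∀ᶠ y in 𝓝 x, g (f y) = y) ∧
      ∀ᶠ z in 𝓝 (f x), f (g z) = z := by
  let F : E → E' := writtenInExtChartAt I I' x f
  let y₀ := extChartAt I x x
  have hF : ContDiffAt ℝ n F y₀ := by
    have := (contMDiffAt_iff.1 hf).2
    rwa [I.range_eq_univ, contDiffWithinAt_univ] at this
  have hFd : DifferentiableAt ℝ F y₀ := hF.differentiableAt hn
  have hd : mfderiv I I' f x = fderiv ℝ F y₀ := by
    rw [(hf.mdifferentiableAt hn).mfderiv, I.range_eq_univ, fderivWithin_univ]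
  let A : E →L[ℝ] E' := fderiv ℝ F y₀
  have hA : Bijective A := by
    have h : Bijective (fderiv ℝ F y₀) := by rw [← hd]; exact hbij
    exact h
  let e : E ≃L[ℝ] E' := ContinuousLinearEquiv.ofBijective A
    (LinearMap.ker_eq_bot.2 hA.1) (LinearMap.range_eq_top.2 hA.2)
  have hFe : HasFDerivAt F (e : E →L[ℝ] E') y₀ := by
    have : (e : E →L[ℝ] E') = A := ContinuousLinearEquiv.coe_ofBijective _ _ _
    rw [this]; exact hFd.hasFDerivAt
  let L := hF.localInverse hFe hn
  have hL : ContDiffAt ℝ n L (F y₀) := hF.to_localInverse hFe hn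
  have hLF : ∀ᶠ y in 𝓝 y₀, L (F y) = y := (hF.hasStrictFDerivAt' hFe hn).eventually_left_inverse
  have hFL : ∀ᶠ z in 𝓝 (F y₀), F (L z) = z := (hF.hasStrictFDerivAt' hFe hn).eventually_right_inverse
  have hLy : L (F y₀) = y₀ := hLF.self_of_nhds
  have hFy : F y₀ = extChartAt I' (f x) (f x) := by simp [F, y₀, writtenInExtChartAt]
  refine ⟨fun z ↦ (extChartAt I x).symm (L (extChartAt I' (f x) z)), ?_, ?_, ?_⟩
  · have h1 : ContMDiffAt I' 𝓘(ℝ, E') n (extChartAt I' (f x)) (f x) := contMDiffAt_extChartAt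
    have h2 : ContMDiffAt 𝓘(ℝ, E') 𝓘(ℝ, E) n L (extChartAt I' (f x) (f x)) := by
      rw [← hFy]; exact hL.contMDiffAt
    have h3 : ContMDiffAt 𝓘(ℝ, E) I n (extChartAt I x).symm (L (extChartAt I' (f x) (f x))) := by
      rw [← hFy, hLy]
      exact (contMDiffOn_extChartAt_symm x).contMDiffAt (extChartAt_target_mem_nhds x)
    exact h3.comp (f x) (h2.comp (f x) h1)
  · have h1 : ∀ᶠ y in 𝓝 x, L (F (extChartAt I x y)) = extChartAt I x y :=
      (continuousAt_extChartAt x).eventually hLF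
    filter_upwards [h1, extChartAt_source_mem_nhds (I := I) x] with y hy hys
    have h2 : F (extChartAt I x y) = extChartAt I' (f x) (f y) := by
      change extChartAt I' (f x) (f ((extChartAt I x).symm (extChartAt I x y))) = _
      rw [(extChartAt I x).left_inv hys]
    rw [← h2, hy, (extChartAt I x).left_inv hys]
  · have hc : ContinuousAt (extChartAt I' (f x)) (f x) := continuousAt_extChartAt _
    have h1 : ∀ᶠ z in 𝓝 (f x), F (L (extChartAt I' (f x) z)) = extChartAt I' (f x) z := by
      refine hc.eventually (p := fun w ↦ F (L w) = w) ?_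
      rw [← hFy]; exact hFL
    have hcL : Filter.Tendsto (fun z ↦ (extChartAt I x).symm (L (extChartAt I' (f x) z)))
        (𝓝 (f x)) (𝓝 x) := by
      have h2 : Filter.Tendsto L (𝓝 (extChartAt I' (f x) (f x))) (𝓝 y₀) := by
        have := hL.continuousAt.tendsto
        rwa [hLy, hFy] at this
      have h3 : Filter.Tendsto (extChartAt I x).symm (𝓝 y₀) (𝓝 x) := by
        have := continuousAt_extChartAt_symm (I := I) x
        simpa [ContinuousAt, y₀] using this
      exact h3.comp (h2.comp hc)
    have h4 : ∀ᶠ y in 𝓝 x, f y ∈ (extChartAt I' (f x)).source :=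
      hf.continuousAt.eventually (extChartAt_source_mem_nhds (I := I') (f x))
    filter_upwards [h1, hcL.eventually h4, extChartAt_source_mem_nhds (I := I') (f x)]
      with z hz hz2 hzs
    have h5 : F (L (extChartAt I' (f x) z)) =
      extChartAt I' (f x) (f ((extChartAt I x).symm (L (extChartAt I' (f x) z)))) := rfl
    rw [h5] at hz
    exact (extChartAt I' (f x)).injOn hz2 hzs hz

/-- The derivative of a smooth function along a smooth vector field is smooth. -/
theorem ContMDiffOn.mfderiv_vectorField [IsManifold I ∞ M] {U : Set M} (hU : IsOpen U)
    {F : Type*} [NormedAddCommGroup F] [NormedSpace ℝ F] {h : M → F}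
    (hh : ContMDiffOn I 𝓘(ℝ, F) ∞ h U) {V : (x : M) → TangentSpace I x}
    (hV : ContMDiffOn I I.tangent ∞ (fun x ↦ (⟨x, V x⟩ : TangentBundle I M)) U) :
    ContMDiffOn I 𝓘(ℝ, F) ∞ (fun x ↦ (show F from mfderiv I 𝓘(ℝ, F) h x (V x))) U := by
  have h1 := hh.contMDiffOn_tangentMapWithin (m := ∞) (by simp) hU.uniqueMDiffOn
  have h2 := h1.comp hV (fun x hx ↦ hx)
  have h3 := (contMDiff_snd_tangentBundle_modelSpace F 𝓘(ℝ, F) (n := ∞)).comp_contMDiffOn h2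
  refine h3.congr fun x hx ↦ ?_
  change _ = mfderivWithin I 𝓘(ℝ, F) h U x (V x)
  rw [mfderivWithin_of_isOpen hU hx]

/-- Chain rule along a curve. -/
theorem HasMFDerivAt.comp_curve {γ : ℝ → M} {t : ℝ} {v : TangentSpace I (γ t)}
    (hγ : HasMFDerivAt 𝓘(ℝ, ℝ) I γ t ((1 : ℝ →L[ℝ] ℝ).smulRight v)) {f : M → M'}
    (hf : MDifferentiableAt I I' f (γ t)) :
    HasMFDerivAt 𝓘(ℝ, ℝ) I' (fun s ↦ f (γ s)) t
      ((1 : ℝ →L[ℝ] ℝ).smulRight (mfderiv I I' f (γ t) v)) := by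
  have h := hf.hasMFDerivAt.comp t hγ
  refine h.congr_mfderiv (ContinuousLinearMap.ext fun a ↦ ?_)
  symm
  change (show ℝ from a) • mfderiv I I' f (γ t) v = mfderiv I I' f (γ t) ((show ℝ from a) • v)
  rw [map_smul]

theorem HasMFDerivAt.comp_curve_hasDerivAt {F : Type*} [NormedAddCommGroup F] [NormedSpace ℝ F]
    {γ : ℝ → M} {t : ℝ} {v : TangentSpace I (γ t)}
    (hγ : HasMFDerivAt 𝓘(ℝ, ℝ) I γ t ((1 : ℝ →L[ℝ] ℝ).smulRight v)) {f : M → F}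
    (hf : MDifferentiableAt I 𝓘(ℝ, F) f (γ t)) :
    HasDerivAt (fun s ↦ f (γ s)) (show F from mfderiv I 𝓘(ℝ, F) f (γ t) v) t := by
  have h : HasFDerivAt (fun s ↦ f (γ s))
      ((1 : ℝ →L[ℝ] ℝ).smulRight (show F from mfderiv I 𝓘(ℝ, F) f (γ t) v)) t :=
    hasMFDerivAt_iff_hasFDerivAt.1 (hγ.comp_curve hf)
  have h' := h.hasDerivAt
  have h1 : ((1 : ℝ →L[ℝ] ℝ).smulRight (show F from mfderiv I 𝓘(ℝ, F) f (γ t) v)) 1 =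
      (show F from mfderiv I 𝓘(ℝ, F) f (γ t) v) := one_smul ℝ (show F from _)
  rwa [h1] at h'

end ManifoldCalculus

/-! ### Local flows on manifolds. -/

section LocalFlow

variable {E : Type*} [NormedAddCommGroup E] [NormedSpace ℝ E] [FiniteDimensional ℝ E]
  {HM : Type*} [TopologicalSpace HM] {I : ModelWithCorners ℝ E HM} [I.Boundaryless]
  {M : Type*} [TopologicalSpace M] [ChartedSpace HM M] [IsManifold I ∞ M]

/-- The local flow of a smooth vector field on a manifold. -/
theorem ContMDiffOn.exists_local_flow {U : Set M} (hU : IsOpen U) {V : (x : M) → TangentSpace I x}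
    (hV : ContMDiffOn I I.tangent ∞ (fun x ↦ (⟨x, V x⟩ : TangentBundle I M)) U)
    {x₀ : M} (hx₀ : x₀ ∈ U) :
    ∃ φ : ℝ × M → M, ContMDiffAt (𝓘(ℝ, ℝ).prod I) I ∞ φ (0, x₀) ∧
      ∀ᶠ p in 𝓝 ((0 : ℝ), x₀), φ (0, p.2) = p.2 ∧
        HasMFDerivAt 𝓘(ℝ, ℝ) I (fun t ↦ φ (t, p.2)) p.1
          ((1 : ℝ →L[ℝ] ℝ).smulRight (V (φ p))) := by
  have : CompleteSpace E := FiniteDimensional.complete ℝ E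
  let χ := extChartAt I x₀
  let y₀ := χ x₀
  have hχ : ContMDiffOn I 𝓘(ℝ, E) ∞ χ χ.source := by
    have := contMDiffOn_extChartAt (I := I) (n := ∞) (x := x₀)
    rwa [← extChartAt_source I] at this
  have hχs : ContMDiffOn 𝓘(ℝ, E) I ∞ χ.symm χ.target := contMDiffOn_extChartAt_symm x₀
  have hso : IsOpen χ.source := isOpen_extChartAt_source x₀
  have hto : IsOpen χ.target := isOpen_extChartAt_target x₀
  have hx₀s : x₀ ∈ χ.source := mem_extChartAt_source x₀
  have hy₀t : y₀ ∈ χ.target := χ.map_source hx₀s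
  let W := χ.target ∩ χ.symm ⁻¹' U
  have hWo : IsOpen W := hχs.continuousOn.isOpen_inter_preimage hto hU
  have hy₀W : y₀ ∈ W := ⟨hy₀t, by change χ.symm (χ x₀) ∈ U; rwa [χ.left_inv hx₀s]⟩
  let fh : E → E := fun y ↦ mfderiv I 𝓘(ℝ, E) χ (χ.symm y) (V (χ.symm y))
  have hfh : ContDiffOn ℝ ∞ fh W := by
    have h1 := (hχ.mono inter_subset_left).mfderiv_vectorField (hso.inter hU)
      (hV.mono inter_subset_right)
    have h2 : ContMDiffOn 𝓘(ℝ, E) 𝓘(ℝ, E) ∞ fh W :=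
      h1.comp (hχs.mono inter_subset_left) fun y hy ↦ ⟨χ.map_target hy.1, hy.2⟩
    exact h2.contDiffOn
  obtain ⟨ρ, hρ, hρs, hρ1⟩ : ∃ ρ : E → ℝ, ContDiff ℝ ∞ ρ ∧ tsupport ρ ⊆ W ∧ ρ =ᶠ[𝓝 y₀] 1 := by
    obtain ⟨R, hR, hRV⟩ := Metric.nhds_basis_closedBall.mem_iff.1 (hWo.mem_nhds hy₀W)
    let b : ContDiffBump y₀ := ⟨R / 2, R, half_pos hR, half_lt_self hR⟩
    exact ⟨b, b.contDiff, by rw [b.tsupport_eq]; exact hRV, b.eventuallyEq_one⟩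
  -- The field in the chart is cut off to a global smooth field on the model space; near the base
  -- point nothing changes.
  let f : E → E := fun y ↦ ρ y • fh y
  have hf : ContDiff ℝ ∞ f := by
    rw [contDiff_iff_contDiffAt]
    intro y
    by_cases hy : y ∈ W
    · exact hρ.contDiffAt.smul (hfh.contDiffAt (hWo.mem_nhds hy))
    · have h0 : ρ =ᶠ[𝓝 y] 0 := notMem_tsupport_iff_eventuallyEq.1 fun h ↦ hy (hρs h)
      have h1 : f =ᶠ[𝓝 y] fun _ ↦ 0 := by
        filter_upwards [h0] with p hp
        have hp' : ρ p = 0 := hp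
        simp [f, hp']
      exact contDiffAt_const.congr_of_eventuallyEq h1
  obtain ⟨φ, hφ, hφ'⟩ := exists_local_flow_of_contDiff hf y₀
  have hφ0 : φ (0, y₀) = y₀ := hφ'.self_of_nhds.1
  let q : ℝ × M → ℝ × E := fun p ↦ (p.1, χ p.2)
  have hq : ContMDiffAt (𝓘(ℝ, ℝ).prod I) 𝓘(ℝ, ℝ × E) ∞ q (0, x₀) := by
    have h1 : ContMDiffAt I 𝓘(ℝ, E) ∞ χ x₀ := contMDiffAt_extChartAt
    have h2 : ContMDiffAt (𝓘(ℝ, ℝ).prod I) 𝓘(ℝ, E) ∞ (fun p : ℝ × M ↦ χ p.2) (0, x₀) :=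
      ContMDiffAt.comp (0, x₀) h1 contMDiffAt_snd
    exact contMDiffAt_fst.prodMk_space h2
  have hφq : ContMDiffAt (𝓘(ℝ, ℝ).prod I) 𝓘(ℝ, E) ∞ (fun p ↦ φ (q p)) (0, x₀) :=
    ContMDiffAt.comp (0, x₀) (g := φ) (f := q) (I' := 𝓘(ℝ, ℝ × E)) hφ.contMDiffAt hq
  refine ⟨fun p ↦ χ.symm (φ (q p)), ?_, ?_⟩
  · refine ContMDiffAt.comp (0, x₀) (g := χ.symm) ?_ hφq
    change ContMDiffAt _ _ _ _ (φ (0, y₀))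
    rw [hφ0]
    exact hχs.contMDiffAt (hto.mem_nhds hy₀t)
  · have h1 : ∀ᶠ y in 𝓝 y₀, y ∈ W ∧ ρ y = 1 := by
      filter_upwards [hWo.mem_nhds hy₀W, hρ1] with y hy hy' using ⟨hy, hy'⟩
    have h2 : ∀ᶠ p in 𝓝 ((0 : ℝ), x₀), φ (q p) ∈ W ∧ ρ (φ (q p)) = 1 := by
      refine hφq.continuousAt.eventually (p := fun y ↦ y ∈ W ∧ ρ y = 1) ?_
      change ∀ᶠ y in 𝓝 (φ (0, y₀)), _
      rw [hφ0]; exact h1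
    have h3 : ∀ᶠ p in 𝓝 ((0 : ℝ), x₀), p.2 ∈ χ.source :=
      continuousAt_snd.eventually (hso.mem_nhds hx₀s)
    filter_upwards [h2, h3, hq.continuousAt.eventually hφ'] with p hp hps hpφ
    refine ⟨?_, ?_⟩
    · change χ.symm (φ (0, χ p.2)) = p.2
      have : φ (0, χ p.2) = χ p.2 := hpφ.1
      rw [this, χ.left_inv hps]
    · have h4 : HasDerivAt (fun t ↦ φ (t, χ p.2)) (fh (φ (q p))) p.1 := by
        have := hpφ.2
        simpa [f, hp.2] using! this
      have h5 : HasMFDerivAt 𝓘(ℝ, ℝ) 𝓘(ℝ, E) (fun t ↦ φ (t, χ p.2)) p.1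
          ((1 : ℝ →L[ℝ] ℝ).smulRight (fh (φ (q p)))) := h4.hasFDerivAt.hasMFDerivAt
      have h6 : MDifferentiableAt 𝓘(ℝ, E) I χ.symm (φ (q p)) :=
        (hχs.contMDiffAt (hto.mem_nhds hp.1.1)).mdifferentiableAt (by simp)
      have h7 := h5.comp_curve (I := 𝓘(ℝ, E)) (γ := fun t ↦ φ (t, χ p.2)) h6
      have h8 : mfderiv 𝓘(ℝ, E) I χ.symm (φ (q p)) (fh (φ (q p))) = V (χ.symm (φ (q p))) := by
        have h9 := mfderivWithin_extChartAt_symm_comp_mfderiv_extChartAt (I := I) (x := x₀) hp.1.1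
        rw [I.range_eq_univ, mfderivWithin_univ] at h9
        exact congrArg (fun A ↦ A (V (χ.symm (φ (q p))))) h9
      change HasMFDerivAt 𝓘(ℝ, ℝ) I (fun t ↦ χ.symm (φ (t, χ p.2))) p.1
        ((1 : ℝ →L[ℝ] ℝ).smulRight (V (χ.symm (φ (q p)))))
      rw [← h8]
      exact h7

end LocalFlow

/-! ### Integrals depending on a point of a manifold. -/

section ParametricIntegral

universe v
variable {E : Type v} [NormedAddCommGroup E] [NormedSpace ℝ E]
  {HM : Type*} [TopologicalSpace HM] {I : ModelWithCorners ℝ E HM} [I.Boundaryless]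
  {M : Type*} [TopologicalSpace M] [ChartedSpace HM M]
  {F : Type v} [NormedAddCommGroup F] [NormedSpace ℝ F]

theorem MDifferentiableAt.mfderiv_eq_fderiv_chart {h : M → F} {x : M}
    (hh : MDifferentiableAt I 𝓘(ℝ, F) h x) :
    mfderiv I 𝓘(ℝ, F) h x = fderiv ℝ (fun y ↦ h ((extChartAt I x).symm y)) (extChartAt I x x) := by
  rw [hh.mfderiv, I.range_eq_univ, fderivWithin_univ]
  rfl

theorem ContMDiff.integral_zero_one [FiniteDimensional ℝ E] [IsManifold I ∞ M] {f : ℝ × M → F}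
    (hf : ContMDiff (𝓘(ℝ, ℝ).prod I) 𝓘(ℝ, F) ∞ f) :
    ContMDiff I 𝓘(ℝ, F) ∞ (fun x ↦ ∫ t in (0 : ℝ)..1, f (t, x)) ∧ ∀ x v,
      (show F from mfderiv I 𝓘(ℝ, F) (fun x ↦ ∫ t in (0 : ℝ)..1, f (t, x)) x v) =
        ∫ t in (0 : ℝ)..1, (show F from mfderiv I 𝓘(ℝ, F) (fun y ↦ f (t, y)) x v) := by
  have key : ∀ x : M, ContMDiffAt I 𝓘(ℝ, F) ∞ (fun x ↦ ∫ t in (0 : ℝ)..1, f (t, x)) x ∧ ∀ v,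
      (show F from mfderiv I 𝓘(ℝ, F) (fun x ↦ ∫ t in (0 : ℝ)..1, f (t, x)) x v) =
        ∫ t in (0 : ℝ)..1, (show F from mfderiv I 𝓘(ℝ, F) (fun y ↦ f (t, y)) x v) := by
    intro x
    let χ := extChartAt I x
    have hχs : ContMDiffOn 𝓘(ℝ, E) I ∞ χ.symm χ.target := contMDiffOn_extChartAt_symm x
    let fh : ℝ × E → F := fun p ↦ f (p.1, χ.symm p.2)
    have hfh : ContDiffOn ℝ ∞ fh (univ ×ˢ χ.target) := by
      rw [← contMDiffOn_iff_contDiffOn]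
      refine hf.comp_contMDiffOn (f := fun p : ℝ × E ↦ (p.1, χ.symm p.2)) ?_
      have h3 : ContMDiffOn 𝓘(ℝ, ℝ × E) 𝓘(ℝ, ℝ) ∞ (Prod.fst : ℝ × E → ℝ) (univ ×ˢ χ.target) :=
        contDiff_fst.contMDiff.contMDiffOn
      have h4 : ContMDiffOn 𝓘(ℝ, ℝ × E) 𝓘(ℝ, E) ∞ (Prod.snd : ℝ × E → E) (univ ×ˢ χ.target) :=
        contDiff_snd.contMDiff.contMDiffOn
      exact h3.prodMk (hχs.comp h4 fun p hp ↦ hp.2)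
    obtain ⟨h1, h2⟩ := contDiffAt_integral_zero_one (isOpen_extChartAt_target x) hfh
      (mem_extChartAt_target x)
    have hG : ContMDiffAt I 𝓘(ℝ, F) ∞ (fun x ↦ ∫ t in (0 : ℝ)..1, f (t, x)) x := by
      have h3 : ContMDiffAt I 𝓘(ℝ, F) ∞ (fun z ↦ ∫ t in (0 : ℝ)..1, fh (t, χ z)) x :=
        ContMDiffAt.comp x h1.contMDiffAt contMDiffAt_extChartAt
      refine h3.congr_of_eventuallyEq ?_
      filter_upwards [extChartAt_source_mem_nhds (I := I) x] with z hz
      simp only [fh, χ, (extChartAt I x).left_inv hz]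
    refine ⟨hG, fun v ↦ ?_⟩
    rw [(hG.mdifferentiableAt (by simp)).mfderiv_eq_fderiv_chart]
    refine (h2 v).trans (intervalIntegral.integral_congr fun t _ ↦ ?_)
    have h4 : ContMDiff I 𝓘(ℝ, F) ∞ fun y ↦ f (t, y) :=
      hf.comp (contMDiff_const.prodMk contMDiff_id)
    simp only [(h4.contMDiffAt.mdifferentiableAt (by simp) :
      MDifferentiableAt I 𝓘(ℝ, F) (fun y ↦ f (t, y)) x).mfderiv_eq_fderiv_chart]
    rfl
  exact ⟨fun x ↦ (key x).1, fun x ↦ (key x).2⟩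

end ParametricIntegral

local notation "𝔼" => EuclideanSpace ℝ (Fin 2)

/-! ### Symplectic linear algebra and smoothness of the Hamiltonian field. -/

section SymplecticLinearAlgebra

variable {N : Type*} [TopologicalSpace N] [ChartedSpace (EuclideanSpace ℝ (Fin 2)) N]
  [IsManifold (𝓡 2) ∞ N]

theorem SymplecticForm.form_swap (Ω : SymplecticForm N) (x : N) (v w : TangentSpace (𝓡 2) x) :
    Ω.form x v w = -Ω.form x w v := by
  have h := Ω.alternating x (v + w)
  simp only [map_add, add_apply, Ω.alternating, zero_add, add_zero] at h
  linarith

/-- Cramer's rule on a symplectic plane. -/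
theorem SymplecticForm.cramer (Ω : SymplecticForm N) (x : N) (e₁ e₂ v : TangentSpace (𝓡 2) x)
    (h : Ω.form x e₁ e₂ ≠ 0) :
    v = (Ω.form x v e₂ / Ω.form x e₁ e₂) • e₁ + (Ω.form x e₁ v / Ω.form x e₁ e₂) • e₂ := by
  have hfin : FiniteDimensional ℝ (TangentSpace (𝓡 2) x) :=
    inferInstanceAs (FiniteDimensional ℝ 𝔼)
  have hrank : Module.finrank ℝ (TangentSpace (𝓡 2) x) = 2 :=
    (finrank_euclideanSpace_fin : Module.finrank ℝ 𝔼 = 2)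
  have hli : LinearIndependent ℝ ![e₁, e₂] := by
    rw [LinearIndependent.pair_iff]
    intro s t hst
    have h1 := congrArg (fun u ↦ Ω.form x u e₂) hst
    have h2 := congrArg (fun u ↦ Ω.form x e₁ u) hst
    simp only [map_add, map_smul, add_apply, smul_apply, mul_zero,
      Ω.alternating, add_zero, zero_add, map_zero, zero_apply,
      smul_eq_mul, mul_eq_zero, h, or_false] at h1 h2
    exact ⟨h1, h2⟩
  have hspan : Submodule.span ℝ (range ![e₁, e₂]) = ⊤ :=
    hli.span_eq_top_of_card_eq_finrank (by simp [hrank])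
  have hv : v ∈ Submodule.span ℝ (range ![e₁, e₂]) := by rw [hspan]; trivial
  rw [Matrix.range_cons, Matrix.range_cons, Matrix.range_empty, union_empty,
    singleton_union, Submodule.mem_span_pair] at hv
  obtain ⟨a, b, rfl⟩ := hv
  have h1 : Ω.form x (a • e₁ + b • e₂) e₂ = a * Ω.form x e₁ e₂ := by
    simp [Ω.alternating]
  have h2 : Ω.form x e₁ (a • e₁ + b • e₂) = b * Ω.form x e₁ e₂ := by
    simp [Ω.alternating]
  rw [h1, h2, mul_div_cancel_right₀ _ h, mul_div_cancel_right₀ _ h]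

/-- Every point has a neighbourhood with a smooth frame of the tangent bundle. -/
theorem SymplecticForm.exists_frame (Ω : SymplecticForm N) (x₀ : N) :
    ∃ U : Set N, IsOpen U ∧ x₀ ∈ U ∧ ∃ e₁ e₂ : (x : N) → TangentSpace (𝓡 2) x,
      ContMDiffOn (𝓡 2) (𝓡 2).tangent ∞ (fun x ↦ (⟨x, e₁ x⟩ : TangentBundle (𝓡 2) N)) U ∧
      ContMDiffOn (𝓡 2) (𝓡 2).tangent ∞ (fun x ↦ (⟨x, e₂ x⟩ : TangentBundle (𝓡 2) N)) U ∧
      ContMDiffOn (𝓡 2) 𝓘(ℝ, ℝ) ∞ (fun x ↦ Ω.form x (e₁ x) (e₂ x)) U ∧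
      ∀ x ∈ U, Ω.form x (e₁ x) (e₂ x) ≠ 0 := by
  let e := trivializationAt 𝔼 (TangentSpace (𝓡 2) : N → Type _) x₀
  let b : Module.Basis (Fin 2) ℝ 𝔼 := (EuclideanSpace.basisFun (Fin 2) ℝ).toBasis
  let e₁ := e.localFrame b 0
  let e₂ := e.localFrame b 1
  have h1 : ContMDiffOn (𝓡 2) (𝓡 2).tangent ∞ (fun x ↦ (⟨x, e₁ x⟩ : TangentBundle (𝓡 2) N))
    e.baseSet := e.contMDiffOn_localFrame_baseSet ∞ b 0
  have h2 : ContMDiffOn (𝓡 2) (𝓡 2).tangent ∞ (fun x ↦ (⟨x, e₂ x⟩ : TangentBundle (𝓡 2) N))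
    e.baseSet := e.contMDiffOn_localFrame_baseSet ∞ b 1
  refine ⟨e.baseSet, e.open_baseSet, FiberBundle.mem_baseSet_trivializationAt' x₀, e₁, e₂, h1, h2,
    ?_, ?_⟩
  · have h3 := ContMDiffOn.clm_bundle_apply₂ (F₁ := 𝔼) (F₂ := 𝔼) (F₃ := ℝ)
      (E₁ := (TangentSpace (𝓡 2) : N → Type _)) (E₂ := (TangentSpace (𝓡 2) : N → Type _))
      (E₃ := fun _ ↦ ℝ) Ω.contMDiff.contMDiffOn h1 h2
    intro x hx
    exact ((Bundle.contMDiffAt_section x).1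
      ((h3 x hx).contMDiffAt (e.open_baseSet.mem_nhds hx))).contMDiffWithinAt
  · intro x hx h0
    have hb := (e.isLocalFrameOn_localFrame_baseSet (𝓡 2) ∞ b)
    have hli := hb.linearIndependent hx
    have hgen := hb.generating hx
    have hz : e₁ x = 0 := by
      refine Ω.nondegenerate x _ fun w ↦ ?_
      have hw : w ∈ Submodule.span ℝ (range fun i ↦ e.localFrame b i x) := hgen trivial
      rw [Submodule.mem_span_range_iff_exists_fun] at hw
      obtain ⟨c, rfl⟩ := hw
      rw [Fin.sum_univ_two, map_add, map_smul, map_smul]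
      change c 0 • Ω.form x (e₁ x) (e₁ x) + c 1 • Ω.form x (e₁ x) (e₂ x) = 0
      rw [Ω.alternating, h0, smul_zero, smul_zero, add_zero]
    exact hli.ne_zero 0 hz

/-- In a local frame, Cramer's rule gives the coefficients of X as Ω(X, e₂) = -dH(e₂) and Ω(e₁, X) =
dH(e₁) divided by Ω(e₁, e₂), all of which are smooth. -/
theorem SymplecticForm.contMDiff_hamiltonianVectorField (Ω : SymplecticForm N) {H : N → ℝ}
    (hH : ContMDiff (𝓡 2) 𝓘(ℝ, ℝ) ∞ H) :
    ContMDiff (𝓡 2) (𝓡 2).tangent ∞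
      (fun x ↦ (⟨x, Ω.hamiltonianVectorField H x⟩ : TangentBundle (𝓡 2) N)) := by
  intro x₀
  obtain ⟨U, hU, hx₀, e₁, e₂, h1, h2, hω, hne⟩ := Ω.exists_frame x₀
  have d1 := hH.contMDiffOn.mfderiv_vectorField hU h1
  have d2 := hH.contMDiffOn.mfderiv_vectorField hU h2
  have hinv : ContMDiffOn (𝓡 2) 𝓘(ℝ, ℝ) ∞ (fun x ↦ (Ω.form x (e₁ x) (e₂ x))⁻¹) U := by
    intro x hx
    have h3 : ContDiffAt ℝ ∞ (fun r : ℝ ↦ r⁻¹) (Ω.form x (e₁ x) (e₂ x)) := contDiffAt_inv ℝ (hne x hx)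
    exact h3.contMDiffAt.comp_contMDiffWithinAt x (hω x hx)
  have hX := ((d2.neg.mul hinv).smul_section h1).add_section ((d1.mul hinv).smul_section h2)
  refine (hX.congr fun x hx ↦ ?_).contMDiffAt (hU.mem_nhds hx₀)
  congr 1
  have g1 := Ω.form_hamiltonianVectorField H x (e₁ x)
  have g2 := Ω.form_hamiltonianVectorField H x (e₂ x)
  have g3 := Ω.form_swap x (e₁ x) (Ω.hamiltonianVectorField H x)
  rw [g1, neg_neg] at g3
  have g4 := Ω.cramer x (e₁ x) (e₂ x) (Ω.hamiltonianVectorField H x) (hne x hx)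
  rw [g2, g3, div_eq_mul_inv, div_eq_mul_inv] at g4
  exact g4

end SymplecticLinearAlgebra

/-! ### Global smooth flows. -/

section SmoothFlow

variable {E : Type*} [NormedAddCommGroup E] [NormedSpace ℝ E] {H : Type*} [TopologicalSpace H]
  {I : ModelWithCorners ℝ E H} {M : Type*} [TopologicalSpace M] [ChartedSpace H M]

theorem HasMFDerivAt.hasDerivAt_comp {F : Type*} [NormedAddCommGroup F] [NormedSpace ℝ F]
    {γ : ℝ → M} {t : ℝ} {v : TangentSpace I (γ t)}
    (hγ : HasMFDerivAt 𝓘(ℝ, ℝ) I γ t ((1 : ℝ →L[ℝ] ℝ).smulRight v)) {f : M → F}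
    (hf : MDifferentiableAt I 𝓘(ℝ, F) f (γ t)) :
    HasDerivAt (fun s ↦ f (γ s)) (mvfderiv I f (γ t) v) t :=
  hγ.comp_curve_hasDerivAt hf

/-- A smooth global flow of the vector field `V`. -/
structure SmoothFlow (V : (x : M) → TangentSpace I x) where
  /-- The time `t` map of the flow. -/
  toFun : ℝ → M → M
  map_zero (x : M) : toFun 0 x = x
  map_add (s t : ℝ) (x : M) : toFun (s + t) x = toFun s (toFun t x)
  isMIntegralCurve (x : M) : IsMIntegralCurve (fun t ↦ toFun t x) V
  eq_of_isMIntegralCurve (γ : ℝ → M) (hγ : IsMIntegralCurve γ V) (t : ℝ) : γ t = toFun t (γ 0)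
  contMDiff : ContMDiff (𝓘(ℝ, ℝ).prod I) I ∞ (fun p : ℝ × M ↦ toFun p.1 p.2)

namespace SmoothFlow

variable {V : (x : M) → TangentSpace I x} (Φ : SmoothFlow V)

theorem contMDiff_time (t : ℝ) : ContMDiff I I ∞ (Φ.toFun t) :=
  Φ.contMDiff.comp (contMDiff_const.prodMk contMDiff_id)

theorem continuous_uncurry : Continuous (fun p : ℝ × M ↦ Φ.toFun p.1 p.2) := Φ.contMDiff.continuous

theorem neg_cancel (t : ℝ) (x : M) : Φ.toFun (-t) (Φ.toFun t x) = x := by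
  rw [← Φ.map_add, neg_add_cancel, Φ.map_zero]

theorem cancel_neg (t : ℝ) (x : M) : Φ.toFun t (Φ.toFun (-t) x) = x := by
  rw [← Φ.map_add, add_neg_cancel, Φ.map_zero]

theorem comm (s t : ℝ) (x : M) : Φ.toFun s (Φ.toFun t x) = Φ.toFun t (Φ.toFun s x) := by
  rw [← Φ.map_add, add_comm, Φ.map_add]

theorem injective (t : ℝ) : Injective (Φ.toFun t) := fun x y h ↦ by
  rw [← Φ.neg_cancel t x, h, Φ.neg_cancel]

end SmoothFlow

variable [T2Space M] [FiniteDimensional ℝ E] [IsManifold I ∞ M] [I.Boundaryless]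
  {V : (x : M) → TangentSpace I x}

/-- A vector field all of whose integral curves are complete has a smooth flow. -/
theorem SmoothFlow.nonempty_of_complete
    (hV : ContMDiff I I.tangent ∞ (fun x ↦ (⟨x, V x⟩ : TangentBundle I M)))
    (h : ∀ x, ∃ γ : ℝ → M, γ 0 = x ∧ IsMIntegralCurve γ V) : Nonempty (SmoothFlow V) := by
  have : CompleteSpace E := FiniteDimensional.complete ℝ E
  have : IsManifold I 1 M := IsManifold.of_le (m := 1) (n := ∞) (by simp)
  have hV1 : ContMDiff I I.tangent 1 (fun x ↦ (⟨x, V x⟩ : TangentBundle I M)) :=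
    hV.of_le (by simp)
  choose Φ hΦ0 hΦ using h
  have huniq : ∀ γ : ℝ → M, IsMIntegralCurve γ V → ∀ t, γ t = Φ (γ 0) t := fun γ hγ t ↦
    congrFun (isMIntegralCurve_Ioo_eq_of_contMDiff_boundaryless (t₀ := 0) hV1 hγ (hΦ _)
      (hΦ0 _).symm) t
  have hadd : ∀ s t x, Φ x (s + t) = Φ (Φ x t) s := by
    intro s t x
    have h1 := huniq _ ((hΦ x).comp_add t) s
    simpa using h1
  have hloc : ∀ x₀, ContMDiffAt (𝓘(ℝ, ℝ).prod I) I ∞ (fun p : ℝ × M ↦ Φ p.2 p.1) (0, x₀) := by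
    intro x₀
    obtain ⟨φ, hφ, hev⟩ := ContMDiffOn.exists_local_flow isOpen_univ hV.contMDiffOn (mem_univ x₀)
    refine hφ.congr_of_eventuallyEq ?_
    obtain ⟨u, hu, w⟩ := Filter.eventually_iff_exists_mem.1 hev
    obtain ⟨a, ha, b, hb, hab⟩ := mem_nhds_prod_iff.1 hu
    obtain ⟨ε, hε, hεa⟩ := Metric.mem_nhds_iff.1 ha
    rw [Real.ball_eq_Ioo, zero_sub, zero_add] at hεa
    filter_upwards [prod_mem_nhds (Ioo_mem_nhds (neg_lt_zero.2 hε) hε) hb] with p hp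
    have hin : ∀ t ∈ Ioo (-ε) ε, (t, p.2) ∈ u := fun t ht ↦ hab ⟨hεa ht, hp.2⟩
    have h0 : (0 : ℝ) ∈ Ioo (-ε) ε := ⟨neg_lt_zero.2 hε, hε⟩
    refine isMIntegralCurveOn_Ioo_eqOn_of_contMDiff_boundaryless h0 hV1
      ((hΦ p.2).isMIntegralCurveOn _) (γ' := fun t ↦ φ (t, p.2)) ?_ ?_ hp.1
    · intro t ht
      exact (w _ (hin t ht)).2.hasMFDerivWithinAt
    · rw [hΦ0]
      exact (w _ (hin 0 h0)).1.symm
  -- The order n is finite here: a map that is C^n at a point is C^n near it, while for infinite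
  -- order the neighbourhoods might shrink with n.
  have hloc' : ∀ (n : ℕ) x₀, ∀ᶠ p in 𝓝 ((0 : ℝ), x₀),
      ContMDiffAt (𝓘(ℝ, ℝ).prod I) I n (fun p : ℝ × M ↦ Φ p.2 p.1) p := fun n x₀ ↦
    have : IsManifold I n M := IsManifold.of_le (n := ∞) (by exact_mod_cast le_top)
    (contMDiffAt_iff_contMDiffAt_nhds (by simp)).1
      ((hloc x₀).of_le (m := n) (by exact_mod_cast le_top))
  have hslice : ∀ (n : ℕ) s x, ContMDiffAt (𝓘(ℝ, ℝ).prod I) I n (fun p : ℝ × M ↦ Φ p.2 p.1) (s, x) →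
      ContMDiffAt I I n (fun y ↦ Φ y s) x := by
    intro n s x hs
    exact hs.comp (g := fun p : ℝ × M ↦ Φ p.2 p.1) x (contMDiffAt_const.prodMk contMDiffAt_id)
  have htime : ∀ (n : ℕ) x₀ t, ContMDiffAt I I n (fun y ↦ Φ y t) x₀ := by
    intro n x₀ t
    -- Smoothness at x₀ is propagated along the orbit. For t close to s, the maps Φ_{t-s} and
    -- Φ_{s-t} are smooth at the relevant points, so smoothness of Φ_s at x₀ and of Φ_t at x₀ imply
    -- each other, and ℝ is connected.
    have key : ∀ s t : ℝ, ContMDiffAt I I n (fun y ↦ Φ y s) x₀ →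
        ContMDiffAt I I n (fun y ↦ Φ y t) x₀ := by
      intro s t
      refine PreconnectedSpace.induction₂' (fun s t : ℝ ↦ ContMDiffAt I I n (fun y ↦ Φ y s) x₀ →
        ContMDiffAt I I n (fun y ↦ Φ y t) x₀) ?_ ⟨fun _ _ _ h1 h2 h ↦ h2 (h1 h)⟩ s t
      intro s
      have hstep : ∀ s t, ContMDiffAt I I n (fun y ↦ Φ y (t - s)) (Φ x₀ s) →
          ContMDiffAt I I n (fun y ↦ Φ y s) x₀ → ContMDiffAt I I n (fun y ↦ Φ y t) x₀ := by
        intro s t h1 h2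
        have h3 := h1.comp x₀ h2
        refine h3.congr_of_eventuallyEq (Filter.Eventually.of_forall fun y ↦ ?_)
        simp only [comp_apply, ← hadd, sub_add_cancel]
      have hc1 : Filter.Tendsto (fun t : ℝ ↦ (t - s, Φ x₀ s)) (𝓝 s) (𝓝 (0, Φ x₀ s)) := by
        have : Continuous (fun t : ℝ ↦ (t - s, Φ x₀ s)) := by fun_prop
        simpa using this.tendsto s
      have hc2 : Filter.Tendsto (fun t : ℝ ↦ (s - t, Φ x₀ t)) (𝓝 s) (𝓝 (0, Φ x₀ s)) := by
        have : Continuous (fun t : ℝ ↦ (s - t, Φ x₀ t)) :=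
          (continuous_const.sub continuous_id).prodMk (hΦ x₀).continuous
        simpa using this.tendsto s
      filter_upwards [hc1.eventually (hloc' n (Φ x₀ s)), hc2.eventually (hloc' n (Φ x₀ s))]
        with t h1 h2
      exact ⟨hstep s t (hslice n _ _ h1), hstep t s (hslice n _ _ h2)⟩
    refine key 0 t ?_
    exact contMDiffAt_id.congr_of_eventuallyEq (Filter.Eventually.of_forall hΦ0)
  refine ⟨⟨fun t x ↦ Φ x t, hΦ0, hadd, hΦ, huniq, ?_⟩⟩
  rw [contMDiff_infty]
  intro n p
  obtain ⟨t₀, x₀⟩ := p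
  have h1 : ContMDiffAt (𝓘(ℝ, ℝ).prod I) (𝓘(ℝ, ℝ).prod I) n
      (fun p : ℝ × M ↦ (p.1 - t₀, Φ p.2 t₀)) (t₀, x₀) := by
    refine ContMDiffAt.prodMk ?_ ?_
    · have h0 : ContMDiffAt (𝓘(ℝ, ℝ).prod I) 𝓘(ℝ, ℝ) n (fun p : ℝ × M ↦ p.1) (t₀, x₀) :=
        contMDiffAt_fst (I := 𝓘(ℝ, ℝ)) (J := I)
      have h1 : ContMDiffAt (𝓘(ℝ, ℝ).prod I) 𝓘(ℝ, ℝ) n (fun _ : ℝ × M ↦ t₀) (t₀, x₀) :=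
        contMDiffAt_const
      exact h0.sub h1
    · exact (htime n x₀ t₀).comp (t₀, x₀) (contMDiffAt_snd (I := 𝓘(ℝ, ℝ)) (J := I))
  have h2 : ContMDiffAt (𝓘(ℝ, ℝ).prod I) I n (fun p : ℝ × M ↦ Φ p.2 p.1)
      ((fun p : ℝ × M ↦ (p.1 - t₀, Φ p.2 t₀)) (t₀, x₀)) := by
    simp only [sub_self]
    exact (hloc _).of_le (by exact_mod_cast le_top)
  refine (h2.comp (t₀, x₀) h1).congr_of_eventuallyEq (Filter.Eventually.of_forall fun p ↦ ?_)
  simp only [comp_apply, ← hadd, sub_add_cancel]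

/-- A vector field vanishing off a compact set is complete. -/
theorem exists_isMIntegralCurve_of_eq_zero_off_compact
    (hV : ContMDiff I I.tangent ∞ (fun x ↦ (⟨x, V x⟩ : TangentBundle I M)))
    {K : Set M} (hK : IsCompact K) (hVK : ∀ x ∉ K, V x = 0) (x : M) :
    ∃ γ : ℝ → M, γ 0 = x ∧ IsMIntegralCurve γ V := by
  have : CompleteSpace E := FiniteDimensional.complete ℝ E
  have : IsManifold I 1 M := IsManifold.of_le (m := 1) (n := ∞) (by simp)
  have hloc : ∀ x₀ : M, ∃ ε > 0, ∀ᶠ x in 𝓝 x₀,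
      ∃ γ : ℝ → M, γ 0 = x ∧ IsMIntegralCurveOn γ V (Ioo (-ε) ε) := by
    intro x₀
    obtain ⟨φ, -, hev⟩ := ContMDiffOn.exists_local_flow isOpen_univ hV.contMDiffOn (mem_univ x₀)
    obtain ⟨a, ha, b, hb, hab⟩ := mem_nhds_prod_iff.1 hev
    obtain ⟨ε, hε, hεa⟩ := Metric.mem_nhds_iff.1 ha
    rw [Real.ball_eq_Ioo, zero_sub, zero_add] at hεa
    refine ⟨ε, hε, Filter.mem_of_superset hb fun x hx ↦ ⟨fun t ↦ φ (t, x), ?_, fun t ht ↦ ?_⟩⟩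
    · exact (hab (show ((0 : ℝ), x) ∈ a ×ˢ b from ⟨hεa ⟨neg_lt_zero.2 hε, hε⟩, hx⟩)).1
    · exact (hab (show (t, x) ∈ a ×ˢ b from ⟨hεa ht, hx⟩)).2.hasMFDerivWithinAt
  -- Compactness gives a common lifespan on K, and outside K constant curves do. A uniform lifespan
  -- implies completeness.
  have huni : ∃ ε > 0, ∀ x ∈ K, ∃ γ : ℝ → M, γ 0 = x ∧ IsMIntegralCurveOn γ V (Ioo (-ε) ε) := by
    refine hK.induction_on (p := fun s ↦ ∃ ε > 0, ∀ x ∈ s, ∃ γ : ℝ → M, γ 0 = x ∧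
      IsMIntegralCurveOn γ V (Ioo (-ε) ε)) ⟨1, one_pos, fun x hx ↦ hx.elim⟩ ?_ ?_ ?_
    · rintro s t hst ⟨ε, hε, h⟩
      exact ⟨ε, hε, fun x hx ↦ h x (hst hx)⟩
    · rintro s t ⟨ε, hε, h⟩ ⟨ε', hε', h'⟩
      refine ⟨min ε ε', lt_min hε hε', fun x hx ↦ ?_⟩
      rcases hx with hx | hx
      · obtain ⟨γ, h0, h1⟩ := h x hx
        exact ⟨γ, h0, h1.mono (Ioo_subset_Ioo (neg_le_neg (min_le_left _ _)) (min_le_left _ _))⟩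
      · obtain ⟨γ, h0, h1⟩ := h' x hx
        exact ⟨γ, h0, h1.mono (Ioo_subset_Ioo (neg_le_neg (min_le_right _ _)) (min_le_right _ _))⟩
    · intro x₀ _
      obtain ⟨ε, hε, h⟩ := hloc x₀
      exact ⟨_, mem_nhdsWithin_of_mem_nhds h, ε, hε, fun x hx ↦ hx⟩
  obtain ⟨ε, hε, h⟩ := huni
  refine exists_isMIntegralCurve_of_isMIntegralCurveOn (hV.of_le (by simp)) hε (fun x ↦ ?_) x
  by_cases hx : x ∈ K
  · exact h x hx
  · exact ⟨fun _ ↦ x, rfl, (isMIntegralCurve_const (hVK x hx)).isMIntegralCurveOn _⟩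

end SmoothFlow

/-! ### The complete flow of a proper Hamiltonian. -/

section Hamiltonian

variable {N : Type*} [TopologicalSpace N] [ChartedSpace (EuclideanSpace ℝ (Fin 2)) N]
  [IsManifold (𝓡 2) ∞ N] (Ω : SymplecticForm N) {H : N → ℝ}

theorem SymplecticForm.form_hamiltonianVectorField_left (H : N → ℝ) (x : N)
    (v : TangentSpace (𝓡 2) x) :
    Ω.form x (Ω.hamiltonianVectorField H x) v = -mvfderiv (𝓡 2) H x v :=
  Ω.form_hamiltonianVectorField H x v

theorem SymplecticForm.form_hamiltonianVectorField_right (H : N → ℝ) (x : N)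
    (v : TangentSpace (𝓡 2) x) :
    Ω.form x v (Ω.hamiltonianVectorField H x) = mvfderiv (𝓡 2) H x v := by
  rw [Ω.form_swap, Ω.form_hamiltonianVectorField_left, neg_neg]

theorem SymplecticForm.mvfderiv_hamiltonianVectorField (H : N → ℝ) (x : N) :
    mvfderiv (𝓡 2) H x (Ω.hamiltonianVectorField H x) = 0 := by
  rw [← Ω.form_hamiltonianVectorField_right, Ω.alternating]

theorem SymplecticForm.hamiltonianVectorField_eq_zero_iff (H : N → ℝ) (x : N) :
    Ω.hamiltonianVectorField H x = 0 ↔ mvfderiv (𝓡 2) H x = 0 := by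
  constructor
  · intro h
    ext v
    rw [← Ω.form_hamiltonianVectorField_right, h]
    simp
  · intro h
    refine Ω.nondegenerate x _ fun w ↦ ?_
    rw [Ω.form_hamiltonianVectorField_left, h]
    simp

theorem SymplecticForm.eq_of_isMIntegralCurve (hH : ContMDiff (𝓡 2) 𝓘(ℝ, ℝ) ∞ H) {γ : ℝ → N}
    (hγ : IsMIntegralCurve γ (Ω.hamiltonianVectorField H)) (s t : ℝ) : H (γ s) = H (γ t) := by
  have h : ∀ t, HasDerivAt (fun t ↦ H (γ t)) 0 t := fun t ↦ by
    have := (hγ t).hasDerivAt_comp (hH.mdifferentiable (by simp) (γ t))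
    rwa [Ω.mvfderiv_hamiltonianVectorField] at this
  exact is_const_of_deriv_eq_zero (fun t ↦ (h t).differentiableAt) (fun t ↦ (h t).deriv) s t

/-- The flow of the Hamiltonian vector field of a proper function. -/
theorem SymplecticForm.nonempty_hamiltonianFlow [T2Space N]
    (hH : ContMDiff (𝓡 2) 𝓘(ℝ, ℝ) ∞ H) (hproper : IsProperMap H) :
    Nonempty (SmoothFlow (Ω.hamiltonianVectorField H)) := by
  have hX := Ω.contMDiff_hamiltonianVectorField hH
  refine SmoothFlow.nonempty_of_complete hX fun x ↦ ?_
  -- The radii of the bump are irrelevant. Properness makes b ∘ H compactly supported, so (b ∘ H) X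
  -- is complete; H is constant along its integral curves, so on the curve through x the factor b ∘
  -- H stays equal to 1.
  let b : ContDiffBump (H x) := default
  let W : (y : N) → TangentSpace (𝓡 2) y := fun y ↦ b (H y) • Ω.hamiltonianVectorField H y
  have hW : ContMDiff (𝓡 2) (𝓡 2).tangent ∞ (fun y ↦ (⟨y, W y⟩ : TangentBundle (𝓡 2) N)) :=
    (b.contDiff.contMDiff.comp hH).smul_section hX
  obtain ⟨γ, h0, hγ⟩ := exists_isMIntegralCurve_of_eq_zero_off_compact hW
    (hproper.isCompact_preimage b.hasCompactSupport) (fun y hy ↦ by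
      have : b (H y) = 0 := image_eq_zero_of_notMem_tsupport hy
      simp only [W, this, zero_smul]) x
  have hc : ∀ t, H (γ t) = H x := by
    intro t
    have h : ∀ t, HasDerivAt (fun t ↦ H (γ t)) 0 t := fun t ↦ by
      have := (hγ t).hasDerivAt_comp (hH.mdifferentiable (by simp) (γ t))
      simpa only [W, map_smul, Ω.mvfderiv_hamiltonianVectorField, smul_zero] using this
    have := is_const_of_deriv_eq_zero (fun t ↦ (h t).differentiableAt) (fun t ↦ (h t).deriv) t 0
    rw [this, h0]
  refine ⟨γ, h0, fun t ↦ ?_⟩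
  have h1 : W (γ t) = Ω.hamiltonianVectorField H (γ t) := by
    have : b (H (γ t)) = 1 := by
      rw [hc]
      exact b.one_of_mem_closedBall (Metric.mem_closedBall_self b.rIn_pos.le)
    simp only [W, this, one_smul]
  have h2 := hγ t
  rwa [h1] at h2

end Hamiltonian

/-! ### Fields transversal to the level sets and their sections. -/

section Transversal

variable {N : Type*} [TopologicalSpace N] [ChartedSpace (EuclideanSpace ℝ (Fin 2)) N]
  [IsManifold (𝓡 2) ∞ N]

/-- The set of regular points of `H`. -/
def regularSet (H : N → ℝ) : Set N := {x | mvfderiv (𝓡 2) H x ≠ 0}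

/-- The required inequalities are convex in the fibre, so a partition of unity globalizes local
solutions. Locally dH(e₁) e₁ + dH(e₂) e₂ works, since dH of it is a sum of two squares that vanishes
only where dH does. -/
theorem SymplecticForm.exists_gradientLike [T2Space N] [SecondCountableTopology N]
    (Ω : SymplecticForm N) {H : N → ℝ} (hH : ContMDiff (𝓡 2) 𝓘(ℝ, ℝ) ∞ H) :
    ∃ Y : (x : N) → TangentSpace (𝓡 2) x,
      ContMDiff (𝓡 2) (𝓡 2).tangent ∞ (fun x ↦ (⟨x, Y x⟩ : TangentBundle (𝓡 2) N)) ∧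
      ∀ x, 0 ≤ mvfderiv (𝓡 2) H x (Y x) ∧ (x ∈ regularSet H → 0 < mvfderiv (𝓡 2) H x (Y x)) := by
  have : LocallyCompactSpace N := Manifold.locallyCompact_of_finiteDimensional (𝓡 2)
  suffices h : ∃ s : ContMDiffSection (𝓡 2) 𝔼 ∞ (TangentSpace (𝓡 2) : N → Type _), ∀ x, s x ∈
      {v | 0 ≤ mvfderiv (𝓡 2) H x v ∧ (x ∈ regularSet H → 0 < mvfderiv (𝓡 2) H x v)} by
    obtain ⟨s, hs⟩ := h
    exact ⟨fun x ↦ s x, s.contMDiff, hs⟩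
  refine exists_contMDiffSection_forall_mem_convex_of_local (n := ⊤) (𝓡 2)
    (F_fiber := 𝔼) (TangentSpace (𝓡 2) : N → Type _)
    (fun x ↦ {v | 0 ≤ mvfderiv (𝓡 2) H x v ∧ (x ∈ regularSet H → 0 < mvfderiv (𝓡 2) H x v)})
    ?_ ?_
  · intro x v hv w hw a b ha hb hab
    simp only [mem_ofPred, map_add, map_smul, smul_eq_mul] at hv hw ⊢
    refine ⟨by nlinarith [mul_nonneg ha hv.1, mul_nonneg hb hw.1], fun hx ↦ ?_⟩
    rcases ha.eq_or_lt with h | h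
    · have : b = 1 := by linarith
      rw [← h, this]
      linarith [hw.2 hx]
    · linarith [mul_pos h (hv.2 hx), mul_nonneg hb hw.1]
  · intro x₀
    obtain ⟨U, hU, hx₀, e₁, e₂, h1, h2, -, hne⟩ := Ω.exists_frame x₀
    have d1 : ContMDiffOn (𝓡 2) 𝓘(ℝ, ℝ) ∞ (fun x ↦ mvfderiv (𝓡 2) H x (e₁ x)) U :=
      hH.contMDiffOn.mfderiv_vectorField hU h1
    have d2 : ContMDiffOn (𝓡 2) 𝓘(ℝ, ℝ) ∞ (fun x ↦ mvfderiv (𝓡 2) H x (e₂ x)) U :=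
      hH.contMDiffOn.mfderiv_vectorField hU h2
    refine ⟨U, hU.mem_nhds hx₀, _, (d1.smul_section h1).add_section (d2.smul_section h2),
      fun y hy ↦ ?_⟩
    have hval : mvfderiv (𝓡 2) H y (((fun x ↦ mvfderiv (𝓡 2) H x (e₁ x) • e₁ x) +
        fun x ↦ mvfderiv (𝓡 2) H x (e₂ x) • e₂ x) y) =
        mvfderiv (𝓡 2) H y (e₁ y) ^ 2 + mvfderiv (𝓡 2) H y (e₂ y) ^ 2 := by
      rw [Pi.add_apply, map_add, map_smul, map_smul, smul_eq_mul, smul_eq_mul, sq, sq]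
    refine ⟨hval ▸ by positivity, fun hreg ↦ hval ▸ ?_⟩
    by_contra hle
    refine hreg (ContinuousLinearMap.ext fun v ↦ ?_)
    have z1 : mvfderiv (𝓡 2) H y (e₁ y) = 0 := by
      nlinarith [sq_nonneg (mvfderiv (𝓡 2) H y (e₁ y)), sq_nonneg (mvfderiv (𝓡 2) H y (e₂ y))]
    have z2 : mvfderiv (𝓡 2) H y (e₂ y) = 0 := by
      nlinarith [sq_nonneg (mvfderiv (𝓡 2) H y (e₁ y)), sq_nonneg (mvfderiv (𝓡 2) H y (e₂ y))]
    rw [Ω.cramer y (e₁ y) (e₂ y) v (hne y hy), map_add, map_smul, map_smul, z1, z2]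
    simp

/-- A smooth vector field on the regular set of `H` along which `H` has derivative one. -/
structure TransversalField (H : N → ℝ) where
  /-- The underlying vector field. -/
  field : (x : N) → TangentSpace (𝓡 2) x
  isOpen_regularSet : IsOpen (regularSet H)
  contMDiffOn : ContMDiffOn (𝓡 2) (𝓡 2).tangent ∞
    (fun x ↦ (⟨x, field x⟩ : TangentBundle (𝓡 2) N)) (regularSet H)
  mvfderiv_field (x : N) (hx : x ∈ regularSet H) : mvfderiv (𝓡 2) H x (field x) = 1

theorem SymplecticForm.nonempty_transversalField [T2Space N] [SecondCountableTopology N]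
    (Ω : SymplecticForm N) {H : N → ℝ} (hH : ContMDiff (𝓡 2) 𝓘(ℝ, ℝ) ∞ H) :
    Nonempty (TransversalField H) := by
  obtain ⟨Y, hY, hpos⟩ := Ω.exists_gradientLike hH
  have hd : ContMDiff (𝓡 2) 𝓘(ℝ, ℝ) ∞ (fun x ↦ mvfderiv (𝓡 2) H x (Y x)) :=
    contMDiffOn_univ.1 (hH.contMDiffOn.mfderiv_vectorField isOpen_univ hY.contMDiffOn)
  have hR : regularSet H = {x | 0 < mvfderiv (𝓡 2) H x (Y x)} := by
    ext x
    refine ⟨(hpos x).2, fun h h0 ↦ ?_⟩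
    rw [mem_ofPred, h0, zero_apply] at h
    exact h.false
  refine ⟨⟨fun x ↦ (mvfderiv (𝓡 2) H x (Y x))⁻¹ • Y x, ?_, ?_, ?_⟩⟩
  · rw [hR]
    exact isOpen_lt continuous_const hd.continuous
  · refine ContMDiffOn.smul_section (f := fun x ↦ (mvfderiv (𝓡 2) H x (Y x))⁻¹) ?_ hY.contMDiffOn
    intro x hx
    have h3 : ContDiffAt ℝ ∞ (fun r : ℝ ↦ r⁻¹) (mvfderiv (𝓡 2) H x (Y x)) :=
      contDiffAt_inv ℝ ((hpos x).2 hx).ne'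
    exact h3.contMDiffAt.comp_contMDiffWithinAt x (hd x).contMDiffWithinAt
  · intro x hx
    rw [map_smul, smul_eq_mul, inv_mul_cancel₀ ((hpos x).2 hx).ne']

/-- A curve `s` is a section over `J` if it is an integral curve of the transversal field which
is parametrized by the value of `H`. -/
structure TransversalField.IsSection {H : N → ℝ} (Y : TransversalField H) (s : ℝ → N)
    (J : Set ℝ) : Prop where
  isMIntegralCurveOn : IsMIntegralCurveOn s Y.field J
  mem_regularSet : ∀ c ∈ J, s c ∈ regularSet H
  apply_eq : ∀ c ∈ J, H (s c) = c

namespace TransversalField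

variable {H : N → ℝ} (Y : TransversalField H)

theorem IsSection.mono {Y : TransversalField H} {s : ℝ → N} {J J' : Set ℝ}
    (hs : Y.IsSection s J) (h : J' ⊆ J) : Y.IsSection s J' :=
  ⟨hs.1.mono h, fun c hc ↦ hs.2 c (h hc), fun c hc ↦ hs.3 c (h hc)⟩

theorem IsSection.isMIntegralCurveAt {Y : TransversalField H} {s : ℝ → N} {J : Set ℝ}
    (hs : Y.IsSection s J) (hJ : IsOpen J) {c : ℝ} (hc : c ∈ J) :
    IsMIntegralCurveAt s Y.field c :=
  hs.1.isMIntegralCurveAt (hJ.mem_nhds hc)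

theorem IsSection.of_locally {Y : TransversalField H} {s : ℝ → N} {J : Set ℝ} (hJ : IsOpen J)
    (h : ∀ c ∈ J, ∃ s' J', IsOpen J' ∧ c ∈ J' ∧ Y.IsSection s' J' ∧ s =ᶠ[𝓝 c] s') :
    Y.IsSection s J := by
  refine ⟨?_, ?_, ?_⟩
  · rw [isMIntegralCurveOn_iff_isMIntegralCurveAt hJ]
    intro c hc
    obtain ⟨s', J', hJ', hcJ', hs', heq⟩ := h c hc
    filter_upwards [hs'.isMIntegralCurveAt hJ' hcJ', heq.eventuallyEq_nhds] with t ht1 ht2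
    rw [ht2.eq_of_nhds]
    exact ht1.congr_of_eventuallyEq ht2
  · intro c hc
    obtain ⟨s', J', hJ', hcJ', hs', heq⟩ := h c hc
    rw [heq.eq_of_nhds]
    exact hs'.2 c hcJ'
  · intro c hc
    obtain ⟨s', J', hJ', hcJ', hs', heq⟩ := h c hc
    rw [heq.eq_of_nhds]
    exact hs'.3 c hcJ'

theorem contMDiffAt_one {x : N} (hx : x ∈ regularSet H) :
    ContMDiffAt (𝓡 2) (𝓡 2).tangent 1 (fun x ↦ (⟨x, Y.field x⟩ : TangentBundle (𝓡 2) N)) x :=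
  ((Y.contMDiffOn x hx).contMDiffAt (Y.isOpen_regularSet.mem_nhds hx)).of_le (by simp)

/-- By uniqueness an integral curve is locally a time slice of the smooth local flow. -/
theorem IsSection.contMDiffOn {Y : TransversalField H} {s : ℝ → N} {J : Set ℝ}
    (hs : Y.IsSection s J) (hJ : IsOpen J) : ContMDiffOn 𝓘(ℝ, ℝ) (𝓡 2) ∞ s J := by
  have : IsManifold (𝓡 2) 1 N := IsManifold.of_le (m := 1) (n := ∞) (by simp)
  intro c hc
  obtain ⟨φ, hφ, hev⟩ := Y.contMDiffOn.exists_local_flow Y.isOpen_regularSet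
    (hs.mem_regularSet c hc)
  have htend : Filter.Tendsto (fun t : ℝ ↦ (t, s c)) (𝓝 0) (𝓝 (0, s c)) :=
    (Continuous.prodMk_left (s c)).tendsto 0
  have h0 : φ (0, s c) = s c := hev.self_of_nhds.1
  have h1 : IsMIntegralCurveAt (fun t ↦ φ (t, s c)) Y.field 0 :=
    (htend.eventually hev).mono fun t ht ↦ ht.2
  have h2 : IsMIntegralCurveAt (s ∘ (· + c)) Y.field 0 := by
    have := (hs.isMIntegralCurveAt hJ hc).comp_add c
    rwa [sub_self] at this
  have h3 : s ∘ (· + c) =ᶠ[𝓝 0] fun t ↦ φ (t, s c) := by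
    refine isMIntegralCurveAt_eventuallyEq_of_contMDiffAt_boundaryless ?_ h2 h1 ?_
    · simpa using! Y.contMDiffAt_one (hs.mem_regularSet c hc)
    · simp [h0]
  have h4 : s =ᶠ[𝓝 c] fun t ↦ φ (t - c, s c) := by
    have : Filter.Tendsto (fun t ↦ t - c) (𝓝 c) (𝓝 0) := by
      have h : Continuous (fun t : ℝ ↦ t - c) := by fun_prop
      simpa using h.tendsto c
    filter_upwards [this.eventually h3] with t ht
    simpa using ht
  refine ContMDiffAt.contMDiffWithinAt (ContMDiffAt.congr_of_eventuallyEq ?_ h4)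
  have h5 : ContMDiffAt 𝓘(ℝ, ℝ) (𝓘(ℝ, ℝ).prod (𝓡 2)) ∞ (fun t : ℝ ↦ (t - c, s c)) c :=
    (contDiff_id.sub contDiff_const).contMDiff.contMDiffAt.prodMk contMDiffAt_const
  have h6 : ContMDiffAt (𝓘(ℝ, ℝ).prod (𝓡 2)) (𝓡 2) ∞ φ ((fun t : ℝ ↦ (t - c, s c)) c) := by
    simpa using hφ
  exact h6.comp c h5

/-- Both agreement and disagreement at a parameter persist nearby, the first by uniqueness of
integral curves and the second by the Hausdorff property. -/
theorem IsSection.eqOn [T2Space N] {Y : TransversalField H} {s s' : ℝ → N} {J : Set ℝ}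
    (hs : Y.IsSection s J) (hs' : Y.IsSection s' J) (hJ : IsOpen J) (hJc : IsPreconnected J)
    {c₀ : ℝ} (hc₀ : c₀ ∈ J) (h : s c₀ = s' c₀) : EqOn s s' J := by
  have : IsManifold (𝓡 2) 1 N := IsManifold.of_le (m := 1) (n := ∞) (by simp)
  intro c hc
  refine hJc.induction₂' (fun c c' ↦ s c = s' c → s c' = s' c') ?_
    (fun x y z _ _ _ h1 h2 h ↦ h2 (h1 h)) hc₀ hc h
  intro c hc
  rw [hJ.nhdsWithin_eq hc]
  have hcs := (hs.isMIntegralCurveAt hJ hc).continuousAt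
  have hcs' := (hs'.isMIntegralCurveAt hJ hc).continuousAt
  by_cases heq : s c = s' c
  · filter_upwards [isMIntegralCurveAt_eventuallyEq_of_contMDiffAt_boundaryless
      (Y.contMDiffAt_one (hs.mem_regularSet c hc)) (hs.isMIntegralCurveAt hJ hc)
      (hs'.isMIntegralCurveAt hJ hc) heq] with c' hc'
    exact ⟨fun _ ↦ hc', fun _ ↦ heq⟩
  · filter_upwards [(hcs.ne_iff_eventually_ne hcs').1 heq] with c' hc'
    exact ⟨fun h ↦ (heq h).elim, fun h ↦ (hc' h).elim⟩

/-- Sections through the points near a regular point exist on intervals of uniform length. -/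
theorem eventually_exists_isSection (hH : ContMDiff (𝓡 2) 𝓘(ℝ, ℝ) ∞ H) {x₀ : N}
    (hx₀ : x₀ ∈ regularSet H) :
    ∃ ε > 0, ∀ᶠ x in 𝓝 x₀, ∃ s : ℝ → N, s (H x) = x ∧
      Y.IsSection s (Ioo (H x - ε) (H x + ε)) := by
  obtain ⟨φ, hφ, hev⟩ := Y.contMDiffOn.exists_local_flow Y.isOpen_regularSet hx₀
  have h0 : φ (0, x₀) = x₀ := hev.self_of_nhds.1
  have hreg : ∀ᶠ p in 𝓝 ((0 : ℝ), x₀), φ p ∈ regularSet H := by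
    refine hφ.continuousAt.eventually (Y.isOpen_regularSet.mem_nhds ?_)
    rwa [h0]
  obtain ⟨a, ha, b, hb, hab⟩ := mem_nhds_prod_iff.1 (hev.and hreg)
  obtain ⟨ε, hε, hεa⟩ := Metric.mem_nhds_iff.1 ha
  rw [Real.ball_eq_Ioo, zero_sub, zero_add] at hεa
  refine ⟨ε, hε, ?_⟩
  filter_upwards [hb] with x hx
  have hball : ∀ t ∈ Ioo (-ε) ε, (φ (0, x) = x ∧
      HasMFDerivAt 𝓘(ℝ, ℝ) (𝓡 2) (fun t ↦ φ (t, x)) t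
        ((1 : ℝ →L[ℝ] ℝ).smulRight (Y.field (φ (t, x))))) ∧ φ (t, x) ∈ regularSet H :=
    fun t ht ↦ hab (show (t, x) ∈ a ×ˢ b from ⟨hεa ht, hx⟩)
  have h0x : φ (0, x) = x := (hball 0 ⟨by linarith, hε⟩).1.1
  let s : ℝ → N := fun c ↦ φ (c - H x, x)
  have hreg : ∀ c ∈ Ioo (H x - ε) (H x + ε), s c ∈ regularSet H := fun c hc ↦
    (hball (c - H x) ⟨by linarith [hc.1], by linarith [hc.2]⟩).2
  have hint : IsMIntegralCurveOn s Y.field (Ioo (H x - ε) (H x + ε)) := by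
    have h1 : IsMIntegralCurveOn (fun t ↦ φ (t, x)) Y.field (Ioo (-ε) ε) := fun t ht ↦
      (hball t ht).1.2.hasMFDerivWithinAt
    have h2 := h1.comp_add (-H x)
    refine h2.mono fun c hc ↦ ?_
    simp only [mem_ofPred, mem_Ioo] at hc ⊢
    constructor <;> linarith [hc.1, hc.2]
  refine ⟨s, by simp [s, h0x], hint, hreg, fun c hc ↦ ?_⟩
  have hder : ∀ c ∈ Ioo (H x - ε) (H x + ε), HasDerivAt (fun c ↦ H (s c) - c) 0 c := by
    intro c hc
    have h1 := ((hint c hc).hasMFDerivAt (Ioo_mem_nhds hc.1 hc.2)).hasDerivAt_comp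
      (hH.mdifferentiable (by simp) (s c))
    rw [Y.mvfderiv_field _ (hreg c hc)] at h1
    have h2 := h1.sub (hasDerivAt_id c)
    rw [sub_self] at h2
    exact h2
  have hmem : H x ∈ Ioo (H x - ε) (H x + ε) := ⟨by linarith, by linarith⟩
  have := (convex_Ioo (H x - ε) (H x + ε)).is_const_of_fderivWithin_eq_zero (𝕜 := ℝ)
    (f := fun c ↦ H (s c) - c) (fun c hc ↦ (hder c hc).differentiableAt.differentiableWithinAt)
    (fun c hc ↦ by
      rw [fderivWithin_of_isOpen isOpen_Ioo hc]
      have := (hder c hc).hasFDerivAt.fderiv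
      simpa using! this) hc hmem
  simp only [s, sub_self, h0x] at this
  simp only [s]
  linarith

theorem exists_isSection (hH : ContMDiff (𝓡 2) 𝓘(ℝ, ℝ) ∞ H) {x₀ : N} (hx₀ : x₀ ∈ regularSet H) :
    ∃ ε > 0, ∃ s : ℝ → N, s (H x₀) = x₀ ∧ Y.IsSection s (Ioo (H x₀ - ε) (H x₀ + ε)) := by
  obtain ⟨ε, hε, hev⟩ := Y.eventually_exists_isSection hH hx₀
  exact ⟨ε, hε, hev.self_of_nhds⟩

end TransversalField

end Transversal

/-! ### Flow boxes as symplectic coordinates. -/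

section FlowBox

variable {N : Type*} [TopologicalSpace N] [ChartedSpace (EuclideanSpace ℝ (Fin 2)) N]
  [IsManifold (𝓡 2) ∞ N] {Ω : SymplecticForm N} {H : N → ℝ}

theorem HasDerivAt.hasMFDerivAt_curve {E : Type*} [NormedAddCommGroup E] [NormedSpace ℝ E]
    {γ : ℝ → E} {v : E} {t : ℝ} (h : HasDerivAt γ v t) :
    HasMFDerivAt 𝓘(ℝ, ℝ) 𝓘(ℝ, E) γ t
      ((1 : ℝ →L[ℝ] ℝ).smulRight (show TangentSpace 𝓘(ℝ, E) (γ t) from v)) :=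
  h.hasFDerivAt.hasMFDerivAt

theorem HasMFDerivAt.curve_unique {E : Type*} [NormedAddCommGroup E] [NormedSpace ℝ E]
    {K : Type*} [TopologicalSpace K] {I : ModelWithCorners ℝ E K} {M : Type*} [TopologicalSpace M]
    [ChartedSpace K M] {γ : ℝ → M} {t : ℝ} {v w : TangentSpace I (γ t)}
    (hv : HasMFDerivAt 𝓘(ℝ, ℝ) I γ t ((1 : ℝ →L[ℝ] ℝ).smulRight v))
    (hw : HasMFDerivAt 𝓘(ℝ, ℝ) I γ t ((1 : ℝ →L[ℝ] ℝ).smulRight w)) : v = w := by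
  have h5 := DFunLike.congr_fun (hasMFDerivAt_unique hv hw) (1 : ℝ)
  have e1 : ∀ (v : TangentSpace I (γ t)), ((1 : ℝ →L[ℝ] ℝ).smulRight v) 1 = v :=
    fun v ↦ one_smul ℝ v
  exact (e1 _).symm.trans (h5.trans (e1 _))

theorem SymplecticForm.bijective_of_form_ne_zero (Ω : SymplecticForm N) {x : N}
    (L : ℝ × ℝ →L[ℝ] TangentSpace (𝓡 2) x) (h : Ω.form x (L (1, 0)) (L (0, 1)) ≠ 0) :
    Bijective L := by
  have hfin : FiniteDimensional ℝ (TangentSpace (𝓡 2) x) :=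
    inferInstanceAs (FiniteDimensional ℝ 𝔼)
  have hrank : Module.finrank ℝ (TangentSpace (𝓡 2) x) = 2 :=
    (finrank_euclideanSpace_fin : Module.finrank ℝ 𝔼 = 2)
  have hinj : Injective L.toLinearMap := by
    rw [injective_iff_map_eq_zero]
    rintro ⟨a, b⟩ hab
    have hsum : a • L (1, 0) + b • L (0, 1) = 0 := by
      rw [← map_smul, ← map_smul, ← map_add]
      simpa using hab
    have h1 := congrArg (fun u ↦ Ω.form x u (L (0, 1))) hsum
    have h2 := congrArg (fun u ↦ Ω.form x (L (1, 0)) u) hsum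
    simp only [map_add, map_smul, add_apply, smul_apply, mul_zero, Ω.alternating, add_zero,
      zero_add, map_zero, zero_apply, smul_eq_mul, mul_eq_zero, h, or_false] at h1 h2
    rw [h1, h2]
    rfl
  exact ⟨hinj, (LinearMap.injective_iff_surjective_of_finrank_eq_finrank
    (by rw [hrank]; simp)).1 hinj⟩

namespace SmoothFlow

variable (Φ : SmoothFlow (Ω.hamiltonianVectorField H))

theorem apply_hamiltonian (hH : ContMDiff (𝓡 2) 𝓘(ℝ, ℝ) ∞ H) (t : ℝ) (x : N) :
    H (Φ.toFun t x) = H x := by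
  have := Ω.eq_of_isMIntegralCurve hH (Φ.isMIntegralCurve x) t 0
  simpa only [Φ.map_zero] using this

theorem fixed_of_notMem_regularSet {x : N} (hx : x ∉ regularSet H) (t : ℝ) :
    Φ.toFun t x = x := by
  have h0 : Ω.hamiltonianVectorField H x = 0 := by
    rw [Ω.hamiltonianVectorField_eq_zero_iff]
    exact not_not.1 hx
  exact (Φ.eq_of_isMIntegralCurve (fun _ ↦ x) (isMIntegralCurve_const h0) t).symm

theorem mem_regularSet_iff (t : ℝ) (x : N) : Φ.toFun t x ∈ regularSet H ↔ x ∈ regularSet H := by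
  constructor
  · intro h hx
    rw [Φ.fixed_of_notMem_regularSet (not_not.2 hx)] at h
    exact h hx
  · intro h hx
    have := Φ.fixed_of_notMem_regularSet (not_not.2 hx) (-t)
    rw [Φ.neg_cancel] at this
    rw [← this] at hx
    exact h hx

/-- The flow box map of a curve `s`. -/
def box (s : ℝ → N) (p : ℝ × ℝ) : N := Φ.toFun p.2 (s p.1)

variable {Y : TransversalField H} {s : ℝ → N} {J : Set ℝ}

theorem apply_box (hH : ContMDiff (𝓡 2) 𝓘(ℝ, ℝ) ∞ H) (hs : Y.IsSection s J) {p : ℝ × ℝ}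
    (hp : p.1 ∈ J) : H (Φ.box s p) = p.1 := by
  rw [box, Φ.apply_hamiltonian hH, hs.apply_eq _ hp]

theorem contMDiffAt_box (hs : Y.IsSection s J) (hJ : IsOpen J) {p : ℝ × ℝ} (hp : p.1 ∈ J) :
    ContMDiffAt 𝓘(ℝ, ℝ × ℝ) (𝓡 2) ∞ (Φ.box s) p := by
  have h1 : ContMDiffAt 𝓘(ℝ, ℝ × ℝ) (𝓡 2) ∞ (fun q : ℝ × ℝ ↦ s q.1) p :=
    ((hs.contMDiffOn hJ p.1 hp).contMDiffAt (hJ.mem_nhds hp)).comp p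
      contDiff_fst.contMDiff.contMDiffAt
  have h2 : ContMDiffAt 𝓘(ℝ, ℝ × ℝ) 𝓘(ℝ, ℝ) ∞ (fun q : ℝ × ℝ ↦ q.2) p :=
    contDiff_snd.contMDiff.contMDiffAt
  exact (Φ.contMDiff (p.2, s p.1)).comp p (h2.prodMk h1)

theorem mfderiv_box_snd (hs : Y.IsSection s J) (hJ : IsOpen J) {p : ℝ × ℝ} (hp : p.1 ∈ J) :
    mfderiv 𝓘(ℝ, ℝ × ℝ) (𝓡 2) (Φ.box s) p ((0, 1) : ℝ × ℝ) =
      Ω.hamiltonianVectorField H (Φ.box s p) := by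
  have h1 := ((hasDerivAt_const p.2 p.1).prodMk (hasDerivAt_id p.2)).hasMFDerivAt_curve
  have h2 := h1.comp_curve (f := Φ.box s) ((Φ.contMDiffAt_box hs hJ hp).mdifferentiableAt (by simp))
  have h3 := Φ.isMIntegralCurve (s p.1) p.2
  exact h2.curve_unique h3

theorem mvfderiv_box_fst (hH : ContMDiff (𝓡 2) 𝓘(ℝ, ℝ) ∞ H) (hs : Y.IsSection s J)
    (hJ : IsOpen J) {p : ℝ × ℝ} (hp : p.1 ∈ J) :
    mvfderiv (𝓡 2) H (Φ.box s p) (mfderiv 𝓘(ℝ, ℝ × ℝ) (𝓡 2) (Φ.box s) p ((1, 0) : ℝ × ℝ)) = 1 := by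
  have h1 := ((hasDerivAt_id p.1).prodMk (hasDerivAt_const p.1 p.2)).hasMFDerivAt_curve
  have h2 := h1.comp_curve (f := Φ.box s) ((Φ.contMDiffAt_box hs hJ hp).mdifferentiableAt (by simp))
  have h3 := h2.hasDerivAt_comp (hH.mdifferentiable (by simp) _)
  have h4 : (fun t ↦ H (Φ.box s (t, p.2))) =ᶠ[𝓝 p.1] id := by
    filter_upwards [hJ.mem_nhds hp] with t ht
    exact Φ.apply_box hH hs ht
  exact h3.unique ((hasDerivAt_id p.1).congr_of_eventuallyEq h4)

/-- The second partial derivative is X, and pairing a vector with X gives dH of it. The level is the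
first coordinate of the box, so dH of the first partial derivative is 1. Level and time are thus
Darboux coordinates. -/
theorem form_mfderiv_box (hH : ContMDiff (𝓡 2) 𝓘(ℝ, ℝ) ∞ H) (hs : Y.IsSection s J)
    (hJ : IsOpen J) {p : ℝ × ℝ} (hp : p.1 ∈ J) :
    Ω.form (Φ.box s p) (mfderiv 𝓘(ℝ, ℝ × ℝ) (𝓡 2) (Φ.box s) p ((1, 0) : ℝ × ℝ))
      (mfderiv 𝓘(ℝ, ℝ × ℝ) (𝓡 2) (Φ.box s) p ((0, 1) : ℝ × ℝ)) = 1 := by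
  rw [Φ.mfderiv_box_snd hs hJ hp, Ω.form_hamiltonianVectorField_right,
    Φ.mvfderiv_box_fst hH hs hJ hp]

/-- The time coordinate of a flow box. -/
theorem exists_time (hH : ContMDiff (𝓡 2) 𝓘(ℝ, ℝ) ∞ H) (hs : Y.IsSection s J)
    (hJ : IsOpen J) {c : ℝ} (hc : c ∈ J) :
    ∃ θ : N → ℝ, ContMDiffAt (𝓡 2) 𝓘(ℝ, ℝ) ∞ θ (s c) ∧ θ (s c) = 0 ∧
      (∀ᶠ y in 𝓝 (s c), H y ∈ J ∧ Φ.toFun (θ y) (s (H y)) = y) ∧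
      ∀ᶠ p in 𝓝 (c, (0 : ℝ)), θ (Φ.box s p) = p.2 := by
  have h0 : Φ.box s (c, 0) = s c := Φ.map_zero _
  obtain ⟨g, hg, hg1, hg2⟩ := (Φ.contMDiffAt_box hs hJ (p := (c, 0)) hc).exists_local_inverse
    (by simp) (Ω.bijective_of_form_ne_zero _
      (ne_of_eq_of_ne (Φ.form_mfderiv_box hH hs hJ (p := (c, 0)) hc) one_ne_zero))
  rw [h0] at hg hg2
  have hg0 : g (s c) = (c, 0) := by
    rw [← h0]
    exact hg1.self_of_nhds
  have hg3 : ∀ᶠ y in 𝓝 (s c), (g y).1 ∈ J := by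
    have : ContinuousAt (fun y ↦ (g y).1) (s c) := hg.continuousAt.fst
    refine this.eventually (hJ.mem_nhds ?_)
    simpa only [hg0] using hc
  refine ⟨fun y ↦ (g y).2, ?_, by simp [hg0], ?_, ?_⟩
  · exact (contDiff_snd (𝕜 := ℝ) (n := ∞)).contMDiff.contMDiffAt.comp (s c) hg
  · filter_upwards [hg2, hg3] with y hy1 hy2
    have := Φ.apply_box hH hs hy2
    rw [hy1] at this
    rw [this]
    exact ⟨hy2, hy1⟩
  · filter_upwards [hg1] with p hp
    rw [hp]

end SmoothFlow

end FlowBox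

/-! ### Periodic points and their least periods. -/

section Periods

variable {N : Type*} [TopologicalSpace N] [ChartedSpace (EuclideanSpace ℝ (Fin 2)) N]
  [IsManifold (𝓡 2) ∞ N] {Ω : SymplecticForm N} {H : N → ℝ}

namespace SmoothFlow

variable (Φ : SmoothFlow (Ω.hamiltonianVectorField H))

/-- The orbit of `x`. -/
def orbit (x : N) : Set N := range (fun t ↦ Φ.toFun t x)

theorem mem_orbit_self (x : N) : x ∈ Φ.orbit x := ⟨0, Φ.map_zero x⟩

theorem mem_orbit (t : ℝ) (x : N) : Φ.toFun t x ∈ Φ.orbit x := ⟨t, rfl⟩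

theorem orbit_eq_of_mem {x y : N} (h : y ∈ Φ.orbit x) : Φ.orbit y = Φ.orbit x := by
  obtain ⟨t, rfl⟩ := h
  ext z
  constructor
  · rintro ⟨s, rfl⟩
    exact ⟨s + t, Φ.map_add s t x⟩
  · rintro ⟨s, rfl⟩
    refine ⟨s - t, ?_⟩
    simp only [← Φ.map_add, sub_add_cancel]

/-- The set of regular periodic points. -/
def periodicSet : Set N := {x | x ∈ regularSet H ∧ ∃ t, 0 < t ∧ Φ.toFun t x = x}

/-- The least period of a periodic point. -/
noncomputable def minPeriod (x : N) : ℝ := sInf {t | 0 < t ∧ Φ.toFun t x = x}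

theorem minPeriod_eq {x : N} {t : ℝ} (h0 : 0 < t) (h : Φ.toFun t x = x)
    (hmin : ∀ s, 0 < s → Φ.toFun s x = x → t ≤ s) : Φ.minPeriod x = t :=
  IsLeast.csInf_eq ⟨⟨h0, h⟩, fun s hs ↦ hmin s hs.1 hs.2⟩

theorem apply_flow_eq_iff (s t : ℝ) (x : N) :
    Φ.toFun s (Φ.toFun t x) = Φ.toFun t x ↔ Φ.toFun s x = x := by
  rw [Φ.comm]
  exact (Φ.injective t).eq_iff

theorem minPeriod_flow (t : ℝ) (x : N) : Φ.minPeriod (Φ.toFun t x) = Φ.minPeriod x := by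
  simp only [minPeriod, Φ.apply_flow_eq_iff]

theorem flow_mem_periodicSet_iff (t : ℝ) (x : N) :
    Φ.toFun t x ∈ Φ.periodicSet ↔ x ∈ Φ.periodicSet := by
  simp only [periodicSet, mem_ofPred, Φ.apply_flow_eq_iff, Φ.mem_regularSet_iff]

theorem apply_sub_eq {s t : ℝ} {x : N} (h : Φ.toFun s x = Φ.toFun t x) :
    Φ.toFun (s - t) x = x := by
  apply Φ.injective t
  rw [← Φ.map_add, add_sub_cancel, h]

theorem continuous_time (t : ℝ) : Continuous (Φ.toFun t) := (Φ.contMDiff_time t).continuous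

theorem continuous_curve (x : N) : Continuous (fun t ↦ Φ.toFun t x) :=
  Φ.continuous_uncurry.comp (Continuous.prodMk_left x)

variable (Y : TransversalField H) (hH : ContMDiff (𝓡 2) 𝓘(ℝ, ℝ) ∞ H)

include Y hH

/-- Around a regular point there are no short periods. -/
theorem eventually_no_short_period {x₀ : N} (hx₀ : x₀ ∈ regularSet H) :
    ∃ δ > 0, ∀ᶠ y in 𝓝 x₀, ∀ t ∈ Ioo 0 δ, Φ.toFun t y ≠ y := by
  obtain ⟨ε, hε, s, hs0, hs⟩ := Y.exists_isSection hH hx₀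
  obtain ⟨θ, hθ, hθ0, h1, h2⟩ := Φ.exists_time hH hs isOpen_Ioo
    (c := H x₀) ⟨by linarith, by linarith⟩
  rw [hs0] at hθ hθ0 h1
  obtain ⟨r, hr, hball⟩ := Metric.eventually_nhds_iff_ball.1 h2
  refine ⟨r / 2, half_pos hr, ?_⟩
  have h3 : ∀ᶠ y in 𝓝 x₀, H y ∈ Metric.ball (H x₀) r :=
    hH.continuous.continuousAt.eventually (Metric.ball_mem_nhds _ hr)
  have h4 : ∀ᶠ y in 𝓝 x₀, θ y ∈ Metric.ball (θ x₀) (r / 2) :=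
    hθ.continuousAt.eventually (Metric.ball_mem_nhds _ (half_pos hr))
  filter_upwards [h1, h3, h4] with y hy1 hy3 hy4 t ht heq
  rw [hθ0, mem_ball_zero_iff, Real.norm_eq_abs, abs_lt] at hy4
  have key : ∀ u ∈ Ico 0 (r / 2), θ (Φ.toFun u y) = u + θ y := by
    intro u hu
    have h5 : (H y, u + θ y) ∈ Metric.ball (H x₀, (0 : ℝ)) r := by
      rw [← ball_prod_same]
      refine ⟨hy3, ?_⟩
      rw [mem_ball_zero_iff, Real.norm_eq_abs, abs_lt]
      constructor <;> linarith [hu.1, hu.2, hy4.1, hy4.2]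
    have h6 := hball _ h5
    rwa [box, Φ.map_add, hy1.2] at h6
  have := key t ⟨ht.1.le, ht.2⟩
  rw [heq] at this
  linarith [ht.1]

variable [T2Space N]

/-- The absence of short periods bounds the positive periods away from 0, so the set of them is
closed and its infimum is attained. -/
theorem isLeast_minPeriod {x : N} (hx : x ∈ Φ.periodicSet) :
    IsLeast {t | 0 < t ∧ Φ.toFun t x = x} (Φ.minPeriod x) := by
  obtain ⟨δ, hδ, hev⟩ := Φ.eventually_no_short_period Y hH hx.1
  have hev := hev.self_of_nhds
  have hS : {t | 0 < t ∧ Φ.toFun t x = x} = {t | δ ≤ t} ∩ {t | Φ.toFun t x = x} := by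
    ext t
    constructor
    · rintro ⟨h1, h2⟩
      refine ⟨?_, h2⟩
      by_contra hlt
      exact hev t ⟨h1, not_le.1 hlt⟩ h2
    · rintro ⟨h1, h2⟩
      exact ⟨hδ.trans_le h1, h2⟩
  have hcl : IsClosed {t | 0 < t ∧ Φ.toFun t x = x} := by
    rw [hS]
    exact isClosed_Ici.inter (isClosed_eq (Φ.continuous_curve x) continuous_const)
  exact hcl.isLeast_csInf hx.2 ⟨0, fun t ht ↦ ht.1.le⟩

theorem minPeriod_pos {x : N} (hx : x ∈ Φ.periodicSet) : 0 < Φ.minPeriod x :=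
  (Φ.isLeast_minPeriod Y hH hx).1.1

theorem apply_minPeriod {x : N} (hx : x ∈ Φ.periodicSet) : Φ.toFun (Φ.minPeriod x) x = x :=
  (Φ.isLeast_minPeriod Y hH hx).1.2

theorem minPeriod_le {x : N} (hx : x ∈ Φ.periodicSet) {t : ℝ} (ht : 0 < t)
    (h : Φ.toFun t x = x) : Φ.minPeriod x ≤ t :=
  (Φ.isLeast_minPeriod Y hH hx).2 ⟨ht, h⟩

omit Y hH [T2Space N] in
theorem apply_int_mul {x : N} {T : ℝ} (h : Φ.toFun T x = x) (k : ℤ) : Φ.toFun (k * T) x = x := by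
  have hnat : ∀ n : ℕ, Φ.toFun (n * T) x = x := by
    intro n
    induction n with
    | zero => simp [Φ.map_zero]
    | succ n ih =>
      rw [show ((n + 1 : ℕ) : ℝ) * T = n * T + T by push_cast; ring, Φ.map_add, h, ih]
  obtain ⟨n, rfl | rfl⟩ := k.eq_nat_or_neg
  · exact_mod_cast hnat n
  · have h1 := Φ.neg_cancel (n * T) x
    rw [hnat] at h1
    push_cast
    rwa [neg_mul]

theorem apply_eq_iff_exists_int {x : N} (hx : x ∈ Φ.periodicSet) (t : ℝ) :
    Φ.toFun t x = x ↔ ∃ k : ℤ, t = k * Φ.minPeriod x := by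
  have hT := Φ.minPeriod_pos Y hH hx
  constructor
  · intro h
    let T := Φ.minPeriod x
    have hfl1 := Int.floor_le (t / T)
    have hfl2 := Int.lt_floor_add_one (t / T)
    rw [le_div_iff₀ hT] at hfl1
    rw [div_lt_iff₀ hT] at hfl2
    refine ⟨⌊t / T⌋, ?_⟩
    by_contra hne
    have hpos : 0 < t - ⌊t / T⌋ * T := sub_pos.2 (lt_of_le_of_ne hfl1 (Ne.symm hne))
    have := Φ.minPeriod_le Y hH hx hpos (Φ.apply_sub_eq (by
      rw [h, Φ.apply_int_mul (Φ.apply_minPeriod Y hH hx)]))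
    have : T ≤ t - ⌊t / T⌋ * T := this
    nlinarith
  · rintro ⟨k, rfl⟩
    exact Φ.apply_int_mul (Φ.apply_minPeriod Y hH hx) k

/-- Regular periodic points form an open set, on which the least period is smooth. -/
theorem eventually_mem_periodicSet {x₀ : N} (hx₀ : x₀ ∈ Φ.periodicSet) :
    ContMDiffAt (𝓡 2) 𝓘(ℝ, ℝ) ∞ Φ.minPeriod x₀ ∧ ∀ᶠ y in 𝓝 x₀, y ∈ Φ.periodicSet := by
  obtain ⟨ε, hε, s, hs0, hs⟩ := Y.exists_isSection hH hx₀.1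
  obtain ⟨θ, hθ, hθ0, h1, -⟩ := Φ.exists_time hH hs isOpen_Ioo
    (c := H x₀) ⟨by linarith, by linarith⟩
  rw [hs0] at hθ hθ0 h1
  obtain ⟨δ, hδ, hshort⟩ := Φ.eventually_no_short_period Y hH hx₀.1
  let T := Φ.minPeriod x₀
  have hT : 0 < T := Φ.minPeriod_pos Y hH hx₀
  have hTx : Φ.toFun T x₀ = x₀ := Φ.apply_minPeriod Y hH hx₀
  -- This is the first-return time. Both y and Φ_T(y) lie on the flow line of s(H y), at times θ(y)
  -- and θ(Φ_T y), so flowing for T + θ(y) - θ(Φ_T y) fixes that line.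
  let τ : N → ℝ := fun y ↦ T - θ (Φ.toFun T y) + θ y
  have hθ' : ContMDiffAt (𝓡 2) 𝓘(ℝ, ℝ) ∞ θ (Φ.toFun T x₀) := by rwa [hTx]
  have hτ : ContMDiffAt (𝓡 2) 𝓘(ℝ, ℝ) ∞ τ x₀ :=
    (contMDiffAt_const.sub (hθ'.comp x₀ (Φ.contMDiff_time T x₀))).add hθ
  have hτ0 : τ x₀ = T := by simp [τ, hTx, hθ0]
  have htend : Filter.Tendsto (Φ.toFun T) (𝓝 x₀) (𝓝 x₀) := by
    have := (Φ.continuous_time T).tendsto x₀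
    rwa [hTx] at this
  -- No time in this compact interval is a period of x₀, hence none is a period of a nearby point.
  have hlong : ∀ᶠ y in 𝓝 x₀, ∀ t ∈ Icc δ (T - δ / 2), Φ.toFun t y ≠ y := by
    refine IsCompact.eventually_forall_of_forall_eventually isCompact_Icc fun t ht ↦ ?_
    have hne : Φ.toFun t x₀ ≠ x₀ := fun h ↦ by
      have : T ≤ t := Φ.minPeriod_le Y hH hx₀ (hδ.trans_le ht.1) h
      linarith [ht.2]
    have hc : Continuous (fun p : N × ℝ ↦ Φ.toFun p.2 p.1) :=
      Φ.continuous_uncurry.comp continuous_swap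
    exact (hc.continuousAt (x := (x₀, t))).ne_iff_eventually_ne
      (continuous_fst.continuousAt) |>.1 hne
  have hmain : ∀ᶠ y in 𝓝 x₀, 0 < τ y ∧ τ y < T + δ / 2 ∧ y ∈ regularSet H ∧
      Φ.toFun (τ y) y = y := by
    have e1 : ∀ᶠ y in 𝓝 x₀, τ y ∈ Ioo 0 (T + δ / 2) := by
      refine hτ.continuousAt.eventually (isOpen_Ioo.mem_nhds ?_)
      rw [hτ0]
      exact ⟨hT, by linarith⟩
    filter_upwards [e1, Y.isOpen_regularSet.mem_nhds hx₀.1, h1, htend.eventually h1]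
      with y hy1 hy2 hy3 hy4
    refine ⟨hy1.1, hy1.2, hy2, ?_⟩
    rw [Φ.apply_hamiltonian hH] at hy4
    have h5 : Φ.toFun (θ (Φ.toFun T y)) (s (H y)) = Φ.toFun (T + θ y) (s (H y)) := by
      rw [hy4.2, Φ.map_add, hy3.2]
    have h6 := Φ.apply_sub_eq h5.symm
    have h7 : Φ.toFun (τ y) y = Φ.toFun (θ y) (Φ.toFun (τ y) (s (H y))) := by
      rw [Φ.comm, hy3.2]
    rw [h7, show τ y = T + θ y - θ (Φ.toFun T y) by simp only [τ]; ring, h6, hy3.2]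
  refine ⟨hτ.congr_of_eventuallyEq ?_, hmain.mono fun y hy ↦ ⟨hy.2.2.1, _, hy.1, hy.2.2.2⟩⟩
  filter_upwards [hmain, hlong, hshort] with y hy hy1 hy2
  refine Φ.minPeriod_eq hy.1 hy.2.2.2 fun t ht0 ht ↦ ?_
  by_contra hlt
  rw [not_le] at hlt
  have hδt : δ ≤ t := by
    by_contra h
    exact hy2 t ⟨ht0, not_le.1 h⟩ ht
  have htT : T - δ / 2 < t := by
    by_contra h
    exact hy1 t ⟨hδt, not_lt.1 h⟩ ht
  -- A period t < τ(y) would exceed T - δ / 2, while τ(y) < T + δ / 2; the difference would then be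
  -- a period shorter than δ.
  refine hy2 (τ y - t) ⟨by linarith, by linarith [hy.2.1]⟩ (Φ.apply_sub_eq ?_)
  rw [hy.2.2.2, ht]

theorem isOpen_periodicSet : IsOpen Φ.periodicSet :=
  isOpen_iff_eventually.2 fun _ hx ↦ (Φ.eventually_mem_periodicSet Y hH hx).2

theorem isEmbeddedCircle_iff {c : ℝ} {L : Set N} :
    IsEmbeddedCircle Ω H c L ↔ ∃ x ∈ Φ.periodicSet, H x = c ∧ Φ.orbit x = L := by
  constructor
  · rintro ⟨γ, hγ, ⟨t, ht, hper⟩, ⟨a, b, hab⟩, hc, rfl⟩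
    have hγΦ := Φ.eq_of_isMIntegralCurve γ hγ
    refine ⟨γ 0, ⟨?_, t, ht, ?_⟩, hc 0, ?_⟩
    · by_contra hreg
      refine hab ?_
      rw [hγΦ a, hγΦ b, Φ.fixed_of_notMem_regularSet hreg, Φ.fixed_of_notMem_regularSet hreg]
    · rw [← hγΦ]
      simpa using hper 0
    · rw [orbit]
      congr 1
      exact funext fun t ↦ (hγΦ t).symm
  · rintro ⟨x, hx, rfl, rfl⟩
    refine ⟨fun t ↦ Φ.toFun t x, Φ.isMIntegralCurve x, ⟨Φ.minPeriod x, Φ.minPeriod_pos Y hH hx,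
      fun t ↦ ?_⟩, ?_, fun t ↦ Φ.apply_hamiltonian hH t x, rfl⟩
    · simp only
      rw [Φ.map_add, Φ.apply_minPeriod Y hH hx]
    · obtain ⟨δ, hδ, hev⟩ := Φ.eventually_no_short_period Y hH hx.1
      refine ⟨δ / 2, 0, ?_⟩
      simp only [Φ.map_zero]
      exact hev.self_of_nhds _ ⟨by linarith, by linarith⟩

omit Y hH [T2Space N] in
theorem orbitPeriod_orbit (x : N) : orbitPeriod Ω H (Φ.orbit x) = Φ.minPeriod x := by
  rw [orbitPeriod, minPeriod]
  congr 1
  ext t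
  refine and_congr_right fun ht ↦ ⟨?_, fun h ↦ ?_⟩
  · rintro ⟨γ, hγ, hr, hper⟩
    have hγΦ := Φ.eq_of_isMIntegralCurve γ hγ
    have h0 : γ 0 ∈ Φ.orbit x := hr ▸ mem_range_self 0
    obtain ⟨a, ha⟩ := h0
    simp only at ha
    rw [← Φ.apply_flow_eq_iff t a, ha, ← hγΦ]
    simpa using hper 0
  · refine ⟨fun t ↦ Φ.toFun t x, Φ.isMIntegralCurve x, rfl, fun u ↦ ?_⟩
    simp only
    rw [Φ.map_add, h]

/-- Two continuous curves of periodic points parametrized by `H` which meet the same orbit for one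
parameter meet the same orbits for all parameters. -/
theorem mem_orbit_of_isPreconnected {f g : ℝ → N} {K : Set ℝ} (hK : IsPreconnected K)
    (hf : ContinuousOn f K) (hg : ContinuousOn g K) (hfP : ∀ c ∈ K, f c ∈ Φ.periodicSet)
    (hfH : ∀ c ∈ K, H (f c) = c) (hgH : ∀ c ∈ K, H (g c) = c)
    {c₀ : ℝ} (hc₀ : c₀ ∈ K) (h : g c₀ ∈ Φ.orbit (f c₀)) {c : ℝ} (hc : c ∈ K) :
    g c ∈ Φ.orbit (f c) := by
  refine hK.induction₂' (fun c c' ↦ g c ∈ Φ.orbit (f c) → g c' ∈ Φ.orbit (f c')) ?_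
    (fun x y z _ _ _ h1 h2 h ↦ h2 (h1 h)) hc₀ hc h
  intro c hc
  -- If the orbits coincide at c, flowing g back by a fixed time brings both curves into one flow
  -- box. There points of equal level lie on the flow line of the same section point, so coincidence
  -- persists.
  by_cases hmem : g c ∈ Φ.orbit (f c)
  · obtain ⟨ε, hε, s, hs0, hs⟩ := Y.exists_isSection hH (hfP c hc).1
    rw [hfH c hc] at hs hs0
    obtain ⟨θ, hθ, hθ0, h1, -⟩ := Φ.exists_time hH hs isOpen_Ioo
      (c := c) ⟨by linarith, by linarith⟩
    rw [hs0] at h1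
    obtain ⟨t, ht⟩ := hmem
    simp only at ht
    have hgt : Filter.Tendsto (fun c' ↦ Φ.toFun (-t) (g c')) (𝓝[K] c) (𝓝 (f c)) := by
      have := ((Φ.continuous_time (-t)).continuousAt).tendsto.comp (hg c hc)
      rwa [← ht, Φ.neg_cancel] at this
    filter_upwards [(hf c hc).eventually h1, hgt.eventually h1, self_mem_nhdsWithin]
      with c' h2 h3 hc'
    refine ⟨fun _ ↦ ?_, fun _ ↦ ⟨t, ht⟩⟩
    rw [hfH c' hc'] at h2
    rw [Φ.apply_hamiltonian hH, hgH c' hc'] at h3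
    have h4 : s c' ∈ Φ.orbit (f c') := ⟨-θ (f c'), by
      simp only
      nth_rewrite 2 [← h2.2]
      rw [Φ.neg_cancel]⟩
    rw [← Φ.orbit_eq_of_mem h4]
    refine ⟨t + θ (Φ.toFun (-t) (g c')), ?_⟩
    simp only
    rw [Φ.map_add, h3.2, Φ.cancel_neg]
  -- If they differ at c, they differ nearby: the periods of f near c are bounded, so only a compact
  -- range of times has to be avoided.
  · have hP := Φ.eventually_mem_periodicSet Y hH (hfP c hc)
    have h1 : ∀ᶠ c' in 𝓝[K] c, Φ.minPeriod (f c') < Φ.minPeriod (f c) + 1 :=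
      (hP.1.continuousAt.tendsto.comp (hf c hc)).eventually (gt_mem_nhds (by linarith))
    have h2 : ∀ᶠ c' in 𝓝[K] c, ∀ t ∈ Icc 0 (Φ.minPeriod (f c) + 1),
        Φ.toFun t (f c') ≠ g c' := by
      have hpair : Filter.Tendsto (fun c' ↦ (f c', g c')) (𝓝[K] c) (𝓝 (f c, g c)) :=
        (hf c hc).prodMk_nhds (hg c hc)
      refine hpair.eventually (p := fun q : N × N ↦ ∀ t ∈ Icc 0 (Φ.minPeriod (f c) + 1),
        Φ.toFun t q.1 ≠ q.2) ?_
      refine IsCompact.eventually_forall_of_forall_eventually isCompact_Icc fun t ht ↦ ?_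
      have hne : Φ.toFun t (f c) ≠ g c := fun h ↦ hmem ⟨t, h⟩
      have hcont : Continuous (fun p : (N × N) × ℝ ↦ Φ.toFun p.2 p.1.1) :=
        Φ.continuous_uncurry.comp (continuous_snd.prodMk (continuous_fst.comp continuous_fst))
      exact (hcont.continuousAt (x := ((f c, g c), t))).ne_iff_eventually_ne
        ((continuous_snd.comp continuous_fst).continuousAt) |>.1 hne
    filter_upwards [h1, h2, self_mem_nhdsWithin] with c' h3 h4 hc'
    refine ⟨fun h ↦ (hmem h).elim, ?_⟩
    rintro ⟨t, ht⟩
    have hx := hfP c' hc'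
    have hper : Periodic (fun t ↦ Φ.toFun t (f c')) (Φ.minPeriod (f c')) := fun t ↦ by
      simp only
      rw [Φ.map_add, Φ.apply_minPeriod Y hH hx]
    obtain ⟨u, hu, hu'⟩ := hper.exists_mem_Ico₀ (Φ.minPeriod_pos Y hH hx) t
    simp only at ht hu'
    exact (h4 u ⟨hu.1, by linarith [hu.2]⟩ (by rw [← hu', ht])).elim

end SmoothFlow

end Periods

/-! ### Area of symplectically embedded plane domains. -/

section Area

theorem EuclideanSpace.alternating_map_eq_det (B : 𝔼 →L[ℝ] 𝔼 →L[ℝ] ℝ) (hB : ∀ v, B v v = 0)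
    (A : 𝔼 →L[ℝ] 𝔼) :
    B (A (EuclideanSpace.single 0 1)) (A (EuclideanSpace.single 1 1)) =
      A.det * B (EuclideanSpace.single 0 1) (EuclideanSpace.single 1 1) := by
  let b := (EuclideanSpace.basisFun (Fin 2) ℝ).toBasis
  have hb : ∀ i, b i = EuclideanSpace.single i 1 := fun i ↦ by simp [b]
  have hdet : A.det = (LinearMap.toMatrix b b A.toLinearMap).det :=
    (LinearMap.det_toMatrix b A.toLinearMap).symm
  have hA : ∀ j, A (b j) = LinearMap.toMatrix b b A.toLinearMap 0 j • b 0 +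
      LinearMap.toMatrix b b A.toLinearMap 1 j • b 1 := by
    intro j
    have := b.sum_repr (A (b j))
    rw [Fin.sum_univ_two] at this
    rw [LinearMap.toMatrix_apply, LinearMap.toMatrix_apply]
    exact this.symm
  have hswap : B (b 1) (b 0) = -B (b 0) (b 1) := by
    have h := hB (b 0 + b 1)
    simp only [map_add, add_apply, hB, zero_add, add_zero] at h
    linarith
  rw [← hb, ← hb, hdet, Matrix.det_fin_two, hA 0, hA 1]
  simp only [map_add, map_smul, add_apply, smul_apply, hB, hswap, smul_eq_mul]
  ring

/-- The identification of the Euclidean plane with `ℝ × ℝ`. -/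
noncomputable def EuclideanSpace.toProd : 𝔼 →L[ℝ] ℝ × ℝ :=
  (EuclideanSpace.proj 0).prod (EuclideanSpace.proj 1)

theorem EuclideanSpace.toProd_bijective : Bijective EuclideanSpace.toProd := by
  constructor
  · intro x y h
    have h' := Prod.ext_iff.1 h
    ext i
    fin_cases i
    · exact h'.1
    · exact h'.2
  · rintro ⟨a, b⟩
    exact ⟨!₂[a, b], by simp [EuclideanSpace.toProd]⟩

theorem EuclideanSpace.measurePreserving_toProd :
    MeasurePreserving EuclideanSpace.toProd :=
  (volume_preserving_finTwoArrow ℝ).comp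
    (EuclideanSpace.volume_preserving_symm_measurableEquiv_toLp (Fin 2))

variable {N : Type*} [TopologicalSpace N] [ChartedSpace (EuclideanSpace ℝ (Fin 2)) N]
  [IsManifold (𝓡 2) ∞ N] (Ω : SymplecticForm N)

/-- Change of variables for the composite of f with the chart. Its Jacobian times the chart density
is the absolute value of the pulled-back form on the standard basis, which is 1. -/
theorem SymplecticForm.chartArea_image {f : ℝ × ℝ → N} {B : Set (ℝ × ℝ)} (hB : MeasurableSet B)
    (hf : ∀ p ∈ B, MDifferentiableAt 𝓘(ℝ, ℝ × ℝ) (𝓡 2) f p) (hinj : InjOn f B)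
    (hform : ∀ p ∈ B, Ω.form (f p) (mfderiv 𝓘(ℝ, ℝ × ℝ) (𝓡 2) f p ((1, 0) : ℝ × ℝ))
      (mfderiv 𝓘(ℝ, ℝ × ℝ) (𝓡 2) f p ((0, 1) : ℝ × ℝ)) = 1)
    {x : N} (hx : ∀ p ∈ B, f p ∈ (chartAt 𝔼 x).source) :
    Ω.chartArea x (f '' B) = volume B := by
  let χ := extChartAt (𝓡 2) x
  let L := EuclideanSpace.toProd
  have hsrc : ∀ p ∈ B, f p ∈ χ.source := fun p hp ↦ by
    rw [extChartAt_source]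
    exact hx p hp
  let F : 𝔼 → 𝔼 := fun z ↦ χ (f (L z))
  have himg : χ '' (f '' B) = F '' (L ⁻¹' B) := by
    rw [image_image]
    ext y
    constructor
    · rintro ⟨p, hp, rfl⟩
      obtain ⟨z, rfl⟩ := EuclideanSpace.toProd_bijective.2 p
      exact ⟨z, hp, rfl⟩
    · rintro ⟨z, hz, rfl⟩
      exact ⟨L z, hz, rfl⟩
  have hL : ∀ z, MDifferentiableAt 𝓘(ℝ, 𝔼) 𝓘(ℝ, ℝ × ℝ) L z := fun z ↦
    L.differentiableAt.mdifferentiableAt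
  have hfL : ∀ z ∈ L ⁻¹' B, MDifferentiableAt 𝓘(ℝ, 𝔼) (𝓡 2) (fun z ↦ f (L z)) z :=
    fun z hz ↦ (hf _ hz).comp z (hL z)
  have hF : ∀ z ∈ L ⁻¹' B, DifferentiableAt ℝ F z := fun z hz ↦ by
    rw [← mdifferentiableAt_iff_differentiableAt]
    refine MDifferentiableAt.comp z ?_ (hfL z hz)
    exact mdifferentiableAt_extChartAt (hx _ hz)
  have hmeas : MeasurableSet (L ⁻¹' B) := L.continuous.measurable hB
  have hFinj : InjOn F (L ⁻¹' B) := by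
    intro z hz w hw h
    exact EuclideanSpace.toProd_bijective.1 (hinj hz hw (χ.injOn (hsrc _ hz) (hsrc _ hw) h))
  rw [SymplecticForm.chartArea]
  change ∫⁻ y in χ '' (f '' B), _ = _
  rw [himg, lintegral_image_eq_lintegral_abs_det_fderiv_mul volume hmeas
    (fun z hz ↦ (hF z hz).hasFDerivAt.hasFDerivWithinAt) hFinj]
  have hone : ∀ z ∈ L ⁻¹' B, ENNReal.ofReal |(fderiv ℝ F z).det| *
      ENNReal.ofReal (Ω.chartDensity x (F z)) = 1 := by
    intro z hz
    rw [← ENNReal.ofReal_mul (abs_nonneg _)]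
    have hinv : χ.symm (F z) = f (L z) := χ.left_inv (hsrc _ hz)
    have hFt : F z ∈ χ.target := χ.map_source (hsrc _ hz)
    have hsym : MDifferentiableAt 𝓘(ℝ, 𝔼) (𝓡 2) χ.symm (F z) :=
      (contMDiffOn_extChartAt_symm (n := 1) x (F z) hFt).contMDiffAt
        ((isOpen_extChartAt_target x).mem_nhds hFt) |>.mdifferentiableAt one_ne_zero
    let D : 𝔼 →L[ℝ] TangentSpace (𝓡 2) (χ.symm (F z)) := mfderiv 𝓘(ℝ, 𝔼) (𝓡 2) χ.symm (F z)
    have hcomp : ∀ v : 𝔼, D (fderiv ℝ F z v) =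
        (show 𝔼 from mfderiv 𝓘(ℝ, ℝ × ℝ) (𝓡 2) f (L z) (L v)) := by
      intro v
      have e1 : (fun w ↦ f (L w)) =ᶠ[𝓝 z] χ.symm ∘ F := by
        have : ∀ᶠ w in 𝓝 z, f (L w) ∈ χ.source :=
          (hfL z hz).continuousAt.eventually ((isOpen_extChartAt_source x).mem_nhds (hsrc _ hz))
        filter_upwards [this] with w hw
        exact (χ.left_inv hw).symm
      have e2 : mfderiv 𝓘(ℝ, 𝔼) (𝓡 2) (fun w ↦ f (L w)) z v =
          mfderiv 𝓘(ℝ, 𝔼) (𝓡 2) (χ.symm ∘ F) z v := by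
        rw [e1.mfderiv_eq]
        rfl
      have e3 := mfderiv_comp_apply z hsym (hF z hz).mdifferentiableAt v
      have e4 := mfderiv_comp_apply z (hf _ hz) (hL z) v
      rw [mfderiv_eq_fderiv] at e3 e4
      rw [ContinuousLinearMap.fderiv] at e4
      exact e3.symm.trans (e2.symm.trans e4)
    let Bf : 𝔼 →L[ℝ] 𝔼 →L[ℝ] ℝ := (show 𝔼 →L[ℝ] 𝔼 →L[ℝ] ℝ from Ω.form (χ.symm (F z))).bilinearComp
      (show 𝔼 →L[ℝ] 𝔼 from D) (show 𝔼 →L[ℝ] 𝔼 from D)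
    have hBf : ∀ v, Bf v v = 0 := fun v ↦ Ω.alternating _ _
    have hdet := EuclideanSpace.alternating_map_eq_det Bf hBf (fderiv ℝ F z)
    have h1 : Bf (fderiv ℝ F z (EuclideanSpace.single 0 1))
        (fderiv ℝ F z (EuclideanSpace.single 1 1)) = 1 := by
      have hL0 : L (EuclideanSpace.single 0 1) = (1, 0) := by simp [L, EuclideanSpace.toProd]
      have hL1 : L (EuclideanSpace.single 1 1) = (0, 1) := by simp [L, EuclideanSpace.toProd]
      have h2 : Bf (fderiv ℝ F z (EuclideanSpace.single 0 1))
        (fderiv ℝ F z (EuclideanSpace.single 1 1)) = Ω.form (χ.symm (F z))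
          (D (fderiv ℝ F z (EuclideanSpace.single 0 1)))
          (D (fderiv ℝ F z (EuclideanSpace.single 1 1))) := rfl
      rw [h2, hcomp, hcomp, hL0, hL1]
      have h3 := hform (L z) hz
      have key : ∀ q, q = f (L z) → ∀ v w : 𝔼, Ω.form q v w = Ω.form (f (L z)) v w := by
        rintro q rfl v w
        rfl
      exact (key _ hinv _ _).trans h3
    have h4 : Ω.chartDensity x (F z) =
      |Bf (EuclideanSpace.single 0 1) (EuclideanSpace.single 1 1)| := rfl
    rw [h4, ← abs_mul, ← hdet, h1, abs_one, ENNReal.ofReal_one]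
  rw [setLIntegral_congr_fun hmeas hone, setLIntegral_one]
  exact EuclideanSpace.measurePreserving_toProd.measure_preimage hB.nullMeasurableSet

/-- A symplectic embedding of an open subset of the plane does not increase area. -/
theorem SymplecticForm.volume_le_area [T2Space N] [SecondCountableTopology N] {f : ℝ × ℝ → N}
    {W : Set (ℝ × ℝ)} (hW : IsOpen W)
    (hf : ∀ p ∈ W, MDifferentiableAt 𝓘(ℝ, ℝ × ℝ) (𝓡 2) f p) (hinj : InjOn f W)
    (hform : ∀ p ∈ W, Ω.form (f p) (mfderiv 𝓘(ℝ, ℝ × ℝ) (𝓡 2) f p ((1, 0) : ℝ × ℝ))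
      (mfderiv 𝓘(ℝ, ℝ × ℝ) (𝓡 2) f p ((0, 1) : ℝ × ℝ)) = 1) :
    volume W ≤ Ω.area := by
  rcases W.eq_empty_or_nonempty with rfl | ⟨p₀, hp₀⟩
  · simp
  have : Nonempty N := ⟨f p₀⟩
  obtain ⟨S, hS, hScov⟩ := TopologicalSpace.countable_cover_nhds
    (fun x : N ↦ chart_source_mem_nhds 𝔼 x)
  have hSne : S.Nonempty := by
    by_contra h
    rw [not_nonempty_iff_eq_empty] at h
    have : f p₀ ∈ ⋃ x ∈ S, (chartAt 𝔼 x).source := hScov ▸ mem_univ _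
    simp [h] at this
  obtain ⟨x, rfl⟩ := hS.exists_eq_range hSne
  have hfc : ContinuousOn f W := fun p hp ↦ (hf p hp).continuousAt.continuousWithinAt
  -- The domain is cut into countably many disjoint Borel pieces, each mapped into one chart; the
  -- finite partial sums compete in the supremum defining the area.
  let A : ℕ → Set (ℝ × ℝ) := fun i ↦ W ∩ f ⁻¹' (chartAt 𝔼 (x i)).source
  have hA : ∀ i, IsOpen (A i) := fun i ↦ hfc.isOpen_inter_preimage hW (chartAt 𝔼 (x i)).open_source
  have hAB : ∀ i, disjointed A i ⊆ A i := disjointed_subset A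
  have hBm : ∀ i, MeasurableSet (disjointed A i) :=
    fun i ↦ MeasurableSet.disjointed (fun i ↦ (hA i).measurableSet) i
  have hunion : ⋃ i, disjointed A i = W := by
    rw [iUnion_disjointed]
    refine Subset.antisymm (iUnion_subset fun i ↦ inter_subset_left) fun p hp ↦ ?_
    have : f p ∈ ⋃ y ∈ range x, (chartAt 𝔼 y).source := hScov ▸ mem_univ _
    simp only [mem_range, iUnion_exists, iUnion_iUnion_eq', mem_iUnion] at this
    obtain ⟨i, hi⟩ := this
    exact mem_iUnion.2 ⟨i, hp, hi⟩
  rw [← hunion, measure_iUnion (disjoint_disjointed A) hBm, ENNReal.tsum_eq_iSup_nat]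
  refine iSup_le fun n ↦ ?_
  have harea : ∀ i, Ω.chartArea (x i) (f '' disjointed A i) = volume (disjointed A i) := fun i ↦
    Ω.chartArea_image (hBm i) (fun p hp ↦ hf p (hAB i hp).1)
      (hinj.mono fun p hp ↦ (hAB i hp).1) (fun p hp ↦ hform p (hAB i hp).1)
      (fun p hp ↦ (hAB i hp).2)
  rw [← Fin.sum_univ_eq_sum_range (fun i ↦ volume (disjointed A i)) n]
  simp only [← harea]
  have hK : ∀ i : Fin n, MeasurableSet[borel N] (f '' disjointed A i) ∧
      f '' disjointed A i ⊆ (chartAt 𝔼 (x i)).source := by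
    intro i
    constructor
    -- The image of a Borel set under an injective continuous map is Borel (Lusin–Souslin).
    · borelize N
      have : BorelSpace N := ⟨rfl⟩
      exact (hBm i).image_of_continuousOn_injOn (hfc.mono fun p hp ↦ (hAB i hp).1)
        (hinj.mono fun p hp ↦ (hAB i hp).1)
    · rintro _ ⟨p, hp, rfl⟩
      exact (hAB i hp).2
  have hdisj : Pairwise (fun i j : Fin n ↦
      Disjoint (f '' disjointed A i) (f '' disjointed A j)) := by
    intro i j hij
    rw [Set.disjoint_left]
    rintro _ ⟨p, hp, rfl⟩ ⟨q, hq, hpq⟩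
    have := hinj (hAB _ hq).1 (hAB _ hp).1 hpq
    subst this
    exact Set.disjoint_left.1 (disjoint_disjointed A (fun h ↦ hij (Fin.ext h))) hp hq
  exact le_iSup_of_le n (le_iSup_of_le (fun i ↦ x i) (le_iSup_of_le (fun i ↦ f '' disjointed A i)
    (le_iSup_of_le hK (le_iSup_of_le hdisj le_rfl))))

end Area

/-! ### Functions with vanishing differential. -/

section ConstantFunctions

variable {E : Type*} [NormedAddCommGroup E] [NormedSpace ℝ E] {K : Type*} [TopologicalSpace K]
  {I : ModelWithCorners ℝ E K} [I.Boundaryless] {M : Type*} [TopologicalSpace M]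
  [ChartedSpace K M] [IsManifold I 1 M]

theorem eventually_eq_of_mvfderiv_eq_zero {h : M → ℝ} (hh : MDifferentiable I 𝓘(ℝ, ℝ) h) {x : M}
    (h0 : ∀ᶠ y in 𝓝 x, mvfderiv I h y = 0) : ∀ᶠ y in 𝓝 x, h y = h x := by
  let χ := extChartAt I x
  have hev : ∀ᶠ z in 𝓝 (χ x), z ∈ χ.target ∧ mvfderiv I h (χ.symm z) = 0 := by
    have h1 : ∀ᶠ z in 𝓝 (χ x), z ∈ χ.target :=
      (isOpen_extChartAt_target x).mem_nhds (mem_extChartAt_target x)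
    refine h1.and ?_
    exact (continuousAt_extChartAt_symm (I := I) x).eventually
      (p := fun y ↦ mvfderiv I h y = 0) (by simpa using h0)
  obtain ⟨r, hr, hball⟩ := Metric.eventually_nhds_iff_ball.1 hev
  have hd : ∀ z ∈ Metric.ball (χ x) r, HasFDerivAt (fun z ↦ h (χ.symm z)) (0 : E →L[ℝ] ℝ) z := by
    intro z hz
    obtain ⟨hz1, hz2⟩ := hball z hz
    have hsym : MDifferentiableAt 𝓘(ℝ, E) I χ.symm z :=
      (contMDiffOn_extChartAt_symm (n := 1) x z hz1).contMDiffAt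
        ((isOpen_extChartAt_target x).mem_nhds hz1) |>.mdifferentiableAt one_ne_zero
    have h1 := (hh (χ.symm z)).hasMFDerivAt.comp z hsym.hasMFDerivAt
    refine (hasMFDerivAt_iff_hasFDerivAt.1 h1).congr_fderiv ?_
    ext v
    exact DFunLike.congr_fun hz2 _
  have hmem : ∀ᶠ y in 𝓝 x, χ y ∈ Metric.ball (χ x) r ∧ y ∈ χ.source :=
    ((continuousAt_extChartAt x).eventually (Metric.ball_mem_nhds _ hr)).and
      (extChartAt_source_mem_nhds x)
  filter_upwards [hmem] with y hy
  have h1 := (convex_ball (χ x) r).is_const_of_fderivWithin_eq_zero (𝕜 := ℝ)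
    (f := fun z ↦ h (χ.symm z)) (fun z hz ↦ (hd z hz).differentiableAt.differentiableWithinAt)
    (fun z hz ↦ by
      rw [fderivWithin_of_isOpen Metric.isOpen_ball hz]
      exact (hd z hz).fderiv) hy.1 (Metric.mem_ball_self hr)
  simpa only [χ.left_inv hy.2, χ.left_inv (mem_extChartAt_source x)] using h1

theorem eq_of_mvfderiv_eq_zero [PreconnectedSpace M] {h : M → ℝ}
    (hh : MDifferentiable I 𝓘(ℝ, ℝ) h) (h0 : ∀ y, mvfderiv I h y = 0) (x y : M) : h x = h y := by
  refine PreconnectedSpace.induction₂' (fun x y ↦ h x = h y) (fun x ↦ ?_)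
    ⟨fun _ _ _ h1 h2 ↦ h1.trans h2⟩ x y
  filter_upwards [eventually_eq_of_mvfderiv_eq_zero hh (x := x) (Filter.Eventually.of_forall h0)]
    with y hy
  exact ⟨hy.symm, hy⟩

end ConstantFunctions

/-! ### Existence of periodic orbits and the isotopies they form. -/

section Cylinders

variable {N : Type*} [TopologicalSpace N] [ChartedSpace (EuclideanSpace ℝ (Fin 2)) N]
  [IsManifold (𝓡 2) ∞ N] {Ω : SymplecticForm N} {H : N → ℝ}
  (Φ : SmoothFlow (Ω.hamiltonianVectorField H)) (Y : TransversalField H)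
  (hH : ContMDiff (𝓡 2) 𝓘(ℝ, ℝ) ∞ H)

namespace SmoothFlow

theorem regularSet_nonempty [ConnectedSpace N] (hH : ContMDiff (𝓡 2) 𝓘(ℝ, ℝ) ∞ H)
    (hnc : ∃ x y : N, H x ≠ H y) : (regularSet H).Nonempty := by
  by_contra h
  obtain ⟨x, y, hxy⟩ := hnc
  have : IsManifold (𝓡 2) 1 N := IsManifold.of_le (m := 1) (n := ∞) (by simp)
  refine hxy (eq_of_mvfderiv_eq_zero (I := 𝓡 2) (hH.mdifferentiable (by simp)) (fun z ↦ ?_) x y)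
  by_contra hz
  exact h ⟨z, hz⟩

include hH in
/-- The part of the flow box of a section on which the flow box map is injective has at most the
area of the surface. -/
theorem volume_le_area [T2Space N] [SecondCountableTopology N] {Y : TransversalField H}
    {s : ℝ → N} {J : Set ℝ} (hs : Y.IsSection s J) (hJ : IsOpen J) {W : Set (ℝ × ℝ)}
    (hW : IsOpen W) (hWJ : ∀ p ∈ W, p.1 ∈ J)
    (hinj : ∀ c t t', (c, t) ∈ W → (c, t') ∈ W → Φ.toFun t (s c) = Φ.toFun t' (s c) → t = t') :
    volume W ≤ Ω.area := by
  refine Ω.volume_le_area (f := Φ.box s) hW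
    (fun p hp ↦ (Φ.contMDiffAt_box hs hJ (hWJ p hp)).mdifferentiableAt (by simp)) ?_
    (fun p hp ↦ Φ.form_mfderiv_box hH hs hJ (hWJ p hp))
  rintro ⟨c, t⟩ hp ⟨c', t'⟩ hp' h
  have h1 := Φ.apply_box hH hs (hWJ _ hp)
  have h2 := Φ.apply_box hH hs (hWJ _ hp')
  simp only at h1 h2
  rw [h, h2] at h1
  subst h1
  rw [hinj _ _ _ hp hp' h]

-- Without periodic points the flow box of any section is injective for all times, since the level
-- separates different flow lines. An interval times ℝ, of infinite area, would then embed
-- symplectically.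
include Y in
theorem periodicSet_nonempty [T2Space N] [SecondCountableTopology N] [ConnectedSpace N]
    (hH : ContMDiff (𝓡 2) 𝓘(ℝ, ℝ) ∞ H) (hnc : ∃ x y : N, H x ≠ H y) (hΩ : Ω.area < ⊤) :
    Φ.periodicSet.Nonempty := by
  by_contra hP
  obtain ⟨x₀, hx₀⟩ := regularSet_nonempty hH hnc
  obtain ⟨ε, hε, s, hs0, hs⟩ := Y.exists_isSection hH hx₀
  have hno : ∀ x ∈ regularSet H, ∀ t, 0 < t → Φ.toFun t x ≠ x := fun x hx t ht h ↦
    hP ⟨x, hx, t, ht, h⟩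
  have hinj : ∀ c ∈ Ioo (H x₀ - ε) (H x₀ + ε), ∀ t t',
      Φ.toFun t (s c) = Φ.toFun t' (s c) → t = t' := by
    intro c hc t t' h
    have hreg := hs.mem_regularSet c hc
    rcases lt_trichotomy t t' with hlt | heq | hlt
    · exact (hno _ hreg _ (sub_pos.2 hlt) (Φ.apply_sub_eq h.symm)).elim
    · exact heq
    · exact (hno _ hreg _ (sub_pos.2 hlt) (Φ.apply_sub_eq h)).elim
  have hW := Φ.volume_le_area hH hs isOpen_Ioo
    (W := Ioo (H x₀ - ε) (H x₀ + ε) ×ˢ univ) (isOpen_Ioo.prod isOpen_univ) (fun p hp ↦ hp.1)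
    (fun c t t' hp _ h ↦ hinj c hp.1 t t' h)
  rw [Measure.volume_eq_prod, Measure.prod_prod, Real.volume_univ, Real.volume_Ioo,
    ENNReal.mul_top (by rw [Ne, ENNReal.ofReal_eq_zero]; linarith)] at hW
  exact (hW.trans_lt hΩ).false

end SmoothFlow

/-- The principal argument is smooth near 1, so arg(z₀) + arg(z / z₀) is a branch of the argument
that is smooth at z₀. -/
theorem Circle.exists_contMDiffAt_arg (z₀ : Circle) :
    ∃ θ : Circle → ℝ, ContMDiffAt (𝓡 1) 𝓘(ℝ, ℝ) ∞ θ z₀ ∧ ∀ z, Circle.exp (θ z) = z := by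
  refine ⟨fun z ↦ (z₀ : ℂ).arg + ((z / z₀ : Circle) : ℂ).arg, ?_, fun z ↦ ?_⟩
  · have hfact : Fact (Module.finrank ℝ ℂ = 1 + 1) := finrank_real_complex_fact'
    have h1 : ContMDiff (𝓡 1) (𝓡 1) ∞ (fun z : Circle ↦ z / z₀) := by
      simp only [div_eq_mul_inv]
      exact contMDiff_mul_right (I := 𝓡 1) (a := z₀⁻¹)
    have h2 : ContMDiff (𝓡 1) 𝓘(ℝ, ℂ) ∞ (fun z : Circle ↦ (z : ℂ)) := contMDiff_coe_sphere
    have h3 : ContDiffAt ℝ ∞ Complex.arg ((z₀ / z₀ : Circle) : ℂ) := by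
      have hlog : ContDiffAt ℝ ∞ Complex.log ((z₀ / z₀ : Circle) : ℂ) :=
        (Complex.contDiffAt_log (by simp)).restrict_scalars ℝ
      have him : Complex.arg = Complex.imCLM ∘ Complex.log := funext fun z ↦ (Complex.log_im z).symm
      rw [him]
      exact Complex.imCLM.contDiff.contDiffAt.comp _ hlog
    have h4 : ContMDiffAt (𝓡 1) 𝓘(ℝ, ℝ) ∞ (fun z : Circle ↦ ((z / z₀ : Circle) : ℂ).arg) z₀ :=
      h3.contMDiffAt.comp z₀ ((h2.comp h1) z₀)
    exact contMDiffAt_const.add h4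
  · rw [Circle.exp_add, Circle.exp_arg, Circle.exp_arg, mul_div_cancel]

namespace SmoothFlow

/-- The rotation by the angle `arg z` of the orbit of `x` of period `T`. -/
noncomputable def rotate (T : ℝ) (z : Circle) (x : N) : N :=
  Φ.toFun (T * (z : ℂ).arg / (2 * Real.pi)) x

/-- Two arguments of the same point of the circle differ by a multiple of 2π, which amounts to a
multiple of the period T. Hence any branch of the argument may be used, in particular one smooth at
a given point. -/
theorem rotate_exp {T : ℝ} {x : N} (h : Φ.toFun T x = x) (θ : ℝ) :
    Φ.rotate T (Circle.exp θ) x = Φ.toFun (T * θ / (2 * Real.pi)) x := by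
  obtain ⟨m, hm⟩ := Circle.exp_eq_exp.1 (Circle.exp_arg (Circle.exp θ))
  rw [rotate, hm]
  have : T * (θ + m * (2 * Real.pi)) / (2 * Real.pi) = T * θ / (2 * Real.pi) + m * T := by
    field_simp
  rw [this, Φ.map_add, Φ.apply_int_mul h]

variable {Φ}

theorem contMDiffAt_rotate {E' : Type*} [NormedAddCommGroup E'] [NormedSpace ℝ E'] {K : Type*}
    [TopologicalSpace K] {I' : ModelWithCorners ℝ E' K} {M : Type*} [TopologicalSpace M]
    [ChartedSpace K M] {T : M → ℝ} {f : M → N} {m : M} (hT : ContMDiffAt I' 𝓘(ℝ, ℝ) ∞ T m)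
    (hf : ContMDiffAt I' (𝓡 2) ∞ f m) (h : ∀ᶠ m' in 𝓝 m, Φ.toFun (T m') (f m') = f m')
    (z₀ : Circle) :
    ContMDiffAt (I'.prod (𝓡 1)) (𝓡 2) ∞ (fun p : M × Circle ↦ Φ.rotate (T p.1) p.2 (f p.1))
      (m, z₀) := by
  obtain ⟨θ, hθ, hexp⟩ := Circle.exists_contMDiffAt_arg z₀
  have h1 : ContMDiffAt (I'.prod (𝓡 1)) 𝓘(ℝ, ℝ) ∞ (fun p : M × Circle ↦ T p.1) (m, z₀) :=
    hT.comp (m, z₀) contMDiffAt_fst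
  have h2 : ContMDiffAt (I'.prod (𝓡 1)) 𝓘(ℝ, ℝ) ∞ (fun p : M × Circle ↦ θ p.2) (m, z₀) :=
    hθ.comp (m, z₀) contMDiffAt_snd
  have h3 : ContMDiffAt (I'.prod (𝓡 1)) (𝓡 2) ∞ (fun p : M × Circle ↦ f p.1) (m, z₀) :=
    hf.comp (m, z₀) contMDiffAt_fst
  have h4 : ContMDiffAt (I'.prod (𝓡 1)) 𝓘(ℝ, ℝ) ∞
      (fun p : M × Circle ↦ T p.1 * θ p.2 / (2 * Real.pi)) (m, z₀) := by
    simp only [div_eq_mul_inv]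
    exact (h1.mul h2).mul contMDiffAt_const
  have h5 := (Φ.contMDiff (T m * θ z₀ / (2 * Real.pi), f m)).comp (m, z₀) (h4.prodMk h3)
  refine h5.congr_of_eventuallyEq ?_
  filter_upwards [continuousAt_fst.eventually h] with p hp
  have := Φ.rotate_exp hp (θ p.2)
  rwa [hexp] at this

variable (Φ) {Y}
variable [T2Space N]

include hH

/-- The orbit of s(c), with its period T(c) rescaled to 2π, parametrizes the circle at level c.
Smoothness in c rests on smoothness of the least period, and injectivity on its minimality. -/
theorem isSmoothIsotopyOfCircles_orbit {s : ℝ → N} {J : Set ℝ} (hs : Y.IsSection s J)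
    (hJ : IsOpen J) (hP : ∀ c ∈ J, s c ∈ Φ.periodicSet) {L : ℝ → Set N}
    (hL : ∀ c ∈ J, Φ.orbit (s c) = L c) : IsSmoothIsotopyOfCircles J L := by
  have hs' : ∀ c ∈ J, ContMDiffAt 𝓘(ℝ, ℝ) (𝓡 2) ∞ s c := fun c hc ↦
    (hs.contMDiffOn hJ c hc).contMDiffAt (hJ.mem_nhds hc)
  have hper : ∀ c ∈ J, Φ.toFun (Φ.minPeriod (s c)) (s c) = s c := fun c hc ↦
    Φ.apply_minPeriod Y hH (hP c hc)
  refine ⟨fun p ↦ Φ.rotate (Φ.minPeriod (s p.1)) p.2 (s p.1), ?_, fun c hc ↦ ⟨?_, ?_, ?_⟩⟩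
  · rintro ⟨c, z⟩ ⟨hc, -⟩
    refine ContMDiffAt.contMDiffWithinAt (contMDiffAt_rotate (T := fun c ↦ Φ.minPeriod (s c))
      ?_ (hs' c hc) ?_ z)
    · exact (Φ.eventually_mem_periodicSet Y hH (hP c hc)).1.comp c (hs' c hc)
    · filter_upwards [hJ.mem_nhds hc] with c' hc'
      exact hper c' hc'
  · intro z w hzw
    simp only at hzw
    rw [← Circle.exp_arg z, ← Circle.exp_arg w, Φ.rotate_exp (hper c hc),
      Φ.rotate_exp (hper c hc)] at hzw
    obtain ⟨k, hk⟩ := (Φ.apply_eq_iff_exists_int Y hH (hP c hc) _).1 (Φ.apply_sub_eq hzw)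
    rw [← Circle.exp_arg z, ← Circle.exp_arg w, Circle.exp_eq_exp]
    refine ⟨k, ?_⟩
    have hT := (Φ.minPeriod_pos Y hH (hP c hc)).ne'
    field_simp at hk
    linarith
  · intro z
    let f : Circle → N := fun z ↦ Φ.rotate (Φ.minPeriod (s c)) z (s c)
    change Injective (mfderiv (𝓡 1) (𝓡 2) f z)
    have hf : MDifferentiableAt (𝓡 1) (𝓡 2) f z := by
      have h1 := contMDiffAt_rotate (Φ := Φ) (I' := 𝓘(ℝ, ℝ)) (T := fun _ : ℝ ↦ Φ.minPeriod (s c))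
        (f := fun _ : ℝ ↦ s c) (m := c) contMDiffAt_const contMDiffAt_const
        (Filter.Eventually.of_forall fun _ ↦ hper c hc) z
      have h2 : ContMDiffAt (𝓡 1) (𝓘(ℝ, ℝ).prod (𝓡 1)) ∞ (fun z : Circle ↦ (c, z)) z :=
        contMDiffAt_const.prodMk contMDiffAt_id
      exact (h1.comp z h2).mdifferentiableAt (by simp)
    -- Composed with the exponential, the parametrization is an integral curve at speed T / 2π, with
    -- nonzero velocity since the point is regular. As the tangent line of the circle is
    -- one-dimensional, this gives injectivity.
    obtain ⟨θ, rfl⟩ : ∃ θ, Circle.exp θ = z := ⟨_, Circle.exp_arg z⟩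
    have hexp : HasMFDerivAt 𝓘(ℝ, ℝ) (𝓡 1) Circle.exp θ ((1 : ℝ →L[ℝ] ℝ).smulRight
        (mfderiv 𝓘(ℝ, ℝ) (𝓡 1) Circle.exp θ (1 : ℝ))) := by
      have := (contMDiff_circleExp.mdifferentiable one_ne_zero θ).hasMFDerivAt
      refine this.congr_mfderiv (ContinuousLinearMap.ext fun a ↦ ?_)
      have := map_smul (mfderiv 𝓘(ℝ, ℝ) (𝓡 1) Circle.exp θ) (show ℝ from a) (1 : ℝ)
      refine Eq.trans ?_ this
      congr 1
      exact (mul_one (show ℝ from a)).symm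
    have h1 := hexp.comp_curve hf
    let a := Φ.minPeriod (s c) / (2 * Real.pi)
    have ha : a ≠ 0 := div_ne_zero (Φ.minPeriod_pos Y hH (hP c hc)).ne' (by positivity)
    have h2 : IsMIntegralCurve ((fun t ↦ Φ.toFun t (s c)) ∘ (· * a))
        (a • Ω.hamiltonianVectorField H) := (Φ.isMIntegralCurve (s c)).comp_mul a
    have h3 : ((fun t ↦ Φ.toFun t (s c)) ∘ (· * a)) = fun θ ↦ f (Circle.exp θ) := by
      funext θ
      simp only [comp_apply, f]
      rw [Φ.rotate_exp (hper c hc)]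
      congr 1
      simp only [a]
      ring
    rw [h3] at h2
    have h4 := h1.curve_unique (h2 θ)
    have hX : (a • Ω.hamiltonianVectorField H) (f (Circle.exp θ)) ≠ 0 := by
      rw [Pi.smul_apply]
      refine smul_ne_zero ha ?_
      rw [Ne, Ω.hamiltonianVectorField_eq_zero_iff]
      exact (Φ.mem_regularSet_iff _ _).2 (hs.mem_regularSet c hc)
    rw [← h4] at hX
    have hne : mfderiv 𝓘(ℝ, ℝ) (𝓡 1) Circle.exp θ (1 : ℝ) ≠ 0 := fun h ↦ hX (by rw [h, _root_.map_zero])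
    have hfr : Module.finrank ℝ (TangentSpace (𝓡 1) (Circle.exp θ)) = 1 :=
      (finrank_euclideanSpace_fin : Module.finrank ℝ (EuclideanSpace ℝ (Fin 1)) = 1)
    rw [injective_iff_map_eq_zero]
    intro v hv
    obtain ⟨b, rfl⟩ := exists_smul_eq_of_finrank_eq_one hfr hne v
    rw [map_smul] at hv
    rcases smul_eq_zero.1 hv with hb | hb
    · rw [hb, zero_smul]
    · exact (hX hb).elim
  · rw [← hL c hc]
    ext x
    constructor
    · rintro ⟨z, rfl⟩
      exact Φ.mem_orbit _ _
    · rintro ⟨t, rfl⟩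
      have hT := (Φ.minPeriod_pos Y hH (hP c hc)).ne'
      refine ⟨Circle.exp (2 * Real.pi * t / Φ.minPeriod (s c)), ?_⟩
      simp only
      rw [Φ.rotate_exp (hper c hc)]
      congr 1
      field_simp

end SmoothFlow

end Cylinders

/-! ### Maximal sections of periodic points and largest cylinders. -/

section MaximalSections

variable {N : Type*} [TopologicalSpace N] [ChartedSpace (EuclideanSpace ℝ (Fin 2)) N]
  [IsManifold (𝓡 2) ∞ N] {Ω : SymplecticForm N} {H : N → ℝ}

/-- `s` is a section through `x₀` over the open interval `J` consisting of periodic points. -/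
structure SmoothFlow.IsPeriodicSection (Φ : SmoothFlow (Ω.hamiltonianVectorField H))
    (Y : TransversalField H) (x₀ : N) (s : ℝ → N) (J : Set ℝ) : Prop where
  isOpen : IsOpen J
  ordConnected : J.OrdConnected
  mem : H x₀ ∈ J
  isSection : Y.IsSection s J
  apply_eq : s (H x₀) = x₀
  mem_periodicSet : ∀ c ∈ J, s c ∈ Φ.periodicSet

namespace SmoothFlow

variable {Φ : SmoothFlow (Ω.hamiltonianVectorField H)} {Y : TransversalField H}

variable [T2Space N]

theorem IsPeriodicSection.eqOn {x₀ : N} {s s' : ℝ → N} {J J' : Set ℝ}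
    (h : Φ.IsPeriodicSection Y x₀ s J) (h' : Φ.IsPeriodicSection Y x₀ s' J') :
    EqOn s s' (J ∩ J') :=
  (h.isSection.mono inter_subset_left).eqOn (h'.isSection.mono inter_subset_right)
    (h.isOpen.inter h'.isOpen) (h.ordConnected.inter h'.ordConnected).isPreconnected
    ⟨h.mem, h'.mem⟩ (h.apply_eq.trans h'.apply_eq.symm)

/-- Two sections that meet once agree on the whole overlap, which is an interval, so they can be
glued. -/
theorem IsPeriodicSection.union {x₀ : N} {s σ : ℝ → N} {J J' : Set ℝ}
    (h : Φ.IsPeriodicSection Y x₀ s J) (hJ' : IsOpen J') (hc : J'.OrdConnected)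
    (hσ : Y.IsSection σ J') (hσP : ∀ c ∈ J', σ c ∈ Φ.periodicSet)
    {c₁ : ℝ} (h₁ : c₁ ∈ J ∩ J') (heq : s c₁ = σ c₁) :
    ∃ s', Φ.IsPeriodicSection Y x₀ s' (J ∪ J') := by
  classical
  have hEq : EqOn s σ (J ∩ J') := (h.isSection.mono inter_subset_left).eqOn
    (hσ.mono inter_subset_right) (h.isOpen.inter hJ')
    (h.ordConnected.inter hc).isPreconnected h₁ heq
  let s' : ℝ → N := J.piecewise s σ
  have h1 : EqOn s' s J := fun c hc ↦ piecewise_eq_of_mem _ _ _ hc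
  have h2 : EqOn s' σ J' := by
    intro c hc
    by_cases hcJ : c ∈ J
    · rw [h1 hcJ, hEq ⟨hcJ, hc⟩]
    · exact piecewise_eq_of_notMem _ _ _ hcJ
  refine ⟨s', h.isOpen.union hJ', ?_, Or.inl h.mem, ?_, (h1 h.mem).trans h.apply_eq, ?_⟩
  · exact (h.ordConnected.isPreconnected.union c₁ h₁.1 h₁.2 hc.isPreconnected).ordConnected
  · refine TransversalField.IsSection.of_locally (h.isOpen.union hJ') fun c hc ↦ ?_
    rcases hc with hc | hc
    · exact ⟨s, J, h.isOpen, hc, h.isSection, h1.eventuallyEq_of_mem (h.isOpen.mem_nhds hc)⟩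
    · exact ⟨σ, J', hJ', hc, hσ, h2.eventuallyEq_of_mem (hJ'.mem_nhds hc)⟩
  · rintro c (hc | hc)
    · rw [h1 hc]
      exact h.mem_periodicSet c hc
    · rw [h2 hc]
      exact hσP c hc

variable (Φ Y) (hH : ContMDiff (𝓡 2) 𝓘(ℝ, ℝ) ∞ H)

include hH

/-- Sections through x₀ agree wherever both are defined, so all of them combine on the union of
their intervals. -/
theorem exists_isPeriodicSection_maximal {x₀ : N} (hx₀ : x₀ ∈ Φ.periodicSet) :
    ∃ s J, Φ.IsPeriodicSection Y x₀ s J ∧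
      ∀ s' J', Φ.IsPeriodicSection Y x₀ s' J' → J' ⊆ J := by
  classical
  have hloc : ∃ s J, Φ.IsPeriodicSection Y x₀ s J := by
    obtain ⟨ε, hε, s, hs0, hs⟩ := Y.exists_isSection hH hx₀.1
    have hmem : H x₀ ∈ Ioo (H x₀ - ε) (H x₀ + ε) := ⟨by linarith, by linarith⟩
    have hcont := (hs.isMIntegralCurveAt isOpen_Ioo hmem).continuousAt
    have hev : ∀ᶠ c in 𝓝 (H x₀), s c ∈ Φ.periodicSet ∧ c ∈ Ioo (H x₀ - ε) (H x₀ + ε) := by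
      refine (hcont.eventually ((Φ.isOpen_periodicSet Y hH).mem_nhds ?_)).and
        (isOpen_Ioo.mem_nhds hmem)
      rwa [hs0]
    obtain ⟨δ, hδ, hball⟩ := Metric.eventually_nhds_iff_ball.1 hev
    rw [Real.ball_eq_Ioo] at hball
    exact ⟨s, Ioo (H x₀ - δ) (H x₀ + δ), isOpen_Ioo, ordConnected_Ioo,
      ⟨by linarith, by linarith⟩, hs.mono fun c hc ↦ (hball c hc).2, hs0,
      fun c hc ↦ (hball c hc).1⟩
  let 𝒥 : Set (Set ℝ) := {J | ∃ s, Φ.IsPeriodicSection Y x₀ s J}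
  let s : ℝ → N := fun c ↦ if h : ∃ p : (ℝ → N) × Set ℝ, Φ.IsPeriodicSection Y x₀ p.1 p.2 ∧ c ∈ p.2
    then h.choose.1 c else x₀
  have hs : ∀ s' J', Φ.IsPeriodicSection Y x₀ s' J' → EqOn s s' J' := by
    intro s' J' h' c hc
    have hex : ∃ p : (ℝ → N) × Set ℝ, Φ.IsPeriodicSection Y x₀ p.1 p.2 ∧ c ∈ p.2 :=
      ⟨(s', J'), h', hc⟩
    simp only [s, dif_pos hex]
    exact hex.choose_spec.1.eqOn h' ⟨hex.choose_spec.2, hc⟩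
  have hsub : ∀ s' J', Φ.IsPeriodicSection Y x₀ s' J' → J' ⊆ ⋃₀ 𝒥 := fun s' J' h' ↦
    subset_sUnion_of_mem ⟨s', h'⟩
  have hopen : IsOpen (⋃₀ 𝒥) := isOpen_sUnion fun J ⟨_, h⟩ ↦ h.isOpen
  obtain ⟨s₁, J₁, h₁⟩ := hloc
  refine ⟨s, ⋃₀ 𝒥, ⟨hopen, ?_, hsub _ _ h₁ h₁.mem, ?_, ?_, ?_⟩, hsub⟩
  · have h2 : ∀ J ∈ 𝒥, IsPreconnected J := fun J ⟨_, h⟩ ↦ h.ordConnected.isPreconnected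
    exact (isPreconnected_sUnion (H x₀) 𝒥 (fun J ⟨_, h⟩ ↦ h.mem) h2).ordConnected
  · refine TransversalField.IsSection.of_locally hopen fun c hc ↦ ?_
    obtain ⟨J, ⟨s', h'⟩, hcJ⟩ := hc
    exact ⟨s', J, h'.isOpen, hcJ, h'.isSection,
      (hs s' J h').eventuallyEq_of_mem (h'.isOpen.mem_nhds hcJ)⟩
  · rw [hs _ _ h₁ h₁.mem, h₁.apply_eq]
  · rintro c ⟨J, ⟨s', h'⟩, hcJ⟩
    rw [hs s' J h' hcJ]
    exact h'.mem_periodicSet c hcJ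

/-- A maximal section leaves every compact set of periodic points. -/
theorem IsPeriodicSection.mem_of_isCompact {x₀ : N} {s : ℝ → N} {J : Set ℝ}
    (h : Φ.IsPeriodicSection Y x₀ s J)
    (hmax : ∀ s' J', Φ.IsPeriodicSection Y x₀ s' J' → J' ⊆ J) {K : Set N} (hK : IsCompact K)
    (hKP : K ⊆ Φ.periodicSet) {b : ℝ} (hsK : ∀ c ∈ J ∩ uIcc (H x₀) b, s c ∈ K) : b ∈ J := by
  -- Through every point of K there is a section of the same length 2ε, by compactness.
  have huni : ∃ ε > 0, ∀ x ∈ K, ∃ σ : ℝ → N, σ (H x) = x ∧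
      Y.IsSection σ (Ioo (H x - ε) (H x + ε)) := by
    refine hK.induction_on (p := fun S ↦ ∃ ε > 0, ∀ x ∈ S, ∃ σ : ℝ → N, σ (H x) = x ∧
      Y.IsSection σ (Ioo (H x - ε) (H x + ε))) ⟨1, one_pos, fun x hx ↦ hx.elim⟩ ?_ ?_ ?_
    · rintro S S' hSS' ⟨ε, hε, h⟩
      exact ⟨ε, hε, fun x hx ↦ h x (hSS' hx)⟩
    · rintro S S' ⟨ε, hε, h⟩ ⟨ε', hε', h'⟩
      refine ⟨min ε ε', lt_min hε hε', fun x hx ↦ ?_⟩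
      have m1 := min_le_left ε ε'
      have m2 := min_le_right ε ε'
      rcases hx with hx | hx
      · obtain ⟨σ, h0, h1⟩ := h x hx
        exact ⟨σ, h0, h1.mono (Ioo_subset_Ioo (by linarith) (by linarith))⟩
      · obtain ⟨σ, h0, h1⟩ := h' x hx
        exact ⟨σ, h0, h1.mono (Ioo_subset_Ioo (by linarith) (by linarith))⟩
    · intro x hx
      obtain ⟨ε, hε, hev⟩ := Y.eventually_exists_isSection hH (hKP hx).1
      exact ⟨_, mem_nhdsWithin_of_mem_nhds hev, ε, hε, fun x hx ↦ hx⟩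
  obtain ⟨ε, hε, huni⟩ := huni
  suffices hsub : uIcc (H x₀) b ⊆ J from hsub right_mem_uIcc
  refine isPreconnected_uIcc.subset_of_closure_inter_subset h.isOpen
    ⟨H x₀, left_mem_uIcc, h.mem⟩ ?_
  rintro m ⟨hmc, hmb⟩
  by_contra hmJ
  have hne : m ≠ H x₀ := fun h' ↦ hmJ (h' ▸ h.mem)
  have hpos : 0 < |m - H x₀| := abs_pos.2 (sub_ne_zero.2 hne)
  -- As m is not in J and J is an interval, the points of J close to m all lie on the side of H x₀,
  -- where s is known to stay in K.
  have hside : ∀ c ∈ J, |c - m| < |m - H x₀| → c ∈ uIcc (H x₀) m := by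
    intro c hc hlt
    have hJc := h.ordConnected.out h.mem hc
    have hJc' := h.ordConnected.out hc h.mem
    rw [abs_lt] at hlt
    rcases lt_or_gt_of_ne hne with hlt' | hlt'
    · rw [abs_of_neg (by linarith)] at hlt
      rw [uIcc_of_ge hlt'.le]
      refine ⟨?_, by linarith [hlt.2]⟩
      by_contra hcm
      exact hmJ (hJc' ⟨(not_le.1 hcm).le, hlt'.le⟩)
    · rw [abs_of_pos (by linarith)] at hlt
      rw [uIcc_of_le hlt'.le]
      refine ⟨by linarith [hlt.1], ?_⟩
      by_contra hcm
      exact hmJ (hJc ⟨hlt'.le, (not_le.1 hcm).le⟩)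
  have hsub : uIcc (H x₀) m ⊆ uIcc (H x₀) b := uIcc_subset_uIcc_left hmb
  -- A section of uniform length started within ε of m crosses the level m. Its point there is a
  -- limit of points of s, so it lies in K and is periodic; gluing extends s past m, against
  -- maximality.
  obtain ⟨c', hc'J, hc'd⟩ := Metric.mem_closure_iff.1 hmc (min ε |m - H x₀|) (lt_min hε hpos)
  rw [dist_comm, Real.dist_eq, lt_min_iff] at hc'd
  obtain ⟨σ, hσ0, hσ⟩ := huni (s c') (hsK c' ⟨hc'J, hsub (hside c' hc'J hc'd.2)⟩)
  rw [h.isSection.apply_eq c' hc'J] at hσ0 hσ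
  have hmI : m ∈ Ioo (c' - ε) (c' + ε) := by
    have := abs_lt.1 hc'd.1
    exact ⟨by linarith [this.2], by linarith [this.1]⟩
  have hEq : EqOn s σ (J ∩ Ioo (c' - ε) (c' + ε)) :=
    (h.isSection.mono inter_subset_left).eqOn (hσ.mono inter_subset_right)
      (h.isOpen.inter isOpen_Ioo) (h.ordConnected.inter ordConnected_Ioo).isPreconnected
      ⟨hc'J, by linarith, by linarith⟩ hσ0.symm
  have hσm : σ m ∈ K := by
    have hcont : ContinuousAt σ m := (hσ.isMIntegralCurveAt isOpen_Ioo hmI).continuousAt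
    have hO : IsOpen (Ioo (c' - ε) (c' + ε) ∩ Metric.ball m |m - H x₀|) :=
      isOpen_Ioo.inter Metric.isOpen_ball
    have hcl : m ∈ closure (J ∩ (Ioo (c' - ε) (c' + ε) ∩ Metric.ball m |m - H x₀|)) :=
      hO.closure_inter ⟨hmc, hmI, Metric.mem_ball_self hpos⟩
    have hmem := hcont.continuousWithinAt.mem_closure_image hcl
    refine hK.isClosed.closure_subset_iff.2 ?_ hmem
    rintro _ ⟨c, ⟨hcJ, hcI, hcb⟩, rfl⟩
    rw [← hEq ⟨hcJ, hcI⟩]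
    rw [Metric.mem_ball, Real.dist_eq] at hcb
    exact hsK c ⟨hcJ, hsub (hside c hcJ hcb)⟩
  have hev : ∀ᶠ c in 𝓝 m, σ c ∈ Φ.periodicSet ∧ c ∈ Ioo (c' - ε) (c' + ε) :=
    ((hσ.isMIntegralCurveAt isOpen_Ioo hmI).continuousAt.eventually
      ((Φ.isOpen_periodicSet Y hH).mem_nhds (hKP hσm))).and (isOpen_Ioo.mem_nhds hmI)
  obtain ⟨δ, hδ, hball⟩ := Metric.eventually_nhds_iff_ball.1 hev
  obtain ⟨c₁, hc₁J, hc₁d⟩ := Metric.mem_closure_iff.1 hmc δ hδ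
  rw [dist_comm] at hc₁d
  obtain ⟨s', hs'⟩ := h.union Metric.isOpen_ball (J' := Metric.ball m δ)
    (by rw [Real.ball_eq_Ioo]; exact ordConnected_Ioo) (hσ.mono fun c hc ↦ (hball c hc).2)
    (fun c hc ↦ (hball c hc).1) ⟨hc₁J, hc₁d⟩ (hEq ⟨hc₁J, (hball c₁ hc₁d).2⟩)
  exact hmJ (hmax _ _ hs' (Or.inr (Metric.mem_ball_self hδ)))

/-- Every periodic point lies on a largest orbit cylinder, traced out by a section. -/
theorem exists_orbitCylinder {x₀ : N} (hx₀ : x₀ ∈ Φ.periodicSet) :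
    ∃ (Γ : OrbitCylinder Ω H) (s : ℝ → N), Φ.IsPeriodicSection Y x₀ s Γ.interval ∧
      (∀ c ∈ Γ.interval, Γ.circle c = Φ.orbit (s c)) ∧
      ∀ Γ' : OrbitCylinder Ω H, H x₀ ∈ Γ'.interval → Γ'.circle (H x₀) = Φ.orbit x₀ → Γ' ≤ Γ := by
  classical
  obtain ⟨s, J, h, hmax⟩ := Φ.exists_isPeriodicSection_maximal Y hH hx₀
  let Γ : OrbitCylinder Ω H :=
    { interval := J
      circle := fun c ↦ if c ∈ J then Φ.orbit (s c) else ∅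
      ordConnected := h.ordConnected
      nontrivial := by
        obtain ⟨ε, hε, hball⟩ := Metric.isOpen_iff.1 h.isOpen _ h.mem
        refine ⟨H x₀, h.mem, H x₀ + ε / 2, hball ?_, by linarith⟩
        rw [Metric.mem_ball, Real.dist_eq, add_sub_cancel_left, abs_of_pos] <;> linarith
      isEmbeddedCircle := fun c hc ↦ (Φ.isEmbeddedCircle_iff Y hH).2
        ⟨s c, h.mem_periodicSet c hc, h.isSection.apply_eq c hc, (if_pos hc).symm⟩
      isotopy := Φ.isSmoothIsotopyOfCircles_orbit hH h.isSection h.isOpen h.mem_periodicSet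
        fun c hc ↦ (if_pos hc).symm
      circle_eq_empty := fun c hc ↦ if_neg hc }
  have hcirc : ∀ c ∈ Γ.interval, Γ.circle c = Φ.orbit (s c) := fun c hc ↦ if_pos hc
  refine ⟨Γ, s, h, hcirc, fun Γ' hmem heq ↦ ?_⟩
  obtain ⟨F, hF, hF'⟩ := Γ'.isotopy
  have hFmem : ∀ c ∈ Γ'.interval, ∀ z, F (c, z) ∈ Γ'.circle c := fun c hc z ↦
    (hF' c hc).2.2 ▸ mem_range_self z
  have hcircle' : ∀ c ∈ Γ'.interval, ∀ x ∈ Γ'.circle c,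
      x ∈ Φ.periodicSet ∧ H x = c ∧ Φ.orbit x = Γ'.circle c := by
    intro c hc x hx
    obtain ⟨y, hy, rfl, hyc⟩ := (Φ.isEmbeddedCircle_iff Y hH).1 (Γ'.isEmbeddedCircle c hc)
    rw [← hyc] at hx ⊢
    refine ⟨?_, ?_, Φ.orbit_eq_of_mem hx⟩
    · obtain ⟨t, rfl⟩ := hx
      exact (Φ.flow_mem_periodicSet_iff t y).2 hy
    · obtain ⟨t, rfl⟩ := hx
      exact Φ.apply_hamiltonian hH t y
  have hFc : ContinuousOn F (Γ'.interval ×ˢ univ) := hF.continuousOn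
  have hgc : ContinuousOn (fun c ↦ F (c, 1)) Γ'.interval :=
    hFc.comp (Continuous.prodMk_left (1 : Circle)).continuousOn fun c hc ↦ ⟨hc, trivial⟩
  -- One continuous curve transversal to the circles of Γ' is enough to compare it with the section:
  -- a common orbit at one level propagates over the common interval.
  have hagree : ∀ c ∈ J ∩ Γ'.interval, Γ'.circle c = Φ.orbit (s c) := by
    rintro c ⟨hcJ, hcI⟩
    have hpre := (h.ordConnected.inter Γ'.ordConnected).isPreconnected
    have hsc : ContinuousOn s (J ∩ Γ'.interval) :=
      (h.isSection.contMDiffOn h.isOpen).continuousOn.mono inter_subset_left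
    have hmo := Φ.mem_orbit_of_isPreconnected Y hH hpre hsc (hgc.mono inter_subset_right)
      (fun c hc ↦ h.mem_periodicSet c hc.1) (fun c hc ↦ h.isSection.apply_eq c hc.1)
      (fun c hc ↦ (hcircle' c hc.2 _ (hFmem c hc.2 1)).2.1) (c₀ := H x₀) ⟨h.mem, hmem⟩
      (by
        rw [h.apply_eq, ← heq]
        exact hFmem _ hmem 1) ⟨hcJ, hcI⟩
    rw [← Φ.orbit_eq_of_mem hmo]
    exact ((hcircle' c hcI _ (hFmem c hcI 1)).2.2).symm
  -- Over a compact interval of levels the isotopy of Γ' sweeps out a compact set of periodic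
  -- points. Up to a time shift along orbits, s runs inside it, so it cannot stop before the end of
  -- that interval.
  have hsub : Γ'.interval ⊆ J := by
    intro b hb
    have hI : uIcc (H x₀) b ⊆ Γ'.interval := Γ'.ordConnected.uIcc_subset hmem hb
    refine IsPeriodicSection.mem_of_isCompact Φ Y hH h hmax (b := b)
      (K := F '' (uIcc (H x₀) b ×ˢ univ)) ?_ ?_ ?_
    · exact (isCompact_uIcc.prod isCompact_univ).image_of_continuousOn
        (hFc.mono (prod_mono hI Subset.rfl))
    · rintro _ ⟨⟨c, z⟩, ⟨hc, -⟩, rfl⟩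
      exact (hcircle' c (hI hc) _ (hFmem c (hI hc) z)).1
    · rintro c ⟨hcJ, hc⟩
      have h1 : s c ∈ Γ'.circle c := by
        rw [hagree c ⟨hcJ, hI hc⟩]
        exact Φ.mem_orbit_self _
      rw [← (hF' c (hI hc)).2.2] at h1
      obtain ⟨z, hz⟩ := h1
      exact ⟨(c, z), ⟨hc, trivial⟩, hz⟩
  refine ⟨hsub, fun c hc ↦ ?_⟩
  rw [hagree c ⟨hsub hc, hc⟩, hcirc c (hsub hc)]

end SmoothFlow

end MaximalSections

/-! ### Maximal cylinders and the resonant alternative. -/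

section MaximalCylinders

variable {N : Type*} [TopologicalSpace N] [ChartedSpace (EuclideanSpace ℝ (Fin 2)) N]
  [IsManifold (𝓡 2) ∞ N] {Ω : SymplecticForm N} {H : N → ℝ}

/-- `s` traces out the orbit cylinder `Γ`. -/
structure SmoothFlow.IsTrace (Φ : SmoothFlow (Ω.hamiltonianVectorField H))
    (Y : TransversalField H) (Γ : OrbitCylinder Ω H) (s : ℝ → N) : Prop where
  isOpen : IsOpen Γ.interval
  isSection : Y.IsSection s Γ.interval
  mem_periodicSet : ∀ c ∈ Γ.interval, s c ∈ Φ.periodicSet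
  circle_eq : ∀ c ∈ Γ.interval, Γ.circle c = Φ.orbit (s c)

/-- A family of periodic orbits of constant period, invariant and closed among regular points. -/
structure SmoothFlow.IsResonantFamily (Φ : SmoothFlow (Ω.hamiltonianVectorField H))
    (Y : TransversalField H) (U : Set N) (s : ℝ → N) (a b τ : ℝ) : Prop where
  lt : a < b
  pos : 0 < τ
  isSection : Y.IsSection s (Ioo a b)
  mem_periodicSet : ∀ c ∈ Ioo a b, s c ∈ Φ.periodicSet
  minPeriod_eq : ∀ c ∈ Ioo a b, Φ.minPeriod (s c) = τ
  mem_iff : ∀ x, x ∈ U ↔ H x ∈ Ioo a b ∧ x ∈ Φ.orbit (s (H x))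
  isOpen : IsOpen U
  closure_inter : ∀ x ∈ closure U, x ∈ regularSet H → x ∈ U

namespace SmoothFlow

variable (Φ : SmoothFlow (Ω.hamiltonianVectorField H)) (Y : TransversalField H)
  (hH : ContMDiff (𝓡 2) 𝓘(ℝ, ℝ) ∞ H)

variable {Φ Y}

theorem IsTrace.mem_support_iff {Γ : OrbitCylinder Ω H} {s : ℝ → N} (h : Φ.IsTrace Y Γ s)
    (hH : ContMDiff (𝓡 2) 𝓘(ℝ, ℝ) ∞ H) (x : N) :
    x ∈ Γ.support ↔ H x ∈ Γ.interval ∧ x ∈ Φ.orbit (s (H x)) := by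
  simp only [OrbitCylinder.support, mem_iUnion, exists_prop]
  constructor
  · rintro ⟨c, hc, hx⟩
    rw [h.circle_eq c hc] at hx
    have : H x = c := by
      obtain ⟨t, rfl⟩ := hx
      simp only
      rw [Φ.apply_hamiltonian hH, h.isSection.apply_eq c hc]
    subst this
    exact ⟨hc, hx⟩
  · rintro ⟨hc, hx⟩
    exact ⟨H x, hc, by rwa [h.circle_eq _ hc]⟩

/-- The support is invariant under the flow, so it is enough to look near a point of the section,
where the flow box fills a neighbourhood. -/
theorem IsTrace.isOpen_support {Γ : OrbitCylinder Ω H} {s : ℝ → N} (h : Φ.IsTrace Y Γ s)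
    (hH : ContMDiff (𝓡 2) 𝓘(ℝ, ℝ) ∞ H) : IsOpen Γ.support := by
  have hinv : ∀ t x, Φ.toFun t x ∈ Γ.support ↔ x ∈ Γ.support := by
    intro t x
    rw [h.mem_support_iff hH, h.mem_support_iff hH, Φ.apply_hamiltonian hH]
    refine and_congr_right fun _ ↦ ?_
    constructor
    · intro hx
      rw [← Φ.orbit_eq_of_mem hx]
      exact ⟨-t, Φ.neg_cancel t x⟩
    · intro hx
      rw [← Φ.orbit_eq_of_mem hx]
      exact Φ.mem_orbit t x
  rw [isOpen_iff_eventually]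
  intro x hx
  obtain ⟨hc, t, ht⟩ := (h.mem_support_iff hH x).1 hx
  simp only at ht
  obtain ⟨θ, -, -, h1, -⟩ := Φ.exists_time hH h.isSection h.isOpen hc
  have h2 : Filter.Tendsto (Φ.toFun (-t)) (𝓝 x) (𝓝 (s (H x))) := by
    have := (Φ.continuous_time (-t)).tendsto x
    rwa [← ht, Φ.neg_cancel, ht] at this
  filter_upwards [h2.eventually h1] with y hy
  rw [← hinv (-t), h.mem_support_iff hH]
  exact ⟨hy.1, ⟨_, hy.2⟩⟩

variable (Φ Y) [T2Space N]

include Φ Y hH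

/-- Every periodic point lies on a maximal orbit cylinder. -/
theorem exists_isMax {x : N} (hx : x ∈ Φ.periodicSet) :
    ∃ (Γ : OrbitCylinder Ω H) (s : ℝ → N), IsMax Γ ∧ x ∈ Γ.support ∧ Φ.IsTrace Y Γ s ∧
      ∀ Γ' : OrbitCylinder Ω H, H x ∈ Γ'.interval → Γ'.circle (H x) = Φ.orbit x → Γ' ≤ Γ := by
  obtain ⟨Γ, s, hs, hcirc, hle⟩ := Φ.exists_orbitCylinder Y hH hx
  have htr : Φ.IsTrace Y Γ s := ⟨hs.isOpen, hs.isSection, hs.mem_periodicSet, hcirc⟩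
  have hcx : Γ.circle (H x) = Φ.orbit x := by rw [hcirc _ hs.mem, hs.apply_eq]
  refine ⟨Γ, s, fun Γ' hΓ' ↦ hle Γ' (hΓ'.1 hs.mem) ?_, ?_, htr, hle⟩
  · rw [← hΓ'.2 hs.mem, hcx]
  · rw [htr.mem_support_iff hH, hs.apply_eq]
    exact ⟨hs.mem, Φ.mem_orbit_self x⟩

theorem exists_mem_periodicSet_circle (Γ : OrbitCylinder Ω H) {c : ℝ} (hc : c ∈ Γ.interval) :
    ∃ x ∈ Φ.periodicSet, H x = c ∧ Γ.circle c = Φ.orbit x := by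
  obtain ⟨x, hx, hxc, horb⟩ := (Φ.isEmbeddedCircle_iff Y hH).1 (Γ.isEmbeddedCircle c hc)
  exact ⟨x, hx, hxc, horb.symm⟩

/-- Both cylinders contain the orbit of x, so both lie below the largest cylinder through x; being
maximal, both equal it. -/
theorem eq_of_mem_support {Γ Γ' : OrbitCylinder Ω H} (hΓ : IsMax Γ) (hΓ' : IsMax Γ') {x : N}
    (hx : x ∈ Γ.support) (hx' : x ∈ Γ'.support) : Γ = Γ' := by
  have key : ∀ Γ : OrbitCylinder Ω H, x ∈ Γ.support →
      x ∈ Φ.periodicSet ∧ H x ∈ Γ.interval ∧ Γ.circle (H x) = Φ.orbit x := by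
    intro Γ hx
    simp only [OrbitCylinder.support, mem_iUnion, exists_prop] at hx
    obtain ⟨c, hc, hx⟩ := hx
    obtain ⟨y, hy, rfl, hyo⟩ := Φ.exists_mem_periodicSet_circle Y hH Γ hc
    rw [hyo] at hx
    have horb := Φ.orbit_eq_of_mem hx
    obtain ⟨t, rfl⟩ := hx
    simp only [Φ.apply_hamiltonian hH] at *
    exact ⟨(Φ.flow_mem_periodicSet_iff t y).2 hy, hc, by rw [hyo, ← horb]⟩
  obtain ⟨hP, hI, hC⟩ := key Γ hx
  obtain ⟨-, hI', hC'⟩ := key Γ' hx'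
  obtain ⟨Γ₀, -, -, -, -, hle⟩ := Φ.exists_isMax Y hH hP
  have h1 := hle Γ hI hC
  have h2 := hle Γ' hI' hC'
  exact (h1.antisymm (hΓ h1)).trans (h2.antisymm (hΓ' h2)).symm

theorem exists_isTrace {Γ : OrbitCylinder Ω H} (hΓ : IsMax Γ) : ∃ s, Φ.IsTrace Y Γ s := by
  obtain ⟨c, hc⟩ := Γ.nontrivial.nonempty
  obtain ⟨x, hx, rfl, hcx⟩ := Φ.exists_mem_periodicSet_circle Y hH Γ hc
  obtain ⟨Γ', s, hΓ', -, htr, hle⟩ := Φ.exists_isMax Y hH hx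
  have h1 := hle Γ hc hcx
  have : Γ = Γ' := h1.antisymm (hΓ h1)
  subst this
  exact ⟨s, htr⟩

/-- Resonance makes the period locally constant, hence constant on the interval; finite area then
bounds the interval; and a constant period passes to limits, which closes the support among regular
points. -/
theorem exists_isResonantFamily [SecondCountableTopology N] (hΩ : Ω.area < ⊤)
    {Γ : OrbitCylinder Ω H} (hΓ : IsMax Γ) (hres : Γ.IsResonant) :
    ∃ s a b τ, Φ.IsResonantFamily Y Γ.support s a b τ := by
  obtain ⟨s, htr⟩ := Φ.exists_isTrace Y hH hΓ
  have hper : ∀ c ∈ Γ.interval, Γ.period c = Φ.minPeriod (s c) := fun c hc ↦ by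
    rw [OrbitCylinder.period, htr.circle_eq c hc, Φ.orbitPeriod_orbit]
  have hconst : ∃ τ, ∀ c ∈ Γ.interval, Φ.minPeriod (s c) = τ := by
    have hd : ∀ c ∈ Γ.interval, HasDerivAt (fun c ↦ Φ.minPeriod (s c)) 0 c := by
      intro c hc
      have h1 : ContMDiffAt 𝓘(ℝ, ℝ) 𝓘(ℝ, ℝ) ∞ (fun c ↦ Φ.minPeriod (s c)) c :=
        (Φ.eventually_mem_periodicSet Y hH (htr.mem_periodicSet c hc)).1.comp c
          ((htr.isSection.contMDiffOn htr.isOpen c hc).contMDiffAt (htr.isOpen.mem_nhds hc))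
      have h2 := (h1.contDiffAt.differentiableAt (by simp)).hasDerivAt
      have h3 : deriv (fun c ↦ Φ.minPeriod (s c)) c = 0 := by
        have h4 := hres c hc
        rw [OrbitCylinder.IsNonresonantAt, not_not, derivWithin_of_isOpen htr.isOpen hc] at h4
        rw [← h4]
        refine Filter.EventuallyEq.deriv_eq ?_
        filter_upwards [htr.isOpen.mem_nhds hc] with c' hc'
        exact (hper c' hc').symm
      rwa [h3] at h2
    obtain ⟨c₀, hc₀⟩ := Γ.nontrivial.nonempty
    refine ⟨Φ.minPeriod (s c₀), fun c hc ↦ ?_⟩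
    refine Γ.ordConnected.convex.is_const_of_fderivWithin_eq_zero (𝕜 := ℝ)
      (f := fun c ↦ Φ.minPeriod (s c))
      (fun c hc ↦ (hd c hc).differentiableAt.differentiableWithinAt) (fun c hc ↦ ?_) hc hc₀
    rw [fderivWithin_of_isOpen htr.isOpen hc]
    have := (hd c hc).hasFDerivAt.fderiv
    simpa using! this
  obtain ⟨τ, hτ⟩ := hconst
  obtain ⟨c₀, hc₀⟩ := Γ.nontrivial.nonempty
  have hτ0 : 0 < τ := hτ c₀ hc₀ ▸ Φ.minPeriod_pos Y hH (htr.mem_periodicSet c₀ hc₀)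
  -- The interval times (0, τ) embeds symplectically, so τ times the length of the interval is at
  -- most the area.
  have hvol : volume Γ.interval < ⊤ := by
    have h1 := Φ.volume_le_area hH htr.isSection htr.isOpen (W := Γ.interval ×ˢ Ioo 0 τ)
      (htr.isOpen.prod isOpen_Ioo) (fun p hp ↦ hp.1) (by
        intro c t t' hp hp' heq
        have hP := htr.mem_periodicSet c hp.1
        have h2 : ∀ u u', u ∈ Ioo 0 τ → u' ∈ Ioo 0 τ → u < u' →
            Φ.toFun u (s c) = Φ.toFun u' (s c) → False := by
          intro u u' hu hu' hlt h
          have := Φ.minPeriod_le Y hH hP (sub_pos.2 hlt) (Φ.apply_sub_eq h.symm)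
          rw [hτ c hp.1] at this
          linarith [hu.1, hu'.2]
        rcases lt_trichotomy t t' with hlt | h | hlt
        · exact (h2 _ _ hp.2 hp'.2 hlt heq).elim
        · exact h
        · exact (h2 _ _ hp'.2 hp.2 hlt heq.symm).elim)
    rw [Measure.volume_eq_prod, Measure.prod_prod, Real.volume_Ioo] at h1
    have h3 := h1.trans_lt hΩ
    by_contra htop
    rw [not_lt, top_le_iff] at htop
    rw [htop, ENNReal.top_mul (by rw [Ne, ENNReal.ofReal_eq_zero]; linarith)] at h3
    exact h3.false
  have hbA : BddAbove Γ.interval := by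
    by_contra hb
    rw [not_bddAbove_iff] at hb
    have : Ici c₀ ⊆ Γ.interval := fun y hy ↦ by
      obtain ⟨z, hz, hyz⟩ := hb y
      exact Γ.ordConnected.out hc₀ hz ⟨hy, hyz.le⟩
    have := measure_mono (μ := volume) this
    rw [Real.volume_Ici, top_le_iff] at this
    exact hvol.ne this
  have hbB : BddBelow Γ.interval := by
    by_contra hb
    rw [not_bddBelow_iff] at hb
    have : Iic c₀ ⊆ Γ.interval := fun y hy ↦ by
      obtain ⟨z, hz, hyz⟩ := hb y
      exact Γ.ordConnected.out hz hc₀ ⟨hyz.le, hy⟩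
    have := measure_mono (μ := volume) this
    rw [Real.volume_Iic, top_le_iff] at this
    exact hvol.ne this
  have hIoo : Γ.interval = Ioo (sInf Γ.interval) (sSup Γ.interval) := by
    ext c
    constructor
    · intro hc
      obtain ⟨ε, hε, hball⟩ := Metric.isOpen_iff.1 htr.isOpen c hc
      rw [Real.ball_eq_Ioo] at hball
      have h1 : c + ε / 2 ≤ sSup Γ.interval :=
        le_csSup hbA (hball ⟨by linarith, by linarith⟩)
      have h2 : sInf Γ.interval ≤ c - ε / 2 :=
        csInf_le hbB (hball ⟨by linarith, by linarith⟩)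
      exact ⟨by linarith, by linarith⟩
    · rintro ⟨h1, h2⟩
      obtain ⟨x, hx, hxc⟩ := exists_lt_of_csInf_lt ⟨c₀, hc₀⟩ h1
      obtain ⟨y, hy, hcy⟩ := exists_lt_of_lt_csSup ⟨c₀, hc₀⟩ h2
      exact Γ.ordConnected.out hx hy ⟨hxc.le, hcy.le⟩
  have hab := hIoo ▸ hc₀
  refine ⟨s, sInf Γ.interval, sSup Γ.interval, τ, hab.1.trans hab.2, hτ0, ?_, ?_, ?_, ?_,
    htr.isOpen_support hH, ?_⟩
  · rw [← hIoo]
    exact htr.isSection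
  · rw [← hIoo]
    exact htr.mem_periodicSet
  · rw [← hIoo]
    exact hτ
  · rw [← hIoo]
    exact htr.mem_support_iff hH
  -- A regular limit point is fixed by the time τ map, so it lies on a maximal cylinder. The open
  -- support of that cylinder meets the given one, and so the two are equal.
  · intro x hx hreg
    have hfix : ∀ y ∈ Γ.support, Φ.toFun τ y = y := by
      intro y hy
      obtain ⟨hc, t, ht⟩ := (htr.mem_support_iff hH y).1 hy
      simp only at ht
      rw [← ht, Φ.apply_flow_eq_iff, ← hτ _ hc]
      exact Φ.apply_minPeriod Y hH (htr.mem_periodicSet _ hc)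
    have hfixx : Φ.toFun τ x = x :=
      closure_minimal hfix (isClosed_eq (Φ.continuous_time τ) continuous_id) hx
    obtain ⟨Γ', s', hΓ', hxΓ', htr', -⟩ := Φ.exists_isMax Y hH (x := x) ⟨hreg, τ, hτ0, hfixx⟩
    obtain ⟨y, hy', hy⟩ := mem_closure_iff.1 hx Γ'.support (htr'.isOpen_support hH) hxΓ'
    rw [Φ.eq_of_mem_support Y hH hΓ hΓ' hy hy']
    exact hxΓ'

end SmoothFlow

end MaximalCylinders

/-! ### Periodic functions with a single Fourier coefficient. -/

/-- With only the zeroth coefficient left, the Fourier series is summable and therefore converges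
pointwise to the function. -/
theorem Function.Periodic.eq_of_fourier_eq_zero {m : ℝ → ℝ} (hm : Continuous m)
    (hper : Periodic m 1)
    (h : ∀ k : ℤ, k ≠ 0 → ∫ t in (0 : ℝ)..1,
      Complex.exp (-(2 * Real.pi * k * t) * Complex.I) * (m t : ℂ) = 0) (t : ℝ) : m t = m 0 := by
  have : Fact ((0 : ℝ) < 1) := ⟨one_pos⟩
  have hper' : Periodic (fun t ↦ (m t : ℂ)) 1 := fun t ↦ by simp only [hper t]
  let f : C(AddCircle (1 : ℝ), ℂ) := ⟨hper'.lift,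
    (Complex.continuous_ofReal.comp hm).quotient_liftOn' _⟩
  have hf : ∀ t : ℝ, f (t : AddCircle (1 : ℝ)) = m t := fun t ↦ hper'.lift_coe t
  have hcoef : ∀ k : ℤ, k ≠ 0 → fourierCoeff f k = 0 := by
    intro k hk
    rw [fourierCoeff_eq_intervalIntegral _ _ 0, ← h k hk]
    simp only [div_one, one_smul, zero_add]
    refine intervalIntegral.integral_congr fun t _ ↦ ?_
    simp only [hf, smul_eq_mul]
    rw [fourier_coe_apply]
    congr 2
    push_cast
    ring
  have hsum : Summable (fourierCoeff f) :=
    summable_of_ne_finset_zero (s := {0}) fun k hk ↦ hcoef k (by simpa using hk)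
  have key : ∀ t : ℝ, (m t : ℂ) = fourierCoeff f 0 := by
    intro t
    have h1 := has_pointwise_sum_fourier_series_of_summable hsum (t : AddCircle (1 : ℝ))
    have h2 := hasSum_single (f := fun i ↦ fourierCoeff f i • fourier i (t : AddCircle (1 : ℝ))) 0
      fun k hk ↦ by rw [hcoef k hk, zero_smul]
    rw [← hf, h1.unique h2]
    simp
  exact_mod_cast (key t).trans (key 0).symm

/-! ### Differentials at boundary points and along slices. -/

section SliceDerivatives

variable {E : Type*} [NormedAddCommGroup E] [NormedSpace ℝ E] {H : Type*} [TopologicalSpace H]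
  {I : ModelWithCorners ℝ E H} {M : Type*} [TopologicalSpace M]
  [ChartedSpace H M] [IsManifold I ∞ M] {F : Type*} [NormedAddCommGroup F] [NormedSpace ℝ F]

theorem ContMDiff.contDiffOn_extChartAt_symm {h : M → F} (hh : ContMDiff I 𝓘(ℝ, F) ∞ h) (x : M) :
    ContDiffOn ℝ ∞ (fun y ↦ h ((extChartAt I x).symm y)) (extChartAt I x).target :=
  (hh.comp_contMDiffOn (contMDiffOn_extChartAt_symm x)).contDiffOn

variable [I.Boundaryless]

omit [IsManifold I ∞ M] in
theorem mvfderiv_eq_fderiv_chart {h : M → F} {x : M} (hh : MDifferentiableAt I 𝓘(ℝ, F) h x)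
    (v : TangentSpace I x) : mvfderiv I h x v =
      fderiv ℝ (fun y ↦ h ((extChartAt I x).symm y)) (extChartAt I x x) (show E from v) := by
  have h1 : mfderiv I 𝓘(ℝ, F) h x =
      fderiv ℝ (fun y ↦ h ((extChartAt I x).symm y)) (extChartAt I x x) := by
    rw [hh.mfderiv, I.range_eq_univ, fderivWithin_univ]
    rfl
  exact DFunLike.congr_fun h1 v

/-- In a chart the differentials are continuous, so equality on an open set extends to its closure.
This transfers periodicity and equivariance on U to differentials at a boundary point. -/
theorem mvfderiv_eq_of_eqOn {f g : M → F} (hf : ContMDiff I 𝓘(ℝ, F) ∞ f)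
    (hg : ContMDiff I 𝓘(ℝ, F) ∞ g) {U : Set M} (hU : IsOpen U) (h : EqOn f g U) {w : M}
    (hw : w ∈ closure U) : mvfderiv I f w = mvfderiv I g w := by
  let χ := extChartAt I w
  have ht : IsOpen χ.target := isOpen_extChartAt_target w
  have hmem : χ w ∈ χ.target := mem_extChartAt_target w
  have hcont : ∀ {f : M → F}, ContMDiff I 𝓘(ℝ, F) ∞ f →
      ContinuousAt (fderiv ℝ (fun y ↦ f (χ.symm y))) (χ w) := fun hf ↦
    ((hf.contDiffOn_extChartAt_symm w).continuousOn_fderiv_of_isOpen ht (by simp)).continuousAt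
      (ht.mem_nhds hmem)
  have hw' : w ∈ closure (U ∩ χ.source) :=
    (isOpen_extChartAt_source w).closure_inter ⟨hw, mem_extChartAt_source w⟩
  have h1 : χ w ∈ closure (χ '' (U ∩ χ.source)) :=
    (continuousAt_extChartAt w).continuousWithinAt.mem_closure_image hw'
  have h2 : ∀ y ∈ χ '' (U ∩ χ.source), fderiv ℝ (fun y ↦ f (χ.symm y)) y =
      fderiv ℝ (fun y ↦ g (χ.symm y)) y := by
    rintro _ ⟨p, ⟨hpU, hps⟩, rfl⟩
    refine Filter.EventuallyEq.fderiv_eq ?_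
    have h3 : ContinuousAt χ.symm (χ p) := continuousAt_extChartAt_symm'' (χ.map_source hps)
    have h4 : ∀ᶠ y in 𝓝 (χ p), χ.symm y ∈ U := by
      refine h3.eventually (hU.mem_nhds ?_)
      rwa [χ.left_inv hps]
    filter_upwards [h4] with y hy
    exact h hy
  have h5 : fderiv ℝ (fun y ↦ f (χ.symm y)) (χ w) = fderiv ℝ (fun y ↦ g (χ.symm y)) (χ w) := by
    have hsub := ((hcont hf).sub (hcont hg)).continuousWithinAt.mem_closure_image h1
    have hz : (fun y ↦ fderiv ℝ (fun y ↦ f (χ.symm y)) y - fderiv ℝ (fun y ↦ g (χ.symm y)) y) ''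
        (χ '' (U ∩ χ.source)) ⊆ {0} := by
      rintro _ ⟨y, hy, rfl⟩
      exact sub_eq_zero.2 (h2 y hy)
    have := closure_minimal hz isClosed_singleton hsub
    exact sub_eq_zero.1 this
  ext v
  rw [mvfderiv_eq_fderiv_chart (hf.mdifferentiable (by simp) w),
    mvfderiv_eq_fderiv_chart (hg.mdifferentiable (by simp) w)]
  exact DFunLike.congr_fun h5 _

theorem ContMDiff.continuous_mvfderiv_slice {f : ℝ × M → F}
    (hf : ContMDiff (𝓘(ℝ, ℝ).prod I) 𝓘(ℝ, F) ∞ f) (x : M) (v : TangentSpace I x) :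
    Continuous (fun t ↦ mvfderiv I (fun y ↦ f (t, y)) x v) := by
  let χ := extChartAt I x
  have ht : IsOpen (univ ×ˢ χ.target : Set (ℝ × E)) := isOpen_univ.prod (isOpen_extChartAt_target x)
  have hslice : ∀ t, ContMDiff I 𝓘(ℝ, F) ∞ (fun y ↦ f (t, y)) := fun t ↦
    hf.comp (contMDiff_const.prodMk contMDiff_id)
  have hfh : ContDiffOn ℝ ∞ (fun p : ℝ × E ↦ f (p.1, χ.symm p.2)) (univ ×ˢ χ.target) := by
    rw [← contMDiffOn_iff_contDiffOn]
    have h1 : ContMDiffOn 𝓘(ℝ, ℝ × E) I ∞ (fun p : ℝ × E ↦ χ.symm p.2) (univ ×ˢ χ.target) :=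
      (contMDiffOn_extChartAt_symm x).comp contDiff_snd.contMDiff.contMDiffOn fun p hp ↦ hp.2
    have h2 : ContMDiffOn 𝓘(ℝ, ℝ × E) 𝓘(ℝ, ℝ) ∞ (fun p : ℝ × E ↦ p.1) (univ ×ˢ χ.target) :=
      contDiff_fst.contMDiff.contMDiffOn
    exact hf.comp_contMDiffOn (h2.prodMk h1)
  have hc := hfh.continuousOn_fderiv_of_isOpen ht (by simp)
  have heq : (fun t ↦ mvfderiv I (fun y ↦ f (t, y)) x v) = fun t ↦
      fderiv ℝ (fun p : ℝ × E ↦ f (p.1, χ.symm p.2)) (t, χ x) ((0 : ℝ), (show E from v)) := by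
    funext t
    rw [mvfderiv_eq_fderiv_chart ((hslice t).mdifferentiable (by simp) x)]
    have h1 : DifferentiableAt ℝ (fun p : ℝ × E ↦ f (p.1, χ.symm p.2)) (t, χ x) :=
      (hfh.contDiffAt (ht.mem_nhds ⟨trivial, mem_extChartAt_target x⟩)).differentiableAt (by simp)
    have h2 := h1.hasFDerivAt.comp (χ x)
      (f := fun y : E ↦ (t, y)) ((hasFDerivAt_const t (χ x)).prodMk (hasFDerivAt_id (χ x)))
    have h3 := h2.fderiv
    change fderiv ℝ (fun y ↦ f (t, χ.symm y)) (χ x) = _ at h3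
    change fderiv ℝ (fun y ↦ f (t, χ.symm y)) (χ x) _ = _
    rw [h3]
    rfl
  rw [heq]
  have h4 : Continuous fun t ↦ fderiv ℝ (fun p : ℝ × E ↦ f (p.1, χ.symm p.2)) (t, χ x) := by
    refine hc.comp_continuous (Continuous.prodMk_left _) fun t ↦ ⟨trivial, mem_extChartAt_target x⟩
  exact h4.clm_apply continuous_const

omit [I.Boundaryless] [IsManifold I ∞ M] in
theorem mvfderiv_clm_comp {F' : Type*} [NormedAddCommGroup F'] [NormedSpace ℝ F'] (A : F →L[ℝ] F')
    {h : M → F} {x : M} (hh : MDifferentiableAt I 𝓘(ℝ, F) h x) (v : TangentSpace I x) :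
    mvfderiv I (fun y ↦ A (h y)) x v = A (mvfderiv I h x v) := by
  have h1 := (A.hasFDerivAt (x := h x)).hasMFDerivAt.comp x hh.hasMFDerivAt
  exact DFunLike.congr_fun h1.mfderiv v

end SliceDerivatives

/-! ### Linearization of a periodic flow at a boundary fixed point. -/

section Linearization

theorem Function.Periodic.integral_comp_add {F : Type*} [NormedAddCommGroup F] [NormedSpace ℝ F]
    {f : ℝ → F} (hf : Periodic f 1) (u : ℝ) :
    ∫ t in (0 : ℝ)..1, f (t + u) = ∫ t in (0 : ℝ)..1, f t := by
  rw [intervalIntegral.integral_comp_add_right (fun t ↦ f t) u, zero_add, add_comm 1 u,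
    hf.intervalIntegral_add_eq u 0, zero_add]

variable {N : Type*} [TopologicalSpace N] [ChartedSpace (EuclideanSpace ℝ (Fin 2)) N]
  [IsManifold (𝓡 2) ∞ N] [T2Space N] {V : (x : N) → TangentSpace (𝓡 2) x}

/-- A chart multiplied by a bump function; a globally defined map can be averaged along orbits. -/
theorem exists_contMDiff_bijective_mvfderiv (w : N) :
    ∃ q : N → 𝔼, ContMDiff (𝓡 2) 𝓘(ℝ, 𝔼) ∞ q ∧ Bijective (mvfderiv (𝓡 2) q w) := by
  have : IsManifold (𝓡 2) 1 N := IsManifold.of_le (m := 1) (n := ∞) (by simp)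
  obtain ⟨f⟩ : Nonempty (SmoothBumpFunction (𝓡 2) w) := inferInstance
  refine ⟨fun x ↦ f x • extChartAt (𝓡 2) w x, f.contMDiff_smul contMDiffOn_extChartAt, ?_⟩
  have h1 : (fun x ↦ f x • extChartAt (𝓡 2) w x) =ᶠ[𝓝 w] extChartAt (𝓡 2) w := by
    filter_upwards [f.eventuallyEq_one] with x hx
    rw [hx, Pi.one_apply, one_smul]
  have h2 := (isInvertible_mfderiv_extChartAt (I := 𝓡 2) (mem_extChartAt_source w)).bijective
  have h3 : ⇑(mvfderiv (𝓡 2) (fun x ↦ f x • extChartAt (𝓡 2) w x) w) =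
      ⇑(mfderiv (𝓡 2) 𝓘(ℝ, 𝔼) (extChartAt (𝓡 2) w) w) := by
    rw [← h1.mfderiv_eq]
    rfl
  rw [h3]
  exact h2

omit [T2Space N] in
theorem eventually_injOn_of_bijective_mvfderiv {F : Type*} [NormedAddCommGroup F]
    [NormedSpace ℝ F] [CompleteSpace F] {q : N → F} (hq : ContMDiff (𝓡 2) 𝓘(ℝ, F) ∞ q) {w : N}
    (hbij : Bijective (mvfderiv (𝓡 2) q w)) : ∃ O ∈ 𝓝 w, InjOn q O := by
  obtain ⟨g, -, hg, -⟩ := (hq w).exists_local_inverse (by simp) hbij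
  exact ⟨_, hg, fun x hx y hy h ↦ by rw [← hx, h, hy]⟩

/-- A flow of period `τ` on an open set is, around a fixed point in the closure, equivariant to a
rotation of the plane. -/
theorem SmoothFlow.exists_linearization (Φ : SmoothFlow V) {U : Set N} (hU : IsOpen U) {w : N}
    (hw : w ∈ closure U) (hfix : ∀ t, Φ.toFun t w = w) {τ : ℝ} (hτ : 0 < τ)
    (hper : ∀ x ∈ U, Φ.toFun τ x = x) (hmin : ∀ x ∈ U, ∀ t ∈ Ioo 0 τ, Φ.toFun t x ≠ x) :
    ∃ G : N → ℂ, ContMDiff (𝓡 2) 𝓘(ℝ, ℂ) ∞ G ∧ Bijective (mvfderiv (𝓡 2) G w) ∧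
      ∀ x ∈ closure U, ∀ t, G (Φ.toFun t x) =
        Complex.exp ((2 * Real.pi * t / τ : ℝ) * Complex.I) * G x := by
  obtain ⟨q, hq, hqbij⟩ := exists_contMDiff_bijective_mvfderiv w
  have hfr : Module.finrank ℝ (TangentSpace (𝓡 2) w) = 2 :=
    (finrank_euclideanSpace_fin : Module.finrank ℝ 𝔼 = 2)
  have hfin : FiniteDimensional ℝ (TangentSpace (𝓡 2) w) :=
    inferInstanceAs (FiniteDimensional ℝ 𝔼)
  have hper' : ∀ x ∈ closure U, Φ.toFun τ x = x := fun x hx ↦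
    closure_minimal hper (isClosed_eq (Φ.contMDiff_time τ).continuous continuous_id) hx
  have hcontΦ := Φ.continuous_uncurry
  -- points of `U` near `w` stay near `w` for short times
  have hnear : ∀ t₀, ∀ O ∈ 𝓝 w, ∃ᶠ x in 𝓝 w, x ∈ U ∧ x ∈ O ∧ Φ.toFun t₀ x ∈ O := by
    intro t₀ O hO
    have h1 : ∀ᶠ x in 𝓝 w, x ∈ O ∧ Φ.toFun t₀ x ∈ O := by
      have h2 : Filter.Tendsto (Φ.toFun t₀) (𝓝 w) (𝓝 w) := by
        have := ((Φ.contMDiff_time t₀).continuous).tendsto w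
        rwa [hfix] at this
      exact Filter.Eventually.and hO (h2.eventually hO)
    exact (mem_closure_iff_frequently.1 hw).and_eventually h1
  let h : Fin 2 → ℝ × N → ℝ := fun j p ↦ q (Φ.toFun (τ * p.1) p.2) j
  let E : ℤ → ℝ → ℂ := fun k t ↦ Complex.exp (-(2 * Real.pi * k * t) * Complex.I)
  have hEper : ∀ k, Periodic (E k) 1 := by
    intro k t
    simp only [E]
    rw [Complex.exp_eq_exp_iff_exists_int]
    refine ⟨-k, ?_⟩
    push_cast
    ring
  have hEadd : ∀ k t u, E k t = E k (-u) * E k (t + u) := by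
    intro k t u
    simp only [E]
    rw [← Complex.exp_add]
    congr 1
    push_cast
    ring
  have hqΦ : ContMDiff (𝓘(ℝ, ℝ).prod (𝓡 2)) 𝓘(ℝ, 𝔼) ∞
      (fun p : ℝ × N ↦ q (Φ.toFun (τ * p.1) p.2)) := by
    have h1 : ContMDiff (𝓘(ℝ, ℝ).prod (𝓡 2)) 𝓘(ℝ, ℝ) ∞ (fun p : ℝ × N ↦ τ * p.1) :=
      (contDiff_const.mul contDiff_id : ContDiff ℝ ∞ fun t : ℝ ↦ τ * t).contMDiff.comp
        contMDiff_fst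
    exact hq.comp (Φ.contMDiff.comp (h1.prodMk contMDiff_snd))
  have hqΦt : ∀ t, ContMDiff (𝓡 2) 𝓘(ℝ, 𝔼) ∞ (fun x : N ↦ q (Φ.toFun (τ * t) x)) := fun t ↦
    hq.comp (Φ.contMDiff_time (τ * t))
  have hh : ∀ j, ContMDiff (𝓘(ℝ, ℝ).prod (𝓡 2)) 𝓘(ℝ, ℝ) ∞ (h j) := fun j ↦
    (EuclideanSpace.proj j : 𝔼 →L[ℝ] ℝ).contDiff.contMDiff.comp hqΦ
  have hht : ∀ j t, ContMDiff (𝓡 2) 𝓘(ℝ, ℝ) ∞ (fun x ↦ h j (t, x)) := fun j t ↦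
    (EuclideanSpace.proj j : 𝔼 →L[ℝ] ℝ).contDiff.contMDiff.comp (hqΦt t)
  have hshift : ∀ x ∈ closure U, ∀ t, Φ.toFun (τ * (t + 1)) x = Φ.toFun (τ * t) x := by
    intro x hx t
    rw [mul_add, mul_one, Φ.map_add, hper' x hx]
  have hhper : ∀ j, ∀ x ∈ closure U, Periodic (fun t ↦ h j (t, x)) 1 := by
    intro j x hx t
    simp only [h]
    rw [hshift x hx]
  let m : Fin 2 → TangentSpace (𝓡 2) w → ℝ → ℝ := fun j v t ↦
    mvfderiv (𝓡 2) (fun x ↦ h j (t, x)) w v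
  have hmc : ∀ j v, Continuous (m j v) := fun j v ↦ (hh j).continuous_mvfderiv_slice w v
  -- The coordinate functions at times t + 1 and t agree only on the closure of U, but that suffices
  -- to identify their differentials at w.
  have hmper : ∀ j v, Periodic (m j v) 1 := by
    intro j v t
    have := mvfderiv_eq_of_eqOn (hht j (t + 1)) (hht j t) hU
      (fun x hx ↦ hhper j x (subset_closure hx) t) hw
    exact DFunLike.congr_fun this v
  let f : ℤ → Fin 2 → ℝ × N → ℂ := fun k j p ↦ h j p • E k p.1
  have hf : ∀ k j, ContMDiff (𝓘(ℝ, ℝ).prod (𝓡 2)) 𝓘(ℝ, ℂ) ∞ (f k j) := by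
    intro k j
    have hE : ContDiff ℝ ∞ (E k) := by
      have h1 : ContDiff ℝ ∞ (fun t : ℝ ↦ (-(2 * Real.pi * k * t) * Complex.I : ℂ)) := by
        have : ContDiff ℝ ∞ (fun t : ℝ ↦ (t : ℂ)) := Complex.ofRealCLM.contDiff
        exact ((contDiff_const.mul this).neg).mul contDiff_const
      exact Complex.contDiff_exp.comp h1
    exact (hh j).smul (hE.contMDiff.comp contMDiff_fst)
  -- The k-th Fourier coefficient of the j-th coordinate along the orbit. Shifting time multiplies
  -- it by a character, so over the closure of U it is equivariant of weight k.
  let G : ℤ → Fin 2 → N → ℂ := fun k j x ↦ ∫ t in (0 : ℝ)..1, f k j (t, x)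
  have hG : ∀ k j, ContMDiff (𝓡 2) 𝓘(ℝ, ℂ) ∞ (G k j) := fun k j ↦
    (ContMDiff.integral_zero_one (hf k j)).1
  have hdG : ∀ k j v, mvfderiv (𝓡 2) (G k j) w v = ∫ t in (0 : ℝ)..1, E k t * (m j v t : ℂ) := by
    intro k j v
    have h1 := (ContMDiff.integral_zero_one (hf k j)).2 w v
    refine Eq.trans h1 ?_
    refine intervalIntegral.integral_congr fun t _ ↦ ?_
    have h2 := mvfderiv_clm_comp ((1 : ℝ →L[ℝ] ℝ).smulRight (E k t))
      ((hht j t).mdifferentiable (by simp) w) v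
    refine Eq.trans h2 ?_
    change (m j v t) • E k t = _
    rw [Complex.real_smul, mul_comm]
  have hGeq : ∀ k j, ∀ x ∈ closure U, ∀ s, G k j (Φ.toFun s x) =
      Complex.exp ((2 * Real.pi * k * s / τ : ℝ) * Complex.I) * G k j x := by
    intro k j x hx s
    have h1 : ∀ t, f k j (t, Φ.toFun s x) = E k (-(s / τ)) * f k j (t + s / τ, x) := by
      intro t
      simp only [f, h]
      rw [hEadd k t (s / τ), ← Φ.map_add, show τ * (t + s / τ) = τ * t + s by field_simp,
        Complex.real_smul, Complex.real_smul]
      ring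
    have hfper : Periodic (fun t ↦ f k j (t, x)) 1 := fun t ↦ by
      have e1 := hhper j x hx t
      have e2 := hEper k t
      simp only at e1
      simp only [f, e1, e2]
    simp only [G, h1]
    rw [intervalIntegral.integral_const_mul, hfper.integral_comp_add (s / τ)]
    congr 1
    simp only [E]
    congr 1
    push_cast
    ring
  by_cases hcase : ∃ k : ℤ, k ≠ 0 ∧ ∃ j v, mvfderiv (𝓡 2) (G k j) w v ≠ 0
  · obtain ⟨k, hk, j, v, hv⟩ := hcase
    have hk' : (k : ℝ) ≠ 0 := by exact_mod_cast hk
    -- At time τ / (4k) the character of weight k is multiplication by i. Differentiating this at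
    -- the fixed point w shows that the image of dG is closed under multiplication by i, so a
    -- nonzero differential is bijective.
    have hrot : ∃ u, mvfderiv (𝓡 2) (G k j) w u = Complex.I * mvfderiv (𝓡 2) (G k j) w v := by
      let t := τ / (4 * k)
      have h1 : EqOn (fun x ↦ G k j (Φ.toFun t x))
          (fun x ↦ (ContinuousLinearMap.mul ℝ ℂ Complex.I) (G k j x)) U := by
        intro x hx
        simp only
        rw [hGeq k j x (subset_closure hx) t]
        have : (2 * Real.pi * k * t / τ : ℝ) = Real.pi / 2 := by
          simp only [t]
          field_simp
          ring
        rw [this]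
        push_cast
        rw [Complex.exp_pi_div_two_mul_I]
        rfl
      have h2 := mvfderiv_eq_of_eqOn ((hG k j).comp (Φ.contMDiff_time t))
        ((ContinuousLinearMap.mul ℝ ℂ Complex.I).contDiff.contMDiff.comp (hG k j)) hU h1 hw
      have h3 := DFunLike.congr_fun h2 v
      have h4 := mvfderiv_clm_comp (ContinuousLinearMap.mul ℝ ℂ Complex.I)
        ((hG k j).mdifferentiable (by simp) w) v
      have h5 := ((((hG k j).mdifferentiable (by simp)
        (Φ.toFun t w)).hasMFDerivAt).comp w
          (((Φ.contMDiff_time t).mdifferentiable (by simp) w).hasMFDerivAt)).mfderiv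
      have h6 : ∀ y, y = w → ∀ u : TangentSpace (𝓡 2) y, ∃ u',
          mvfderiv (𝓡 2) (G k j) w u' = mvfderiv (𝓡 2) (G k j) y u := by
        rintro y rfl u
        exact ⟨u, rfl⟩
      obtain ⟨u, hu⟩ := h6 _ (hfix t) (mfderiv (𝓡 2) (𝓡 2) (Φ.toFun t) w v)
      refine ⟨u, hu.trans ((DFunLike.congr_fun h5 v).symm.trans (h3.trans h4))⟩
    have hbij : Bijective (mvfderiv (𝓡 2) (G k j) w) := by
      have hsurj : Surjective (mvfderiv (𝓡 2) (G k j) w).toLinearMap := by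
        intro z
        obtain ⟨u, hu⟩ := hrot
        refine ⟨(z / mvfderiv (𝓡 2) (G k j) w v).re • v +
          (z / mvfderiv (𝓡 2) (G k j) w v).im • u, ?_⟩
        change mvfderiv (𝓡 2) (G k j) w _ = z
        rw [_root_.map_add, map_smul, map_smul, hu, Complex.real_smul, Complex.real_smul]
        conv_rhs => rw [← div_mul_cancel₀ z hv, ← Complex.re_add_im (z / _)]
        ring
      exact ⟨(LinearMap.injective_iff_surjective_of_finrank_eq_finrank
        (by rw [hfr, Complex.finrank_real_complex])).2 hsurj, hsurj⟩
    -- For |k| ≥ 2 the map G, injective near w, would not distinguish x from its image at time τ /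
    -- |k|, contradicting the minimality of τ.
    have hk1 : |k| = 1 := by
      by_contra hne
      have hk2 : (2 : ℝ) ≤ |(k : ℝ)| := by
        have h1 := Int.one_le_abs hk
        have : 2 ≤ |k| := by omega
        exact_mod_cast this
      have hkpos : (0 : ℝ) < |(k : ℝ)| := by linarith
      obtain ⟨O, hO, hinj⟩ := eventually_injOn_of_bijective_mvfderiv (hG k j) hbij
      obtain ⟨x, hxU, hxO, hxO'⟩ := (hnear (τ / |(k : ℝ)|) O hO).exists
      refine hmin x hxU (τ / |(k : ℝ)|) ⟨by positivity, ?_⟩ (hinj hxO' hxO ?_)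
      · rw [div_lt_iff₀ hkpos]
        nlinarith
      · rw [hGeq k j x (subset_closure hxU)]
        have : Complex.exp ((2 * Real.pi * k * (τ / |(k : ℝ)|) / τ : ℝ) * Complex.I) = 1 := by
          rw [Complex.exp_eq_one_iff]
          rcases abs_choice (k : ℝ) with h | h
          · refine ⟨1, ?_⟩
            rw [h]
            have : (2 * Real.pi * k * (τ / k) / τ : ℝ) = 2 * Real.pi := by field_simp
            rw [this]
            push_cast
            ring
          · refine ⟨-1, ?_⟩
            rw [h]
            have : (2 * Real.pi * k * (τ / -k) / τ : ℝ) = -(2 * Real.pi) := by field_simp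
            rw [this]
            push_cast
            ring
        rw [this, one_mul]
    rcases (abs_eq (by norm_num)).1 hk1 with rfl | rfl
    · refine ⟨G 1 j, hG 1 j, hbij, fun x hx t ↦ ?_⟩
      rw [hGeq 1 j x hx t, Int.cast_one, mul_one]
    -- Conjugation turns weight -1 into weight 1.
    · let C : ℂ →L[ℝ] ℂ := Complex.conjCLE
      refine ⟨fun x ↦ C (G (-1) j x), C.contDiff.contMDiff.comp (hG (-1) j), ?_, fun x hx t ↦ ?_⟩
      · have h1 : ⇑(mvfderiv (𝓡 2) (fun x ↦ C (G (-1) j x)) w) =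
            C ∘ mvfderiv (𝓡 2) (G (-1) j) w :=
          funext fun v ↦ mvfderiv_clm_comp C ((hG (-1) j).mdifferentiable (by simp) w) v
        rw [h1]
        exact Complex.conjCLE.bijective.comp hbij
      · change C (G (-1) j (Φ.toFun t x)) = _ * C (G (-1) j x)
        rw [hGeq (-1) j x hx t]
        change (starRingEnd ℂ) _ = _ * (starRingEnd ℂ) _
        rw [map_mul, ← Complex.exp_conj, map_mul, Complex.conj_I, Complex.conj_ofReal]
        congr 2
        push_cast
        ring
  · exfalso
    push Not at hcase
    have hconst : ∀ j v t, m j v t = m j v 0 := fun j v t ↦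
      (hmper j v).eq_of_fourier_eq_zero (hmc j v)
        (fun k hk ↦ (hdG k j v).symm.trans (hcase k hk j v)) t
    -- In the remaining case the differential at w of q ∘ Φ_{τt} does not depend on t, so the
    -- average L over the orbit has the bijective differential of q and is injective near w. But L
    -- is constant on orbits in U, so points x and Φ_{τ/2}(x) near w would coincide.
    let L : N → 𝔼 := fun x ↦ ∫ t in (0 : ℝ)..1, q (Φ.toFun (τ * t) x)
    have hL := ContMDiff.integral_zero_one hqΦ
    have hdL : ∀ v, mvfderiv (𝓡 2) L w v = mvfderiv (𝓡 2) q w v := by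
      intro v
      have h1 : ∀ t, mvfderiv (𝓡 2) (fun x ↦ q (Φ.toFun (τ * t) x)) w v =
          mvfderiv (𝓡 2) q w v := by
        intro t
        ext j
        have e1 := mvfderiv_clm_comp (EuclideanSpace.proj j : 𝔼 →L[ℝ] ℝ)
          ((hqΦt t).mdifferentiable (by simp) w) v
        have e2 := mvfderiv_clm_comp (EuclideanSpace.proj j : 𝔼 →L[ℝ] ℝ)
          ((hqΦt 0).mdifferentiable (by simp) w) v
        have e3 := (e1.symm.trans (hconst j v t)).trans e2
        have e4 : (fun x ↦ q (Φ.toFun (τ * 0) x)) = q := by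
          funext x
          rw [mul_zero, Φ.map_zero]
        rw [e4] at e3
        exact e3
      refine (hL.2 w v).trans ?_
      refine (intervalIntegral.integral_congr fun t _ ↦ h1 t).trans ?_
      simp
    have hLbij : Bijective (mvfderiv (𝓡 2) L w) := by
      rw [show ⇑(mvfderiv (𝓡 2) L w) = ⇑(mvfderiv (𝓡 2) q w) from funext hdL]
      exact hqbij
    obtain ⟨O, hO, hinj⟩ := eventually_injOn_of_bijective_mvfderiv hL.1 hLbij
    obtain ⟨x, hxU, hxO, hxO'⟩ := (hnear (τ / 2) O hO).exists
    refine hmin x hxU (τ / 2) ⟨by linarith, by linarith⟩ (hinj hxO' hxO ?_)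
    have hLper : Periodic (fun t ↦ q (Φ.toFun (τ * t) x)) 1 := fun t ↦ by
      simp only
      rw [hshift x (subset_closure hxU)]
    have h1 : ∀ t, q (Φ.toFun (τ * t) (Φ.toFun (τ / 2) x)) = q (Φ.toFun (τ * (t + 1 / 2)) x) := by
      intro t
      rw [← Φ.map_add]
      congr 2
      ring
    simp only [h1]
    exact hLper.integral_comp_add (1 / 2)

end Linearization

/-! ### Connectedness of punctured discs and images of connected sets. -/

section PuncturedDisc

theorem Complex.isPreconnected_ball_diff_singleton (r : ℝ) :
    IsPreconnected (Metric.ball (0 : ℂ) r \ {0}) := by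
  have h1 : Metric.ball (0 : ℂ) r \ {0} =
      (fun p : ℝ × ℝ ↦ (p.1 : ℂ) * Complex.exp (p.2 * Complex.I)) '' (Ioo 0 r ×ˢ univ) := by
    ext z
    constructor
    · rintro ⟨hz, hz0⟩
      refine ⟨(‖z‖, z.arg), ⟨⟨norm_pos_iff.2 hz0, mem_ball_zero_iff.1 hz⟩, trivial⟩, ?_⟩
      exact Complex.norm_mul_exp_arg_mul_I z
    · rintro ⟨⟨ρ, θ⟩, ⟨hρ, -⟩, rfl⟩
      simp only at hρ ⊢
      have h2 : ‖(ρ : ℂ) * Complex.exp (θ * Complex.I)‖ = ρ := by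
        rw [norm_mul, Complex.norm_exp_ofReal_mul_I, mul_one, Complex.norm_real, Real.norm_eq_abs,
          abs_of_pos hρ.1]
      refine ⟨by rw [mem_ball_zero_iff, h2]; exact hρ.2, fun h0 ↦ ?_⟩
      rw [mem_singleton_iff] at h0
      rw [h0, norm_zero] at h2
      exact hρ.1.ne h2
  rw [h1]
  refine (isPreconnected_Ioo.prod isPreconnected_univ).image _ ?_
  exact Continuous.continuousOn (by fun_prop)

theorem IsPreconnected.uIoo_subset {K : Set ℝ} (hK : IsPreconnected K) {e k : ℝ}
    (he : e ∈ closure K) (hk : k ∈ K) : uIoo e k ⊆ K := by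
  intro c hc
  rcases le_total e k with h | h
  · rw [uIoo_of_le h] at hc
    obtain ⟨d, hd, hdK⟩ := mem_closure_iff.1 he (Iio c) isOpen_Iio hc.1
    exact hK.Icc_subset hdK hk ⟨le_of_lt hd, hc.2.le⟩
  · rw [uIoo_of_ge h] at hc
    obtain ⟨d, hd, hdK⟩ := mem_closure_iff.1 he (Ioi c) isOpen_Ioi hc.2
    exact hK.Icc_subset hk hdK ⟨hc.1.le, le_of_lt hd⟩

end PuncturedDisc

/-! ### The ends of a resonant cylinder. -/

section ResonantFamilies

variable {N : Type*} [TopologicalSpace N] [T2Space N] [ChartedSpace (EuclideanSpace ℝ (Fin 2)) N]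
  [IsManifold (𝓡 2) ∞ N] {Ω : SymplecticForm N} {H : N → ℝ}

namespace SmoothFlow

variable {Φ : SmoothFlow (Ω.hamiltonianVectorField H)} {Y : TransversalField H}

/-- An orbit is swept out within one period. -/
theorem exists_time_mem_Icc (hH : ContMDiff (𝓡 2) 𝓘(ℝ, ℝ) ∞ H) (Y : TransversalField H) {x y : N}
    (hx : x ∈ Φ.periodicSet) (hy : y ∈ Φ.orbit x) :
    ∃ t ∈ Icc 0 (Φ.minPeriod x), Φ.toFun t x = y := by
  obtain ⟨t, rfl⟩ := hy
  have hT := Φ.minPeriod_pos Y hH hx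
  refine ⟨toIcoMod hT 0 t, ?_, ?_⟩
  · have := toIcoMod_mem_Ico hT 0 t
    rw [zero_add] at this
    exact Ico_subset_Icc_self this
  · simp only
    conv_rhs => rw [← toIcoMod_add_toIcoDiv_zsmul hT 0 t]
    rw [Φ.map_add, zsmul_eq_mul, Φ.apply_int_mul (Φ.apply_minPeriod Y hH hx)]

namespace IsResonantFamily

variable {U : Set N} {s : ℝ → N} {a b τ : ℝ} (h : Φ.IsResonantFamily Y U s a b τ)

include h

omit [T2Space N]

theorem section_mem {c : ℝ} (hc : c ∈ Ioo a b) : s c ∈ U := by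
  have : H (s c) = c := h.isSection.apply_eq c hc
  rw [h.mem_iff, this]
  exact ⟨hc, Φ.mem_orbit_self _⟩

theorem mem_periodicSet_of_mem {x : N} (hx : x ∈ U) : x ∈ Φ.periodicSet := by
  obtain ⟨hc, t, ht⟩ := (h.mem_iff x).1 hx
  rw [← ht]
  exact (Φ.flow_mem_periodicSet_iff t _).2 (h.mem_periodicSet _ hc)

theorem minPeriod_of_mem {x : N} (hx : x ∈ U) : Φ.minPeriod x = τ := by
  obtain ⟨hc, t, ht⟩ := (h.mem_iff x).1 hx
  rw [← ht]
  exact (Φ.minPeriod_flow t _).trans (h.minPeriod_eq _ hc)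

theorem fixed {w : N} (hw : w ∈ closure U) (hwU : w ∉ U) (t : ℝ) : Φ.toFun t w = w :=
  Φ.fixed_of_notMem_regularSet (fun hr ↦ hwU (h.closure_inter w hw hr)) t

theorem notMem_regularSet {w : N} (hw : w ∈ closure U) (hwU : w ∉ U) : w ∉ regularSet H :=
  fun hr ↦ hwU (h.closure_inter w hw hr)

variable (hH : ContMDiff (𝓡 2) 𝓘(ℝ, ℝ) ∞ H)

include hH

theorem apply_mem_Icc {w : N} (hw : w ∈ closure U) : H w ∈ Icc a b := by
  have h1 : closure U ⊆ H ⁻¹' Icc a b :=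
    closure_minimal (fun x hx ↦ Ioo_subset_Icc_self ((h.mem_iff x).1 hx).1)
      (isClosed_Icc.preimage hH.continuous)
  exact h1 hw

variable [T2Space N]

theorem apply_period {x : N} (hx : x ∈ closure U) : Φ.toFun τ x = x := by
  refine closure_minimal (fun y hy ↦ ?_) (isClosed_eq (Φ.continuous_time τ) continuous_id) hx
  have := Φ.apply_minPeriod Y hH (h.mem_periodicSet_of_mem hy)
  rwa [h.minPeriod_of_mem hy] at this

theorem apply_ne {x : N} (hx : x ∈ U) {t : ℝ} (ht : t ∈ Ioo 0 τ) : Φ.toFun t x ≠ x := by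
  intro heq
  have := Φ.minPeriod_le Y hH (h.mem_periodicSet_of_mem hx) ht.1 heq
  rw [h.minPeriod_of_mem hx] at this
  exact not_le.2 ht.2 this

theorem exists_time_section {x : N} (hx : x ∈ U) : ∃ t ∈ Icc 0 τ, Φ.toFun t (s (H x)) = x := by
  obtain ⟨hc, ht⟩ := (h.mem_iff x).1 hx
  have := Φ.exists_time_mem_Icc hH Y (h.mem_periodicSet _ hc) ht
  rwa [h.minPeriod_eq _ hc] at this

theorem exists_time_to_section {x : N} (hx : x ∈ U) : ∃ t ∈ Icc 0 τ, Φ.toFun t x = s (H x) := by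
  obtain ⟨hc, ht⟩ := (h.mem_iff x).1 hx
  have h1 : s (H x) ∈ Φ.orbit x := by
    rw [Φ.orbit_eq_of_mem ht]
    exact Φ.mem_orbit_self _
  have := Φ.exists_time_mem_Icc hH Y (h.mem_periodicSet_of_mem hx) h1
  rwa [h.minPeriod_of_mem hx] at this

/-- Orbits are swept out within the fixed time τ, so not lying on the orbit of s(H x) is an open
condition, by compactness of [0, τ]. New limit points therefore occur only at the extreme levels. -/
theorem mem_of_mem_closure {x : N} (hx : x ∈ closure U) (hc : H x ∈ Ioo a b) : x ∈ U := by
  by_contra hxU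
  have hne : ∀ t ∈ Icc 0 τ, Φ.toFun t (s (H x)) ≠ x := fun t _ heq ↦
    hxU ((h.mem_iff x).2 ⟨hc, ⟨t, heq⟩⟩)
  have hs : ContinuousAt s (H x) :=
    ((h.isSection.contMDiffOn isOpen_Ioo _ hc).contMDiffAt (isOpen_Ioo.mem_nhds hc)).continuousAt
  have hev : ∀ᶠ y in 𝓝 x, ∀ t ∈ Icc 0 τ, Φ.toFun t (s (H y)) ≠ y := by
    refine isCompact_Icc.eventually_forall_of_forall_eventually fun t ht ↦ ?_
    have h1 : ContinuousAt (fun p : N × ℝ ↦ Φ.toFun p.2 (s (H p.1))) (x, t) := by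
      have h2 : ContinuousAt (fun p : N × ℝ ↦ s (H p.1)) (x, t) :=
        ContinuousAt.comp (g := s) (f := fun p : N × ℝ ↦ H p.1) hs
          (hH.continuous.comp continuous_fst).continuousAt
      exact Φ.continuous_uncurry.continuousAt.comp (continuousAt_snd.prodMk h2)
    exact h1.ne_iff_eventually_ne continuousAt_fst |>.1 (hne t ht)
  obtain ⟨y, hy, hyU⟩ := ((mem_closure_iff_frequently.1 hx).and_eventually hev).exists
  obtain ⟨t, ht, heq⟩ := h.exists_time_section hH hy
  exact hyU t ht heq

-- By properness the section, restricted to levels tending to c, has a cluster point.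
omit [T2Space N] in
theorem exists_mem_closure (hproper : IsProperMap H) {c : ℝ} (hc : c ∈ closure (Ioo a b)) :
    ∃ w ∈ closure U, H w = c := by
  let l := 𝓝[Ioo a b] c
  have : l.NeBot := mem_closure_iff_nhdsWithin_neBot.1 hc
  have hK : IsCompact (H ⁻¹' Icc a b) := hproper.isCompact_preimage isCompact_Icc
  have h1 : ∀ᶠ c' in l, s c' ∈ H ⁻¹' Icc a b := by
    filter_upwards [self_mem_nhdsWithin] with c' hc'
    rw [mem_preimage, h.isSection.apply_eq c' hc']
    exact Ioo_subset_Icc_self hc'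
  obtain ⟨w, -, hw⟩ := hK (f := Filter.map s l) (Filter.le_principal_iff.2 h1)
  refine ⟨w, mem_closure_iff_clusterPt.2 (hw.mono (Filter.le_principal_iff.2 ?_)), ?_⟩
  · refine Filter.mem_map.2 (Filter.mem_of_superset self_mem_nhdsWithin fun c' hc' ↦ ?_)
    exact h.section_mem hc'
  · have h2 : Filter.Tendsto H (Filter.map s l) (𝓝 c) := by
      rw [Filter.tendsto_map'_iff]
      have h3 : H ∘ s =ᶠ[l] id := by
        filter_upwards [self_mem_nhdsWithin] with c' hc'
        exact h.isSection.apply_eq c' hc'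
      exact (Filter.tendsto_id.mono_left nhdsWithin_le_nhds).congr' h3.symm
    have h4 := hw.map (hH.continuous.continuousAt) h2
    exact eq_of_nhds_neBot h4

/-- The linearization identifies a neighbourhood of w with a disc. A point of the closure of U
outside U is fixed, hence a zero of the linearization. So inside the punctured disc U is relatively
closed; it is also open and nonempty there, and the punctured disc is connected. -/
theorem exists_preconnected {w : N} (hw : w ∈ closure U) (hwU : w ∉ U) {O : Set N}
    (hO : O ∈ 𝓝 w) : ∃ P ⊆ O, IsPreconnected P ∧ P ⊆ U ∧ insert w P ∈ 𝓝 w := by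
  obtain ⟨G, hG, hbij, heq⟩ := Φ.exists_linearization h.isOpen hw (h.fixed hw hwU) h.pos
    (fun x hx ↦ h.apply_period hH (subset_closure hx)) (fun x hx t ht ↦ h.apply_ne hH hx ht)
  have hzero : ∀ x ∈ closure U, (∀ t, Φ.toFun t x = x) → G x = 0 := by
    intro x hx hfix
    have h1 := heq x hx (τ / 2)
    have h2 : (2 * Real.pi * (τ / 2) / τ : ℝ) = Real.pi := by
      have := h.pos.ne'
      field_simp
    rw [hfix, h2, Complex.exp_pi_mul_I, neg_one_mul] at h1
    exact self_eq_neg.1 h1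
  have hGw := hzero w hw (h.fixed hw hwU)
  obtain ⟨g, hg, hgG, hGg⟩ := (hG w).exists_local_inverse (by simp) hbij
  rw [hGw] at hg hGg
  have hg0 : g 0 = w := by
    have := hgG.self_of_nhds
    rwa [hGw] at this
  have hgc : ∀ᶠ z in 𝓝 (0 : ℂ), ContinuousAt g z := by
    have h1 : ContMDiffAt 𝓘(ℝ, ℂ) (𝓡 2) 1 g 0 := hg.of_le (by simp)
    have : IsManifold (𝓡 2) 1 N := IsManifold.of_le (m := 1) (n := ∞) (by simp)
    filter_upwards [(contMDiffAt_iff_contMDiffAt_nhds (by simp)).1 h1] with z hz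
      using hz.continuousAt
  have hgO : ∀ᶠ z in 𝓝 (0 : ℂ), g z ∈ O := by
    refine hg.continuousAt.eventually ?_
    rw [hg0]
    exact hO
  obtain ⟨r, hr, hball⟩ := Metric.eventually_nhds_iff_ball.1 (hGg.and (hgc.and hgO))
  let P := g '' (Metric.ball (0 : ℂ) r \ {0})
  have hwP : w ∉ P := by
    rintro ⟨z, ⟨hz, hz0⟩, hzw⟩
    have := (hball z hz).1
    rw [hzw, hGw] at this
    exact hz0 this.symm
  have hnhds : insert w P ∈ 𝓝 w := by
    have h1 : ∀ᶠ y in 𝓝 w, G y ∈ Metric.ball (0 : ℂ) r := by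
      refine hG.continuous.continuousAt.eventually ?_
      rw [hGw]
      exact Metric.ball_mem_nhds _ hr
    filter_upwards [h1, hgG] with y hy hgy
    by_cases h0 : G y = 0
    · left
      rw [← hgy, h0, hg0]
    · exact Or.inr ⟨G y, ⟨hy, h0⟩, hgy⟩
  have hP : IsPreconnected P := (Complex.isPreconnected_ball_diff_singleton r).image g
    fun z hz ↦ (hball z hz.1).2.1.continuousWithinAt
  refine ⟨P, ?_, hP, ?_, hnhds⟩
  · rintro _ ⟨z, hz, rfl⟩
    exact (hball z hz.1).2.2
  · refine hP.subset_of_closure_inter_subset h.isOpen ?_ ?_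
    · obtain ⟨y, hyU, hy⟩ := ((mem_closure_iff_frequently.1 hw).and_eventually hnhds).exists
      rcases hy with rfl | hy
      · exact absurd hyU hwU
      · exact ⟨y, hy, hyU⟩
    · rintro _ ⟨hx, z, hz, rfl⟩
      by_contra hxU
      have := hzero _ hx (h.fixed hx hxU)
      rw [(hball z hz.1).1] at this
      exact hz.2 this

theorem apply_eq_or_eq {w : N} (hw : w ∈ closure U) (hwU : w ∉ U) : H w = a ∨ H w = b := by
  have h1 := h.apply_mem_Icc hH hw
  by_contra hne
  push Not at hne
  exact hwU (h.mem_of_mem_closure hH hw ⟨lt_of_le_of_ne h1.1 hne.1.symm, lt_of_le_of_ne h1.2 hne.2⟩)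

/-- A small connected punctured neighbourhood P of w lies in U. Since H(P) is connected with H w in
its closure, P contains points of every level close to H w in (a, b). The section point at such a
level is reached from P within time τ, and points near the fixed point w stay near it for that long.
-/
theorem tendsto_section {w : N} (hw : w ∈ closure U) (hwU : w ∉ U) :
    Filter.Tendsto s (𝓝[Ioo a b] (H w)) (𝓝 w) := by
  intro O hO
  have hO' : ∀ᶠ y in 𝓝 w, ∀ t ∈ Icc 0 τ, Φ.toFun t y ∈ O := by
    refine isCompact_Icc.eventually_forall_of_forall_eventually fun t _ ↦ ?_
    have h1 : ContinuousAt (fun p : N × ℝ ↦ Φ.toFun p.2 p.1) (w, t) :=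
      (Φ.continuous_uncurry.comp continuous_swap).continuousAt
    refine h1.eventually ?_
    simp only [h.fixed hw hwU t]
    exact hO
  obtain ⟨P, hPO, hP, hPU, hnhds⟩ := h.exists_preconnected hH hw hwU hO'
  have hwP : w ∈ closure P := by
    refine mem_closure_iff_frequently.2 ?_
    refine ((mem_closure_iff_frequently.1 hw).and_eventually hnhds).mono ?_
    rintro y ⟨hyU, rfl | hy⟩
    · exact absurd hyU hwU
    · exact hy
  obtain ⟨p, hp⟩ : P.Nonempty := closure_nonempty_iff.1 ⟨w, hwP⟩
  have h2 := (hP.image H hH.continuous.continuousOn).uIoo_subset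
    (image_closure_subset_closure_image hH.continuous ⟨w, hwP, rfl⟩) (mem_image_of_mem H hp)
  have hpc := ((h.mem_iff p).1 (hPU hp)).1
  have h3 : uIoo (H w) (H p) ∈ 𝓝[Ioo a b] (H w) := by
    rcases h.apply_eq_or_eq hH hw hwU with e | e
    · rw [e, uIoo_of_lt hpc.1]
      refine mem_nhdsWithin.2 ⟨Iio (H p), isOpen_Iio, hpc.1, fun c hc ↦ ⟨hc.2.1, hc.1⟩⟩
    · rw [e, uIoo_of_gt hpc.2]
      refine mem_nhdsWithin.2 ⟨Ioi (H p), isOpen_Ioi, hpc.2, fun c hc ↦ ⟨hc.1, hc.2.2⟩⟩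
  refine Filter.mem_map.2 (Filter.mem_of_superset h3 fun c hc ↦ ?_)
  obtain ⟨q, hq, rfl⟩ := h2 hc
  obtain ⟨t, ht, heq⟩ := h.exists_time_to_section hH (hPU hq)
  rw [mem_preimage, ← heq]
  exact hPO hq t ht

/-- Both points are the limit of the same section at the same end, so each end has at most one
boundary point. -/
theorem eq_of_apply_eq {w w' : N} (hw : w ∈ closure U) (hwU : w ∉ U) (hw' : w' ∈ closure U)
    (hwU' : w' ∉ U) (heq : H w = H w') : w = w' := by
  have h1 := h.tendsto_section hH hw hwU
  have h2 := h.tendsto_section hH hw' hwU'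
  rw [← heq] at h2
  have : (𝓝[Ioo a b] (H w)).NeBot := by
    rw [← mem_closure_iff_nhdsWithin_neBot, closure_Ioo h.lt.ne]
    exact h.apply_mem_Icc hH hw
  exact tendsto_nhds_unique h1 h2

/-- A resonant family fills a closed surface up to a maximum and a minimum point. -/
theorem exists_extrema [ConnectedSpace N] (hproper : IsProperMap H) : ∃ zmax zmin : N,
    H zmax = b ∧ H zmin = a ∧ zmax ∉ U ∧ zmin ∉ U ∧ insert zmax (insert zmin U) = univ ∧
    closure U = univ := by
  obtain ⟨zp, hzp, hb⟩ := h.exists_mem_closure hH hproper (c := b)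
    (by rw [closure_Ioo h.lt.ne]; exact right_mem_Icc.2 h.lt.le)
  obtain ⟨zm, hzm, ha⟩ := h.exists_mem_closure hH hproper (c := a)
    (by rw [closure_Ioo h.lt.ne]; exact left_mem_Icc.2 h.lt.le)
  have hzpU : zp ∉ U := fun hU ↦ by
    have := ((h.mem_iff zp).1 hU).1.2
    exact absurd hb this.ne
  have hzmU : zm ∉ U := fun hU ↦ by
    have := ((h.mem_iff zm).1 hU).1.1
    exact absurd ha this.ne'
  have hcl : closure U = insert zp (insert zm U) := by
    refine Subset.antisymm (fun w hw ↦ ?_) ?_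
    · by_cases hwU : w ∈ U
      · exact Or.inr (Or.inr hwU)
      · rcases h.apply_eq_or_eq hH hw hwU with e | e
        · exact Or.inr (Or.inl (h.eq_of_apply_eq hH hw hwU hzm hzmU (e.trans ha.symm)))
        · exact Or.inl (h.eq_of_apply_eq hH hw hwU hzp hzpU (e.trans hb.symm))
    · exact insert_subset hzp (insert_subset hzm subset_closure)
  have hopen : IsOpen (closure U) := by
    rw [isOpen_iff_mem_nhds]
    intro w hw
    by_cases hwU : w ∈ U
    · exact Filter.mem_of_superset (h.isOpen.mem_nhds hwU) subset_closure
    · obtain ⟨P, -, -, hPU, hn⟩ := h.exists_preconnected hH hw hwU Filter.univ_mem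
      exact Filter.mem_of_superset hn (insert_subset hw (hPU.trans subset_closure))
  have huniv : closure U = univ :=
    IsClopen.eq_univ ⟨isClosed_closure, hopen⟩ ⟨zp, hzp⟩
  exact ⟨zp, zm, hb, ha, hzpU, hzmU, hcl ▸ huniv, huniv⟩

end IsResonantFamily

end SmoothFlow

end ResonantFamilies

/-! ### Nondegeneracy of the linearizable critical points. -/

section CriticalPoints

variable {N : Type*} [TopologicalSpace N] [ChartedSpace (EuclideanSpace ℝ (Fin 2)) N]
  [IsManifold (𝓡 2) ∞ N]

theorem mvfderiv_eq_fderiv_comp_chart {F : Type*} [NormedAddCommGroup F] [NormedSpace ℝ F]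
    {f : N → F} (hf : ContMDiff (𝓡 2) 𝓘(ℝ, F) ∞ f) (z : N) {x : N}
    (hx : x ∈ (chartAt 𝔼 z).source) (v : TangentSpace (𝓡 2) x) :
    mvfderiv (𝓡 2) f x v = fderiv ℝ (f ∘ (extChartAt (𝓡 2) z).symm) (extChartAt (𝓡 2) z x)
      (mvfderiv (𝓡 2) (extChartAt (𝓡 2) z) x v) := by
  have : IsManifold (𝓡 2) 1 N := IsManifold.of_le (m := 1) (n := ∞) (by simp)
  let χ := extChartAt (𝓡 2) z
  have hxs : x ∈ χ.source := by rwa [extChartAt_source]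
  have h1 : DifferentiableAt ℝ (f ∘ χ.symm) (χ x) :=
    ((hf.contDiffOn_extChartAt_symm z).contDiffAt
      ((isOpen_extChartAt_target z).mem_nhds (χ.map_source hxs))).differentiableAt (by simp)
  have h2 := h1.hasFDerivAt.hasMFDerivAt.comp x (mdifferentiableAt_extChartAt hx).hasMFDerivAt
  have h3 : f =ᶠ[𝓝 x] (f ∘ χ.symm) ∘ χ := by
    filter_upwards [(isOpen_extChartAt_source z).mem_nhds hxs] with y hy
    simp only [comp_apply, χ.left_inv hy]
  have h4 := (h2.congr_of_eventuallyEq h3).mfderiv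
  exact DFunLike.congr_fun h4 v

/-- A critical point at which the Hamiltonian vector field has invertible linear part is
nondegenerate. -/
theorem SymplecticForm.isNondegenerateCriticalPoint (Ω : SymplecticForm N) {H : N → ℝ}
    (hH : ContMDiff (𝓡 2) 𝓘(ℝ, ℝ) ∞ H) {z : N} (hz : mvfderiv (𝓡 2) H z = 0) {G : N → ℂ}
    (hG : ContMDiff (𝓡 2) 𝓘(ℝ, ℂ) ∞ G) (hbij : Bijective (mvfderiv (𝓡 2) G z)) {k : ℂ} (hk : k ≠ 0)
    (hX : ∀ x, mvfderiv (𝓡 2) G x (Ω.hamiltonianVectorField H x) = k * G x) :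
    IsNondegenerateCriticalPoint H z := by
  refine ⟨hz, fun u hu ↦ ?_⟩
  have : IsManifold (𝓡 2) 1 N := IsManifold.of_le (m := 1) (n := ∞) (by simp)
  obtain ⟨U, hU, hzU, e₁, e₂, he₁, he₂, hω, hne⟩ := Ω.exists_frame z
  let χ := extChartAt (𝓡 2) z
  let y₀ := χ z
  have hy₀ : y₀ ∈ χ.target := mem_extChartAt_target z
  have hsource : χ.source = (chartAt 𝔼 z).source := extChartAt_source (𝓡 2) z
  let W := U ∩ (chartAt 𝔼 z).source
  have hW : IsOpen W := hU.inter (chartAt 𝔼 z).open_source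
  have hzW : z ∈ W := ⟨hzU, mem_chart_source 𝔼 z⟩
  -- With u in the kernel of the Hessian, the relation dG(X) = kG is examined along the coordinate
  -- line through z in the direction u, divided by t, as t → 0.
  let γ : ℝ → N := fun t ↦ χ.symm (y₀ + t • u)
  have hγ0 : γ 0 = z := by
    simp only [γ, zero_smul, add_zero, y₀]
    exact extChartAt_to_inv z
  have hlin : HasDerivAt (fun t : ℝ ↦ y₀ + t • u) u 0 := by
    simpa using ((hasDerivAt_id (0 : ℝ)).smul_const u).const_add y₀
  have hγc : ContinuousAt γ 0 := by
    refine ContinuousAt.comp (g := χ.symm) ?_ hlin.continuousAt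
    rw [zero_smul, add_zero]
    exact continuousAt_extChartAt_symm z
  have hev : ∀ᶠ t in 𝓝 0, γ t ∈ W ∧ χ (γ t) = y₀ + t • u := by
    have h1 : ∀ᶠ t in 𝓝 0, γ t ∈ W := hγc.eventually (by rw [hγ0]; exact hW.mem_nhds hzW)
    have h2 : ∀ᶠ t in 𝓝 (0 : ℝ), y₀ + t • u ∈ χ.target := by
      refine hlin.continuousAt.eventually ?_
      change _ ∈ 𝓝 (y₀ + (0 : ℝ) • u)
      rw [zero_smul, add_zero]
      exact (isOpen_extChartAt_target z).mem_nhds hy₀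
    filter_upwards [h1, h2] with t ht1 ht2
    exact ⟨ht1, χ.right_inv ht2⟩
  have hlim : ∀ {F : Type} [NormedAddCommGroup F] [NormedSpace ℝ F] {f : N → F},
      ContMDiffOn (𝓡 2) 𝓘(ℝ, F) ∞ f W → Filter.Tendsto (fun t ↦ f (γ t)) (𝓝[≠] 0) (𝓝 (f z)) := by
    intro F _ _ f hf
    have h1 : ContinuousAt f (γ 0) := by
      rw [hγ0]
      exact hf.continuousOn.continuousAt (hW.mem_nhds hzW)
    have h2 := (ContinuousAt.comp (f := γ) h1 hγc).tendsto
    simp only [comp_apply, hγ0] at h2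
    exact h2.mono_left nhdsWithin_le_nhds
  have he₁' := he₁.mono (inter_subset_left (t := (chartAt 𝔼 z).source))
  have he₂' := he₂.mono (inter_subset_left (t := (chartAt 𝔼 z).source))
  have hχ : ContMDiffOn (𝓡 2) 𝓘(ℝ, 𝔼) ∞ χ W := contMDiffOn_extChartAt.mono inter_subset_right
  have l1 := hlim (hχ.mfderiv_vectorField hW he₁')
  have l2 := hlim (hχ.mfderiv_vectorField hW he₂')
  have l3 := hlim (hG.contMDiffOn.mfderiv_vectorField hW he₁')
  have l4 := hlim (hG.contMDiffOn.mfderiv_vectorField hW he₂')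
  have l5 := hlim (hω.mono inter_subset_left)
  have hĤ : ContDiffAt ℝ ∞ (H ∘ χ.symm) y₀ := (hH.contDiffOn_extChartAt_symm z).contDiffAt
    ((isOpen_extChartAt_target z).mem_nhds hy₀)
  have hĜ : ContDiffAt ℝ ∞ (G ∘ χ.symm) y₀ := (hG.contDiffOn_extChartAt_symm z).contDiffAt
    ((isOpen_extChartAt_target z).mem_nhds hy₀)
  have hdH : fderiv ℝ (H ∘ χ.symm) y₀ = 0 := by
    have := mvfderiv_eq_fderiv_chart (hH.mdifferentiable (by simp) z)
    rw [hz] at this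
    ext v
    exact (this v).symm
  have hG0 : G z = 0 := by
    have h1 := hX z
    rw [(Ω.hamiltonianVectorField_eq_zero_iff H z).2 hz, _root_.map_zero] at h1
    exact (mul_eq_zero.1 h1.symm).resolve_left hk
  -- The limit is the Hessian applied to u, which vanishes by assumption.
  have l6 : Filter.Tendsto (fun t : ℝ ↦ t⁻¹ • fderiv ℝ (H ∘ χ.symm) (y₀ + t • u)) (𝓝[≠] 0)
      (𝓝 0) := by
    have h1 : DifferentiableAt ℝ (fderiv ℝ (H ∘ χ.symm)) (y₀ + (0 : ℝ) • u) := by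
      rw [zero_smul, add_zero]
      exact (hĤ.fderiv_right (m := 1) (by norm_cast)).differentiableAt (by simp)
    have h2 := h1.hasFDerivAt.comp_hasDerivAt 0 hlin
    rw [zero_smul, add_zero, show fderiv ℝ (fderiv ℝ (H ∘ χ.symm)) y₀ u = 0 from
      ContinuousLinearMap.ext hu] at h2
    have h3 := hasDerivAt_iff_tendsto_slope_zero.1 h2
    simpa [hdH] using h3
  have l7 : Filter.Tendsto (fun t : ℝ ↦ t⁻¹ • G (γ t)) (𝓝[≠] 0)
      (𝓝 (fderiv ℝ (G ∘ χ.symm) y₀ u)) := by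
    have h1 : DifferentiableAt ℝ (G ∘ χ.symm) (y₀ + (0 : ℝ) • u) := by
      rw [zero_smul, add_zero]
      exact hĜ.differentiableAt (by simp)
    have h2 := h1.hasFDerivAt.comp_hasDerivAt 0 hlin
    rw [zero_smul, add_zero] at h2
    have h3 := hasDerivAt_iff_tendsto_slope_zero.1 h2
    have h4 : G (χ.symm y₀) = 0 := by
      rw [← hG0]
      exact congrArg G (extChartAt_to_inv z)
    simpa [h4] using h3
  -- Cramer's rule expresses X through dH, so dG(X) = kG becomes linear in dH. In the limit the
  -- right side vanishes while the left side tends to k Ω(e₁, e₂) dG(u); hence dG(u) = 0 and u = 0.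
  have key : ∀ᶠ t in 𝓝[≠] (0 : ℝ),
      k * ((Ω.form (γ t) (e₁ (γ t)) (e₂ (γ t)) : ℝ) : ℂ) * (t⁻¹ • G (γ t)) =
      (((t⁻¹ • fderiv ℝ (H ∘ χ.symm) (y₀ + t • u)) (mvfderiv (𝓡 2) χ (γ t) (e₁ (γ t))) : ℝ) : ℂ) *
        mvfderiv (𝓡 2) G (γ t) (e₂ (γ t)) -
      (((t⁻¹ • fderiv ℝ (H ∘ χ.symm) (y₀ + t • u)) (mvfderiv (𝓡 2) χ (γ t) (e₂ (γ t))) : ℝ) : ℂ) *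
        mvfderiv (𝓡 2) G (γ t) (e₁ (γ t)) := by
    filter_upwards [hev.filter_mono nhdsWithin_le_nhds] with t ⟨htW, htχ⟩
    have g1 := mvfderiv_eq_fderiv_comp_chart hH z htW.2 (e₁ (γ t))
    have g2 := mvfderiv_eq_fderiv_comp_chart hH z htW.2 (e₂ (γ t))
    have hne' : ((Ω.form (γ t) (e₁ (γ t)) (e₂ (γ t)) : ℝ) : ℂ) ≠ 0 :=
      Complex.ofReal_ne_zero.2 (hne _ htW.1)
    have g3 := Ω.cramer (γ t) (e₁ (γ t)) (e₂ (γ t)) (Ω.hamiltonianVectorField H (γ t))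
      (hne _ htW.1)
    rw [Ω.form_hamiltonianVectorField_left, Ω.form_hamiltonianVectorField_right] at g3
    have g4 := hX (γ t)
    rw [g3, _root_.map_add, map_smul, map_smul, g1, g2, Complex.real_smul, Complex.real_smul] at g4
    change _ * mvfderiv (𝓡 2) G (γ t) (e₁ (γ t)) + _ * mvfderiv (𝓡 2) G (γ t) (e₂ (γ t)) = _ at g4
    have g5 : extChartAt (𝓡 2) z (γ t) = y₀ + t • u := htχ
    rw [g5] at g4
    have g6 : k * ((Ω.form (γ t) (e₁ (γ t)) (e₂ (γ t)) : ℝ) : ℂ) * (t⁻¹ • G (γ t)) =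
      ((t⁻¹ : ℝ) : ℂ) * ((Ω.form (γ t) (e₁ (γ t)) (e₂ (γ t)) : ℝ) : ℂ) * (k * G (γ t)) := by
      rw [Complex.real_smul]
      ring
    rw [g6, ← g4]
    simp only [smul_apply, smul_eq_mul]
    push_cast
    field_simp
    ring
  have happ : ∀ {A : ℝ → 𝔼 →L[ℝ] ℝ} {v : ℝ → 𝔼} {v₀ : 𝔼}, Filter.Tendsto A (𝓝[≠] 0) (𝓝 0) →
      Filter.Tendsto v (𝓝[≠] 0) (𝓝 v₀) → Filter.Tendsto (fun t ↦ A t (v t)) (𝓝[≠] 0) (𝓝 0) := by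
    intro A v v₀ hA hv
    have h1 := (isBoundedBilinearMap_apply (𝕜 := ℝ) (E := 𝔼) (F := ℝ)).continuous.tendsto (0, v₀)
    exact h1.comp (hA.prodMk_nhds hv)
  have L1 := ((tendsto_const_nhds (x := k)).mul
    ((Complex.continuous_ofReal.tendsto _).comp l5)).mul l7
  have L2 := (((Complex.continuous_ofReal.tendsto _).comp (happ l6 l1)).mul l4).sub
    (((Complex.continuous_ofReal.tendsto _).comp (happ l6 l2)).mul l3)
  have hzero : ∀ p q : ℂ, ((0 : ℝ) : ℂ) * p - ((0 : ℝ) : ℂ) * q = 0 := by simp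
  have h0 := (tendsto_nhds_unique (L1.congr' key) L2).trans (hzero _ _)
  have h1 : fderiv ℝ (G ∘ χ.symm) y₀ u = 0 := by
    refine (mul_eq_zero.1 h0).resolve_left (mul_ne_zero hk ?_)
    exact Complex.ofReal_ne_zero.2 (hne z hzU)
  have h2 := mvfderiv_eq_fderiv_chart (hG.mdifferentiable (by simp) z) u
  exact hbij.1 ((h2.trans h1).trans (_root_.map_zero (mvfderiv (𝓡 2) G z)).symm)

end CriticalPoints

/-! ### Periodic flows as circle actions. -/

section CircleActions

variable {N : Type*} [TopologicalSpace N] [ChartedSpace (EuclideanSpace ℝ (Fin 2)) N]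
  [IsManifold (𝓡 2) ∞ N] {Ω : SymplecticForm N} {H : N → ℝ}

/-- A periodic Hamiltonian flow is a circle action. -/
theorem SmoothFlow.inducesHamiltonianCircleAction
    (Φ : SmoothFlow (Ω.hamiltonianVectorField H)) {τ : ℝ} (hτ : 0 < τ)
    (hper : ∀ x, Φ.toFun τ x = x) :
    InducesHamiltonianCircleAction Ω H {x | ∀ t, Φ.toFun t x = x} := by
  let ρ : MulAction Circle N :=
    { smul := fun z x ↦ Φ.rotate τ z x
      one_smul := fun x ↦ by
        change Φ.rotate τ 1 x = x
        rw [← Circle.exp_zero, Φ.rotate_exp (hper x), mul_zero, zero_div, Φ.map_zero]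
      mul_smul := fun z w x ↦ by
        change Φ.rotate τ (z * w) x = Φ.rotate τ z (Φ.rotate τ w x)
        rw [← Circle.exp_arg z, ← Circle.exp_arg w, ← Circle.exp_add, Φ.rotate_exp (hper _),
          Φ.rotate_exp (hper _), Φ.rotate_exp (hper _), ← Φ.map_add, mul_add, add_div] }
  have hexp : ∀ (t : ℝ) (x : N), Circle.exp (2 * Real.pi * t / τ) • x = Φ.toFun t x := by
    intro t x
    change Φ.rotate τ _ x = _
    rw [Φ.rotate_exp (hper x)]
    congr 1
    field_simp
  refine ⟨τ, hτ, ρ, ⟨fun p ↦ ?_⟩, fun x ↦ ?_, ?_⟩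
  · have h1 : ContMDiffAt ((𝓡 2).prod (𝓡 1)) (𝓡 2) ∞
        (fun q : N × Circle ↦ Φ.rotate τ q.2 q.1) (p.2, p.1) :=
      contMDiffAt_rotate (T := fun _ : N ↦ τ) (f := fun x : N ↦ x) contMDiffAt_const
        contMDiffAt_id (Filter.Eventually.of_forall hper) p.1
    have h2 : ContMDiffAt ((𝓡 1).prod (𝓡 2)) ((𝓡 2).prod (𝓡 1)) ∞
        (fun p : Circle × N ↦ (p.2, p.1)) p := contMDiffAt_snd.prodMk contMDiffAt_fst
    exact ContMDiffAt.comp (g := fun q : N × Circle ↦ Φ.rotate τ q.2 q.1) p h1 h2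
  · simp only [hexp]
    exact Φ.isMIntegralCurve x
  · ext x
    constructor
    · intro hx t
      rw [← hexp]
      exact hx _
    · intro hx z
      have := hexp (τ * (z : ℂ).arg / (2 * Real.pi)) x
      exact hx _

end CircleActions

-- Surfaces that project radially onto the sphere.

local notation "𝔼₃" => EuclideanSpace ℝ (Fin 3)

section Spheres

variable {N : Type*} [TopologicalSpace N] [ChartedSpace (EuclideanSpace ℝ (Fin 2)) N]
  [IsManifold (𝓡 2) ∞ N]

/-- A bijection that is a local diffeomorphism is a diffeomorphism. -/
theorem ContMDiff.nonempty_diffeomorph {M : Type*} [TopologicalSpace M]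
    [ChartedSpace (EuclideanSpace ℝ (Fin 2)) M] [IsManifold (𝓡 2) ∞ M] {f : N → M}
    (hf : ContMDiff (𝓡 2) (𝓡 2) ∞ f) (hbij : Bijective f)
    (hd : ∀ x, Bijective (mfderiv (𝓡 2) (𝓡 2) f x)) : Nonempty (N ≃ₘ^∞⟮𝓡 2, 𝓡 2⟯ M) := by
  let e := Equiv.ofBijective f hbij
  refine ⟨{ e with contMDiff_toFun := hf, contMDiff_invFun := fun y ↦ ?_ }⟩
  obtain ⟨x, rfl⟩ := hbij.2 y
  obtain ⟨g, hg, -, h⟩ := (hf x).exists_local_inverse (by simp) (hd x)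
  refine hg.congr_of_eventuallyEq ?_
  filter_upwards [h] with z hz
  conv_lhs => rw [← hz]
  exact e.symm_apply_apply (g z)

/-- A closed surface that projects diffeomorphically along rays is a sphere. -/
theorem ContMDiff.nonempty_diffeomorph_sphere [CompactSpace N] [Nonempty N]
    {A : N → EuclideanSpace ℝ (Fin 3)} (hA : ContMDiff (𝓡 2) 𝓘(ℝ, EuclideanSpace ℝ (Fin 3)) ∞ A)
    (h0 : ∀ x, A x ≠ 0) (hinj : ∀ x y, ∀ μ : ℝ, 0 < μ → A x = μ • A y → x = y)
    (himm : ∀ x (v : TangentSpace (𝓡 2) x) (l : ℝ), mvfderiv (𝓡 2) A x v = l • A x → v = 0) :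
    Nonempty (N ≃ₘ^∞⟮𝓡 2, 𝓡 2⟯ Metric.sphere (0 : EuclideanSpace ℝ (Fin 3)) 1) := by
  have hfact : Fact (Module.finrank ℝ 𝔼₃ = 2 + 1) := ⟨finrank_euclideanSpace_fin⟩
  have hpos : ∀ x, 0 < ‖A x‖ := fun x ↦ norm_pos_iff.2 (h0 x)
  have hnorm : ContMDiff (𝓡 2) 𝓘(ℝ, ℝ) ∞ (fun x ↦ ‖A x‖) := fun x ↦
    (contDiffAt_norm ℝ (h0 x)).contMDiffAt.comp x (hA x)
  have hinv : ContMDiff (𝓡 2) 𝓘(ℝ, ℝ) ∞ (fun x ↦ ‖A x‖⁻¹) := fun x ↦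
    (contDiffAt_inv ℝ (hpos x).ne').contMDiffAt.comp x (hnorm x)
  let B : N → 𝔼₃ := fun x ↦ ‖A x‖⁻¹ • A x
  have hB : ContMDiff (𝓡 2) 𝓘(ℝ, 𝔼₃) ∞ B := hinv.smul hA
  have hBs : ∀ x, B x ∈ Metric.sphere (0 : 𝔼₃) 1 := fun x ↦ by
    rw [mem_sphere_zero_iff_norm, norm_smul, norm_inv, norm_norm, inv_mul_cancel₀ (hpos x).ne']
  let f : N → Metric.sphere (0 : 𝔼₃) 1 := fun x ↦ ⟨B x, hBs x⟩
  have hf : ContMDiff (𝓡 2) (𝓡 2) ∞ f := hB.codRestrict_sphere hBs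
  have hAB : ∀ x, A x = ‖A x‖ • B x := fun x ↦ by
    rw [smul_smul, mul_inv_cancel₀ (hpos x).ne', one_smul]
  have hfr : ∀ x, Module.finrank ℝ (TangentSpace (𝓡 2) (f x)) = 2 := fun x ↦
    (finrank_euclideanSpace_fin : Module.finrank ℝ 𝔼 = 2)
  have hfr' : ∀ x : N, Module.finrank ℝ (TangentSpace (𝓡 2) x) = 2 := fun x ↦
    (finrank_euclideanSpace_fin : Module.finrank ℝ 𝔼 = 2)
  have hd : ∀ x, Bijective (mfderiv (𝓡 2) (𝓡 2) f x) := by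
    intro x
    have hfin : FiniteDimensional ℝ (TangentSpace (𝓡 2) x) :=
      inferInstanceAs (FiniteDimensional ℝ 𝔼)
    have hfin' : FiniteDimensional ℝ (TangentSpace (𝓡 2) (f x)) :=
      inferInstanceAs (FiniteDimensional ℝ 𝔼)
    -- Where the differential of A / |A| kills v, the differential of A sends v to a multiple of A,
    -- which the hypothesis on A excludes unless v = 0.
    have hi : Injective (mfderiv (𝓡 2) (𝓡 2) f x).toLinearMap := by
      rw [injective_iff_map_eq_zero]
      intro v hv
      have h1 : mvfderiv (𝓡 2) B x v = 0 := by
        have hval : ContMDiff (𝓡 2) 𝓘(ℝ, 𝔼₃) ∞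
          (fun z : Metric.sphere (0 : 𝔼₃) 1 ↦ (z : 𝔼₃)) := contMDiff_coe_sphere
        have h2 := (hval.mdifferentiable (by simp) (f x)).hasMFDerivAt.comp x
          (hf.mdifferentiable (by simp) x).hasMFDerivAt
        have h3 := DFunLike.congr_fun h2.mfderiv v
        refine Eq.trans h3 ?_
        refine Eq.trans (congrArg (mfderiv (𝓡 2) 𝓘(ℝ, 𝔼₃)
          (fun z : Metric.sphere (0 : 𝔼₃) 1 ↦ (z : 𝔼₃)) (f x)) hv) ?_
        exact _root_.map_zero _
      have h4 := DFunLike.congr_fun (mvfderiv_smul (hnorm.mdifferentiable (by simp) x)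
        (hB.mdifferentiable (by simp) x)) v
      have h5 : ((fun x ↦ ‖A x‖) • B : N → 𝔼₃) = A := funext fun x ↦ (hAB x).symm
      rw [h5] at h4
      refine himm x v (mvfderiv (𝓡 2) (fun x ↦ ‖A x‖) x v * ‖A x‖⁻¹) (h4.trans ?_)
      rw [mul_smul]
      change ‖A x‖ • mvfderiv (𝓡 2) B x v + mvfderiv (𝓡 2) (fun x ↦ ‖A x‖) x v • B x = _
      rw [h1, smul_zero, zero_add]
    exact ⟨hi, (LinearMap.injective_iff_surjective_of_finrank_eq_finrank
      ((hfr' x).trans (hfr x).symm)).1 hi⟩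
  have hopen : IsOpenMap f := by
    rw [isOpenMap_iff_nhds_le]
    intro x O hO
    obtain ⟨g, hg, hgf, hfg⟩ := (hf x).exists_local_inverse (by simp) (hd x)
    have h1 : ∀ᶠ z in 𝓝 (f x), g z ∈ f ⁻¹' O := by
      refine hg.continuousAt.eventually ?_
      rw [hgf.self_of_nhds]
      exact hO
    filter_upwards [h1, hfg] with z hz hz'
    rw [← hz']
    exact hz
  -- The image is open, and closed by compactness, in the connected sphere.
  have hsurj : Surjective f := by
    have hconn : ConnectedSpace (Metric.sphere (0 : 𝔼₃) 1) := by
      refine isConnected_iff_connectedSpace.1 (isConnected_sphere ?_ 0 zero_le_one)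
      rw [← Module.finrank_eq_rank, finrank_euclideanSpace_fin]
      norm_num
    rw [← range_eq_univ]
    exact IsClopen.eq_univ ⟨(isCompact_range hf.continuous).isClosed, hopen.isOpen_range⟩
      (range_nonempty f)
  refine hf.nonempty_diffeomorph ⟨fun x y hxy ↦ ?_, hsurj⟩ hd
  have h1 : B x = B y := congrArg Subtype.val hxy
  refine hinj x y (‖A x‖ * ‖A y‖⁻¹) (mul_pos (hpos x) (inv_pos.2 (hpos y))) ?_
  conv_lhs => rw [hAB x, h1]
  rw [mul_smul]

end Spheres

/-! ### A global rotation-equivariant map to the plane. -/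

section EquivariantMaps

variable {N : Type*} [TopologicalSpace N] [T2Space N] [ChartedSpace (EuclideanSpace ℝ (Fin 2)) N]
  [IsManifold (𝓡 2) ∞ N] {Ω : SymplecticForm N} {H : N → ℝ}

namespace SmoothFlow.IsResonantFamily

variable {Φ : SmoothFlow (Ω.hamiltonianVectorField H)} {Y : TransversalField H}
  {U : Set N} {s : ℝ → N} {a b τ : ℝ} (h : Φ.IsResonantFamily Y U s a b τ)
  (hH : ContMDiff (𝓡 2) 𝓘(ℝ, ℝ) ∞ H)

include h

omit [T2Space N] in
theorem flow_mem {x : N} (hx : x ∈ U) (t : ℝ) (hH : ContMDiff (𝓡 2) 𝓘(ℝ, ℝ) ∞ H) :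
    Φ.toFun t x ∈ U := by
  have h1 := (h.mem_iff x).1 hx
  rw [h.mem_iff, Φ.apply_hamiltonian hH]
  refine ⟨h1.1, ?_⟩
  rw [← Φ.orbit_eq_of_mem h1.2]
  exact Φ.mem_orbit t x

omit [T2Space N] in
theorem contMDiffAt_section {c : ℝ} (hc : c ∈ Ioo a b) : ContMDiffAt 𝓘(ℝ, ℝ) (𝓡 2) ∞ s c :=
  (h.isSection.contMDiffOn isOpen_Ioo _ hc).contMDiffAt (isOpen_Ioo.mem_nhds hc)

include hH

theorem exp_eq_exp {x : N} (hx : x ∈ U) {t u : ℝ} (htu : Φ.toFun t x = Φ.toFun u x) :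
    Complex.exp ((2 * Real.pi * t / τ : ℝ) * Complex.I) =
      Complex.exp ((2 * Real.pi * u / τ : ℝ) * Complex.I) := by
  obtain ⟨k, hk⟩ := (Φ.apply_eq_iff_exists_int Y hH (h.mem_periodicSet_of_mem hx) _).1
    (Φ.apply_sub_eq htu)
  rw [h.minPeriod_of_mem hx] at hk
  rw [Complex.exp_eq_exp_iff_exists_int]
  refine ⟨k, ?_⟩
  have h1 : t = u + k * τ := by linarith
  have h2 : 2 * Real.pi * t / τ = 2 * Real.pi * u / τ + k * (2 * Real.pi) := by
    have := h.pos.ne'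
    rw [h1]
    field_simp
  rw [h2]
  push_cast
  ring

theorem apply_eq_of_exp_eq_exp {x : N} (hx : x ∈ U) {t u : ℝ}
    (htu : Complex.exp ((2 * Real.pi * t / τ : ℝ) * Complex.I) =
      Complex.exp ((2 * Real.pi * u / τ : ℝ) * Complex.I)) : Φ.toFun t x = Φ.toFun u x := by
  rw [Complex.exp_eq_exp_iff_exists_int] at htu
  obtain ⟨k, hk⟩ := htu
  have h1 : (2 * Real.pi * t / τ : ℝ) = 2 * Real.pi * u / τ + k * (2 * Real.pi) := by
    have h2 : ((2 * Real.pi * t / τ : ℝ) : ℂ) =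
        ((2 * Real.pi * u / τ + k * (2 * Real.pi) : ℝ) : ℂ) := by
      apply mul_right_cancel₀ Complex.I_ne_zero
      rw [hk]
      push_cast
      ring
    exact_mod_cast h2
  have h3 : t = u + k * τ := by
    have := h.pos.ne'
    have := Real.pi_ne_zero
    field_simp at h1
    linarith
  rw [h3, Φ.map_add, Φ.apply_int_mul (h.apply_period hH (subset_closure hx))]

/-- The phase function of a resonant family. -/
theorem exists_phase : ∃ G : N → ℂ, (∀ x ∈ U, ContMDiffAt (𝓡 2) 𝓘(ℝ, ℂ) ∞ G x) ∧
    (∀ x ∈ U, ∀ t, G (Φ.toFun t x) =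
      Complex.exp ((2 * Real.pi * t / τ : ℝ) * Complex.I) * G x) ∧
    ∀ x ∈ U, G x ≠ 0 := by
  have hex : ∀ x, ∃ t, x ∈ U → Φ.toFun t (s (H x)) = x := fun x ↦ by
    by_cases hx : x ∈ U
    · obtain ⟨t, -, ht⟩ := h.exists_time_section hH hx
      exact ⟨t, fun _ ↦ ht⟩
    · exact ⟨0, fun hx' ↦ absurd hx' hx⟩
  choose θ hθ using hex
  let e : ℝ → ℂ := fun t ↦ Complex.exp ((2 * Real.pi * t / τ : ℝ) * Complex.I)
  have he : ContDiff ℝ ∞ e := by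
    have h1 : ContDiff ℝ ∞ (fun t : ℝ ↦ (((2 * Real.pi * t / τ : ℝ) : ℂ) * Complex.I)) := by
      have h2 : ContDiff ℝ ∞ (fun t : ℝ ↦ (2 * Real.pi * t / τ : ℝ)) :=
        (contDiff_const.mul contDiff_id).div_const τ
      exact (Complex.ofRealCLM.contDiff.comp h2).mul contDiff_const
    exact Complex.contDiff_exp.comp h1
  -- The time from the section to x is defined only modulo τ, and the choice of θ need not be
  -- continuous; its exponential is independent of the choice and inherits smoothness from local
  -- time coordinates.
  have hunique : ∀ x ∈ U, ∀ t, Φ.toFun t (s (H x)) = x → e (θ x) = e t := fun x hx t ht ↦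
    h.exp_eq_exp hH (h.section_mem ((h.mem_iff x).1 hx).1) ((hθ x hx).trans ht.symm)
  refine ⟨fun x ↦ e (θ x), fun x hx ↦ ?_, fun x hx t ↦ ?_, fun x _ ↦ Complex.exp_ne_zero _⟩
  · have hc := ((h.mem_iff x).1 hx).1
    obtain ⟨φ, hφ, -, h1, -⟩ := Φ.exists_time hH h.isSection isOpen_Ioo hc
    have hback : Φ.toFun (-θ x) x = s (H x) := by
      have := Φ.neg_cancel (θ x) (s (H x))
      rwa [hθ x hx] at this
    have hsm : ContMDiffAt (𝓡 2) 𝓘(ℝ, ℝ) ∞ (fun y ↦ θ x + φ (Φ.toFun (-θ x) y)) x := by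
      refine contMDiffAt_const.add (ContMDiffAt.comp (g := φ) x ?_ (Φ.contMDiff_time (-θ x) x))
      rw [hback]
      exact hφ
    refine (he.contMDiff.contMDiffAt.comp x hsm).congr_of_eventuallyEq ?_
    have h2 : Filter.Tendsto (Φ.toFun (-θ x)) (𝓝 x) (𝓝 (s (H x))) := by
      rw [← hback]
      exact (Φ.continuous_time (-θ x)).tendsto x
    filter_upwards [h2.eventually h1, h.isOpen.mem_nhds hx] with y hy hyU
    refine hunique y hyU _ ?_
    have h3 := hy.2
    rw [Φ.apply_hamiltonian hH] at h3
    rw [Φ.map_add, h3]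
    exact Φ.cancel_neg _ _
  · have h1 : e (θ (Φ.toFun t x)) = e (t + θ x) := by
      refine hunique _ (h.flow_mem hx t hH) _ ?_
      rw [Φ.apply_hamiltonian hH, Φ.map_add, hθ x hx]
    simp only [h1]
    simp only [e]
    rw [← Complex.exp_add]
    congr 1
    push_cast
    ring

/-- The linearization vanishes at w because w is fixed, and it is injective near w. The section
converges to w without meeting it, so it avoids the zero near that end. -/
theorem exists_pole {w : N} (hw : w ∈ closure U) (hwU : w ∉ U) : ∃ G : N → ℂ,
    ContMDiff (𝓡 2) 𝓘(ℝ, ℂ) ∞ G ∧ Bijective (mvfderiv (𝓡 2) G w) ∧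
    (∀ x ∈ U, ∀ t, G (Φ.toFun t x) =
      Complex.exp ((2 * Real.pi * t / τ : ℝ) * Complex.I) * G x) ∧
    ∀ᶠ c in 𝓝[Ioo a b] (H w), G (s c) ≠ 0 := by
  obtain ⟨G, hG, hbij, heq⟩ := Φ.exists_linearization h.isOpen hw (h.fixed hw hwU) h.pos
    (fun x hx ↦ h.apply_period hH (subset_closure hx)) (fun x hx t ht ↦ h.apply_ne hH hx ht)
  refine ⟨G, hG, hbij, fun x hx ↦ heq x (subset_closure hx), ?_⟩
  have hGw : G w = 0 := by
    have h1 := heq w hw (τ / 2)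
    have h2 : (2 * Real.pi * (τ / 2) / τ : ℝ) = Real.pi := by
      have := h.pos.ne'
      field_simp
    rw [h.fixed hw hwU, h2, Complex.exp_pi_mul_I, neg_one_mul] at h1
    exact self_eq_neg.1 h1
  obtain ⟨O, hO, hinj⟩ := eventually_injOn_of_bijective_mvfderiv hG hbij
  filter_upwards [h.tendsto_section hH hw hwU hO, self_mem_nhdsWithin] with c hc hcI h0
  have := hinj hc (mem_of_mem_nhds hO) (h0.trans hGw.symm)
  exact hwU (this ▸ h.section_mem hcI)

/-- An equivariant map is extended over a fixed point as a local diffeomorphism. -/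
theorem exists_extension {w : N} (hw : w ∈ closure U) (hwU : w ∉ U) {G₀ : N → ℂ}
    (hG₀ : ∀ x ∈ U, ContMDiffAt (𝓡 2) 𝓘(ℝ, ℂ) ∞ G₀ x)
    (heq₀ : ∀ x ∈ U, ∀ t, G₀ (Φ.toFun t x) =
      Complex.exp ((2 * Real.pi * t / τ : ℝ) * Complex.I) * G₀ x)
    (hne₀ : ∀ x ∈ U, G₀ x ≠ 0) : ∃ G : N → ℂ,
    (∀ x ∈ U, ContMDiffAt (𝓡 2) 𝓘(ℝ, ℂ) ∞ G x) ∧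
    (∀ x ∈ U, ∀ t, G (Φ.toFun t x) =
      Complex.exp ((2 * Real.pi * t / τ : ℝ) * Complex.I) * G x) ∧
    (∀ x ∈ U, G x ≠ 0) ∧ ContMDiffAt (𝓡 2) 𝓘(ℝ, ℂ) ∞ G w ∧ Bijective (mvfderiv (𝓡 2) G w) ∧
    ∀ x ∈ closure U, x ∉ U → x ≠ w → G =ᶠ[𝓝 x] G₀ := by
  obtain ⟨G₁, hG₁, hbij, heq₁, hne₁⟩ := h.exists_pole hH hw hwU
  have hab := h.lt
  have hwab := h.apply_eq_or_eq hH hw hwU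
  obtain ⟨r, hr, hball⟩ := Metric.mem_nhdsWithin_iff.1 hne₁
  -- The gluing takes place at levels about d away from H w: within the range r where G₁ has no
  -- zeros on the section, and short of the other end.
  let d := min (r / 2) ((b - a) / 2)
  have hd0 : 0 < d := lt_min (by linarith) (by linarith)
  have hd1 : d < r := (min_le_left _ _).trans_lt (by linarith)
  have hd2 : d < b - a := (min_le_right _ _).trans_lt (by linarith)
  obtain ⟨c₁, hc₁, hc₁d⟩ : ∃ c₁ ∈ Ioo a b, |c₁ - H w| = d := by
    rcases hwab with e | e
    · refine ⟨a + d, ⟨by linarith, by linarith⟩, ?_⟩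
      rw [e, add_sub_cancel_left, abs_of_pos hd0]
    · refine ⟨b - d, ⟨by linarith, by linarith⟩, ?_⟩
      rw [e, sub_sub_cancel_left, abs_neg, abs_of_pos hd0]
  have hG₁c₁ : G₁ (s c₁) ≠ 0 :=
    hball ⟨by rw [Metric.mem_ball, Real.dist_eq, hc₁d]; exact hd1, hc₁⟩
  have hG₀c₁ := hne₀ _ (h.section_mem hc₁)
  -- Normalizes the ratio of the two maps to 1 at s(c₁), so that near this level it keeps positive
  -- real part.
  let κ : ℂ := G₀ (s c₁) / G₁ (s c₁)
  have hκ : κ ≠ 0 := div_ne_zero hG₀c₁ hG₁c₁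
  have hratio : ∀ᶠ c in 𝓝 c₁, 0 < (κ * G₁ (s c) / G₀ (s c)).re := by
    have hs : ContinuousAt s c₁ := (h.contMDiffAt_section hc₁).continuousAt
    have h1 : ContinuousAt (fun c ↦ κ * G₁ (s c) / G₀ (s c)) c₁ := by
      refine ContinuousAt.div ?_ ?_ hG₀c₁
      · exact continuousAt_const.mul (hG₁.continuous.continuousAt.comp hs)
      · exact ContinuousAt.comp (g := G₀) (hG₀ _ (h.section_mem hc₁)).continuousAt hs
    refine (Complex.continuous_re.continuousAt.comp h1).eventually (Ioi_mem_nhds ?_)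
    have h2 : κ * G₁ (s c₁) / G₀ (s c₁) = 1 := by
      simp only [κ]
      field_simp
    simp only [comp_apply, h2]
    norm_num
  obtain ⟨δ, hδ, hδball⟩ := Metric.eventually_nhds_iff_ball.1 hratio
  -- The transition levels lie within ε of c₁: less than δ so that the ratio has positive real part
  -- there, less than d so that the glued map equals κ G₁ near w, and less than b - a - d so that it
  -- equals G₀ near the other end.
  let ε := min (δ / 2) (min (d / 2) (min ((r - d) / 2) ((b - a - d) / 2)))
  have hε0 : 0 < ε := lt_min (by linarith) (lt_min (by linarith) (lt_min (by linarith)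
    (by linarith)))
  have hε1 : ε < δ := (min_le_left _ _).trans_lt (by linarith)
  have hε2 : ε < d := ((min_le_right _ _).trans (min_le_left _ _)).trans_lt (by linarith)
  have hε3 : ε < r - d := (((min_le_right _ _).trans (min_le_right _ _)).trans
    (min_le_left _ _)).trans_lt (by linarith)
  have hε4 : ε < b - a - d := (((min_le_right _ _).trans (min_le_right _ _)).trans
    (min_le_right _ _)).trans_lt (by linarith)
  let f : ContDiffBump (H w) := ⟨d - ε, d + ε, by linarith, by linarith⟩
  have hf1 : ∀ c, |c - H w| ≤ d - ε → f c = 1 := fun c hc ↦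
    f.one_of_mem_closedBall (by rwa [Metric.mem_closedBall, Real.dist_eq])
  have hf0 : ∀ c, d + ε ≤ |c - H w| → f c = 0 := fun c hc ↦
    f.zero_of_le_dist (by rwa [Real.dist_eq])
  have hfs : ContMDiff (𝓡 2) 𝓘(ℝ, ℂ) ∞ (fun x ↦ ((f (H x) : ℝ) : ℂ)) :=
    (Complex.ofRealCLM.contDiff.comp f.contDiff).contMDiff.comp hH
  -- The weights depend only on H, so equivariance survives. On the section the interpolation is G₀
  -- times a convex combination of 1 and a number of positive real part, hence nonzero.
  let G : N → ℂ := fun x ↦ (1 - (f (H x) : ℂ)) * G₀ x + f (H x) * (κ * G₁ x)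
  have heq : ∀ x ∈ U, ∀ t, G (Φ.toFun t x) =
      Complex.exp ((2 * Real.pi * t / τ : ℝ) * Complex.I) * G x := by
    intro x hx t
    simp only [G]
    rw [heq₀ x hx, heq₁ x hx, Φ.apply_hamiltonian hH]
    ring
  have hsec : ∀ c ∈ Ioo a b, G (s c) ≠ 0 := by
    intro c hc
    have hHs : H (s c) = c := h.isSection.apply_eq c hc
    simp only [G, hHs]
    have hG₀c := hne₀ _ (h.section_mem hc)
    rcases le_total |c - H w| (d - ε) with h1 | h1
    · rw [hf1 c h1]
      have : G₁ (s c) ≠ 0 := hball ⟨by rw [Metric.mem_ball, Real.dist_eq]; linarith, hc⟩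
      simpa using ⟨hκ, this⟩
    rcases le_total (d + ε) |c - H w| with h2 | h2
    · rw [hf0 c h2]
      simpa using hG₀c
    have h3 : |c - c₁| ≤ ε := by
      rcases hwab with e | e
      · rw [e, abs_of_pos (by linarith [hc.1])] at h1 h2
        rw [e, abs_of_pos (by linarith [hc₁.1])] at hc₁d
        rw [abs_le]
        constructor <;> linarith
      · rw [e, abs_of_neg (by linarith [hc.2])] at h1 h2
        rw [e, abs_of_neg (by linarith [hc₁.2])] at hc₁d
        rw [abs_le]
        constructor <;> linarith
    have h4 := hδball c (by rw [Metric.mem_ball, Real.dist_eq]; linarith)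
    have h5 : (1 - (f c : ℂ)) * G₀ (s c) + f c * (κ * G₁ (s c)) =
        ((1 - f c : ℝ) + (f c : ℝ) * (κ * G₁ (s c) / G₀ (s c))) * G₀ (s c) := by
      push_cast
      field_simp
    rw [h5]
    refine mul_ne_zero (fun h0 ↦ ?_) hG₀c
    have h6 := congrArg Complex.re h0
    rw [Complex.add_re, Complex.ofReal_re, Complex.re_ofReal_mul, Complex.zero_re] at h6
    have h7 := f.nonneg (x := c)
    have h8 := f.le_one (x := c)
    rcases h7.eq_or_lt with h9 | h9
    · rw [← h9] at h6
      norm_num at h6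
    · nlinarith [mul_pos h9 h4]
  have hGw : G =ᶠ[𝓝 w] fun x ↦ (ContinuousLinearMap.mul ℝ ℂ κ) (G₁ x) := by
    have h1 : ∀ᶠ x in 𝓝 w, H x ∈ Metric.ball (H w) (d - ε) :=
      hH.continuous.continuousAt.eventually (Metric.ball_mem_nhds _ (by linarith))
    filter_upwards [h1] with x hx
    rw [Metric.mem_ball, Real.dist_eq] at hx
    simp only [G, hf1 _ hx.le, Complex.ofReal_one, sub_self, zero_mul, zero_add, one_mul]
    rfl
  refine ⟨G, fun x hx ↦ ?_, heq, fun x hx ↦ ?_, ?_, ?_, fun x hx hxU hxw ↦ ?_⟩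
  · have hmul : ∀ {p q : N → ℂ}, ContMDiffAt (𝓡 2) 𝓘(ℝ, ℂ) ∞ p x →
        ContMDiffAt (𝓡 2) 𝓘(ℝ, ℂ) ∞ q x → ContMDiffAt (𝓡 2) 𝓘(ℝ, ℂ) ∞ (fun y ↦ p y * q y) x :=
      fun hp hq ↦ (contDiff_mul (𝕜 := ℝ) (𝔸 := ℂ)).contMDiff.contMDiffAt.comp x (hp.prodMk_space hq)
    exact (hmul (contMDiffAt_const.sub (hfs x)) (hG₀ x hx)).add
      (hmul (hfs x) (hmul contMDiffAt_const (hG₁ x)))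
  · obtain ⟨t, -, ht⟩ := h.exists_time_section hH hx
    have hc := ((h.mem_iff x).1 hx).1
    rw [← ht, heq _ (h.section_mem hc)]
    exact mul_ne_zero (Complex.exp_ne_zero _) (hsec _ hc)
  · exact ((ContinuousLinearMap.mul ℝ ℂ κ).contDiff.contMDiff.comp hG₁).contMDiffAt
      |>.congr_of_eventuallyEq hGw
  · have h1 : ⇑(mvfderiv (𝓡 2) G w) = (fun z ↦ κ * z) ∘ mvfderiv (𝓡 2) G₁ w := by
      funext v
      have h2 := hGw.mfderiv_eq (I := 𝓡 2) (I' := 𝓘(ℝ, ℂ))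
      refine (DFunLike.congr_fun h2 v).trans ?_
      exact mvfderiv_clm_comp (ContinuousLinearMap.mul ℝ ℂ κ) (hG₁.mdifferentiable (by simp) w) v
    rw [h1]
    exact (mulLeft_bijective₀ κ hκ).comp hbij
  · have hne : H x ≠ H w := fun e ↦ hxw (h.eq_of_apply_eq hH hx hxU hw hwU e)
    have h1 : |H x - H w| = b - a := by
      rcases h.apply_eq_or_eq hH hx hxU with e | e <;> rcases hwab with e' | e'
      · exact absurd (e.trans e'.symm) hne
      · rw [e, e', abs_of_neg (by linarith)]
        ring
      · rw [e, e', abs_of_pos (by linarith)]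
      · exact absurd (e.trans e'.symm) hne
    have h2 : ∀ᶠ y in 𝓝 x, d + ε < |H y - H w| := by
      have h3 : Continuous (fun y ↦ |H y - H w|) := (hH.continuous.sub continuous_const).abs
      refine h3.continuousAt.eventually (Ioi_mem_nhds ?_)
      change d + ε < |H x - H w|
      rw [h1]
      linarith
    filter_upwards [h2] with y hy
    simp only [G, hf0 _ hy.le, Complex.ofReal_zero, sub_zero, one_mul, zero_mul, add_zero]

/-- An equivariant map to the plane that vanishes only at the two fixed points, where it is a
local diffeomorphism. -/
theorem exists_equivariant {zmax zmin : N} (hmax : zmax ∉ U) (hmin : zmin ∉ U)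
    (hne : zmax ≠ zmin) (huniv : insert zmax (insert zmin U) = univ) (hcl : closure U = univ) :
    ∃ G : N → ℂ, ContMDiff (𝓡 2) 𝓘(ℝ, ℂ) ∞ G ∧
      (∀ x t, G (Φ.toFun t x) = Complex.exp ((2 * Real.pi * t / τ : ℝ) * Complex.I) * G x) ∧
      (∀ x ∈ U, G x ≠ 0) ∧ G zmax = 0 ∧ G zmin = 0 ∧ Bijective (mvfderiv (𝓡 2) G zmax) ∧
      Bijective (mvfderiv (𝓡 2) G zmin) := by
  obtain ⟨G₀, h1, h2, h3⟩ := h.exists_phase hH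
  have hcl' : ∀ x, x ∈ closure U := fun x ↦ hcl ▸ mem_univ x
  -- Extension over the minimum first, then over the maximum; the second step leaves the map
  -- unchanged near the minimum.
  obtain ⟨G₁, g1, g2, g3, g4, g5, -⟩ := h.exists_extension hH (hcl' zmin) hmin h1 h2 h3
  obtain ⟨G, f1, f2, f3, f4, f5, f6⟩ := h.exists_extension hH (hcl' zmax) hmax g1 g2 g3
  have hmin' := f6 zmin (hcl' zmin) hmin hne.symm
  have hG : ContMDiff (𝓡 2) 𝓘(ℝ, ℂ) ∞ G := by
    intro x
    have hx : x ∈ insert zmax (insert zmin U) := huniv ▸ mem_univ x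
    rcases hx with rfl | rfl | hx
    · exact f4
    · exact g4.congr_of_eventuallyEq hmin'
    · exact f1 x hx
  have heq : ∀ x t, G (Φ.toFun t x) =
      Complex.exp ((2 * Real.pi * t / τ : ℝ) * Complex.I) * G x := by
    intro x t
    refine closure_minimal (s := U) (t := {x | G (Φ.toFun t x) =
      Complex.exp ((2 * Real.pi * t / τ : ℝ) * Complex.I) * G x}) (fun y hy ↦ f2 y hy t)
      (isClosed_eq (hG.continuous.comp (Φ.continuous_time t))
        (continuous_const.mul hG.continuous)) (hcl' x)
  have hzero : ∀ w ∉ U, G w = 0 := by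
    intro w hwU
    have h1 := heq w (τ / 2)
    have h2 : (2 * Real.pi * (τ / 2) / τ : ℝ) = Real.pi := by
      have := h.pos.ne'
      field_simp
    rw [h.fixed (hcl' w) hwU, h2, Complex.exp_pi_mul_I, neg_one_mul] at h1
    exact self_eq_neg.1 h1
  refine ⟨G, hG, heq, f3, hzero _ hmax, hzero _ hmin, f5, ?_⟩
  have h4 : mfderiv (𝓡 2) 𝓘(ℝ, ℂ) G zmin = mfderiv (𝓡 2) 𝓘(ℝ, ℂ) G₁ zmin := hmin'.mfderiv_eq
  have h5 : ⇑(mvfderiv (𝓡 2) G zmin) = ⇑(mvfderiv (𝓡 2) G₁ zmin) :=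
    funext fun v ↦ DFunLike.congr_fun h4 v
  rw [h5]
  exact g5

end SmoothFlow.IsResonantFamily

end EquivariantMaps

/-! ### One-variable profiles of the sphere. -/

section Profiles

/-- A derivative without zeros has constant sign by Darboux's theorem. A negative sign would make
the positive function v decreasing, against its limit 0 at a. -/
theorem deriv_pos_of_tendsto_zero {v : ℝ → ℝ} {a b : ℝ}
    (hv : ∀ c ∈ Ioo a b, DifferentiableAt ℝ v c) (hpos : ∀ c ∈ Ioo a b, 0 < v c)
    (hne : ∀ c ∈ Ioo a b, deriv v c ≠ 0) (ht : Filter.Tendsto v (𝓝[>] a) (𝓝 0)) :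
    ∀ c ∈ Ioo a b, 0 < deriv v c := by
  rcases hasDerivWithinAt_forall_lt_or_forall_gt_of_forall_ne (convex_Ioo a b)
    (fun c hc ↦ (hv c hc).hasDerivAt.hasDerivWithinAt) hne with h | h
  · intro c hc
    exfalso
    have hanti : StrictAntiOn v (Ioo a b) := by
      refine strictAntiOn_of_deriv_neg (convex_Ioo a b)
        (fun c hc ↦ (hv c hc).continuousAt.continuousWithinAt) ?_
      rwa [interior_Ioo]
    refine absurd (ge_of_tendsto ht ?_) (not_le.2 (hpos c hc))
    filter_upwards [Ioo_mem_nhdsGT hc.1] with c' hc'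
    exact (hanti ⟨hc'.1, hc'.2.trans hc.2⟩ hc hc'.2).le
  · exact h

/-- A height function compatible with a given radial profile. -/
theorem exists_height {v : ℝ → ℝ} {a b : ℝ} (hab : a < b)
    (hv : ∀ c ∈ Ioo a b, ContDiffAt ℝ ∞ v c) (hpos : ∀ c ∈ Ioo a b, 0 < v c)
    (hna : ∀ᶠ c in 𝓝[>] a, deriv v c ≠ 0) (hnb : ∀ᶠ c in 𝓝[<] b, deriv v c ≠ 0)
    (hta : Filter.Tendsto v (𝓝[>] a) (𝓝 0)) (htb : Filter.Tendsto v (𝓝[<] b) (𝓝 0)) :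
    ∃ K : ℝ → ℝ, ContDiff ℝ ∞ K ∧ K a < 0 ∧ 0 < K b ∧
      ∀ c ∈ Ioo a b, K c * deriv v c < 2 * deriv K c * v c := by
  have hdiff : ∀ c ∈ Ioo a b, DifferentiableAt ℝ v c := fun c hc ↦
    (hv c hc).differentiableAt (by simp)
  let m := (a + b) / 2
  have ham : a < m := by simp only [m]; linarith
  have hmb : m < b := by simp only [m]; linarith
  obtain ⟨a₁, ha₁, hpa⟩ : ∃ a₁ ∈ Ioc a m, ∀ c ∈ Ioo a a₁, 0 < deriv v c := by
    obtain ⟨a', ha', hI⟩ := mem_nhdsGT_iff_exists_Ioo_subset.1 hna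
    refine ⟨min a' m, ⟨lt_min ha' ham, min_le_right _ _⟩, ?_⟩
    have hsub : ∀ c ∈ Ioo a (min a' m), c ∈ Ioo a b ∧ c ∈ Ioo a a' := fun c hc ↦
      ⟨⟨hc.1, (hc.2.trans_le (min_le_right _ _)).trans hmb⟩,
        ⟨hc.1, hc.2.trans_le (min_le_left _ _)⟩⟩
    exact deriv_pos_of_tendsto_zero (fun c hc ↦ hdiff c (hsub c hc).1)
      (fun c hc ↦ hpos c (hsub c hc).1) (fun c hc ↦ hI (hsub c hc).2) hta
  obtain ⟨b₁, hb₁, hpb⟩ : ∃ b₁ ∈ Ico m b, ∀ c ∈ Ioo b₁ b, deriv v c < 0 := by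
    obtain ⟨b', hb', hI⟩ := mem_nhdsLT_iff_exists_Ioo_subset.1 hnb
    refine ⟨max b' m, ⟨le_max_right _ _, max_lt hb' hmb⟩, fun c hc ↦ ?_⟩
    have hsub : ∀ c ∈ Ioo (-b) (-max b' m), -c ∈ Ioo a b ∧ -c ∈ Ioo b' b := fun c hc ↦ by
      have h1 := le_max_right b' m
      have h2 := le_max_left b' m
      exact ⟨⟨by linarith [hc.2], by linarith [hc.1]⟩, ⟨by linarith [hc.2], by linarith [hc.1]⟩⟩
    have key := deriv_pos_of_tendsto_zero (v := fun c ↦ v (-c)) (a := -b) (b := -max b' m)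
      (fun c hc ↦ (hdiff _ (hsub c hc).1).comp c differentiableAt_id.neg)
      (fun c hc ↦ hpos _ (hsub c hc).1)
      (fun c hc ↦ by
        rw [deriv_comp_neg]
        exact neg_ne_zero.2 (hI (hsub c hc).2))
      (htb.comp (tendsto_neg_nhdsGT_neg (a := b))) (-c) ⟨by linarith [hc.2], by linarith [hc.1]⟩
    rw [deriv_comp_neg, neg_neg] at key
    linarith
  have hsub : ∀ c ∈ Icc a₁ b₁, c ∈ Ioo a b := fun c hc ↦
    ⟨ha₁.1.trans_le hc.1, hc.2.trans_lt hb₁.2⟩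
  obtain ⟨C, hC⟩ := isCompact_Icc.exists_bound_of_continuousOn (s := Icc a₁ b₁)
    (f := fun c ↦ deriv v c / (2 * v c)) (fun c hc ↦ by
      have h1 : ContinuousAt (fun c ↦ fderiv ℝ v c 1) c :=
        ((hv c (hsub c hc)).fderiv_right (m := 0) (by simp)).continuousAt.clm_apply
          continuousAt_const
      exact (h1.div (continuousAt_const.mul (hdiff c (hsub c hc)).continuousAt)
        (mul_ne_zero two_ne_zero (hpos c (hsub c hc)).ne')).continuousWithinAt)
  -- On the compact middle part M dominates |v'| / (2v); for K = sinh(M(c - m)) the inequality then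
  -- reduces to |sinh| < cosh.
  let M := max C 1
  have hM : 0 < M := lt_max_of_lt_right one_pos
  have hK : ∀ c, HasDerivAt (fun c ↦ Real.sinh (M * (c - m))) (M * Real.cosh (M * (c - m))) c := by
    intro c
    have h1 : HasDerivAt (fun c ↦ M * (c - m)) (M * 1) c :=
      ((hasDerivAt_id c).sub_const m).const_mul M
    have h2 := h1.sinh
    rwa [mul_one, mul_comm] at h2
  refine ⟨fun c ↦ Real.sinh (M * (c - m)), ?_, ?_, ?_, fun c hc ↦ ?_⟩
  · exact Real.contDiff_sinh.comp (contDiff_const.mul (contDiff_id.sub contDiff_const))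
  · exact Real.sinh_neg_iff.2 (mul_neg_of_pos_of_neg hM (by linarith))
  · exact Real.sinh_pos_iff.2 (mul_pos hM (by linarith))
  · rw [(hK c).deriv]
    have hch := Real.cosh_pos (M * (c - m))
    have hvc := hpos c hc
    have hrhs : 0 < 2 * (M * Real.cosh (M * (c - m))) * v c := by positivity
    -- Near a, K is negative while v increases; near b, K is positive while v decreases. In both
    -- cases the left side is negative.
    rcases lt_or_ge c a₁ with h1 | h1
    · have h2 := hpa c ⟨hc.1, h1⟩
      have h3 : Real.sinh (M * (c - m)) < 0 :=
        Real.sinh_neg_iff.2 (mul_neg_of_pos_of_neg hM (by linarith [ha₁.2]))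
      exact (mul_neg_of_neg_of_pos h3 h2).trans hrhs
    rcases lt_or_ge b₁ c with h2 | h2
    · have h3 := hpb c ⟨h2, hc.2⟩
      have h4 : 0 < Real.sinh (M * (c - m)) :=
        Real.sinh_pos_iff.2 (mul_pos hM (by linarith [hb₁.1]))
      exact (mul_neg_of_pos_of_neg h4 h3).trans hrhs
    · have h3 := (hC c ⟨h1, h2⟩).trans (le_max_left C 1)
      rw [Real.norm_eq_abs, abs_div, abs_of_pos (by positivity : 0 < 2 * v c),
        div_le_iff₀ (by positivity)] at h3
      have h4 : |Real.sinh (M * (c - m))| < Real.cosh (M * (c - m)) := by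
        rw [Real.abs_sinh, ← Real.cosh_abs]
        exact Real.sinh_lt_cosh _
      calc Real.sinh (M * (c - m)) * deriv v c ≤ |Real.sinh (M * (c - m))| * |deriv v c| := by
            rw [← abs_mul]
            exact le_abs_self _
        _ ≤ |Real.sinh (M * (c - m))| * (M * (2 * v c)) :=
            mul_le_mul_of_nonneg_left h3 (abs_nonneg _)
        _ < Real.cosh (M * (c - m)) * (M * (2 * v c)) :=
            mul_lt_mul_of_pos_right h4 (by positivity)
        _ = _ := by ring

/-- The hypothesis is exactly positivity of the derivative. Geometrically, the profile curve (√v, K)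
crosses each ray from the origin at most once. -/
theorem strictMonoOn_div_sqrt {v K : ℝ → ℝ} {a b : ℝ}
    (hv : ∀ c ∈ Ioo a b, DifferentiableAt ℝ v c) (hpos : ∀ c ∈ Ioo a b, 0 < v c)
    (hK : Differentiable ℝ K)
    (h : ∀ c ∈ Ioo a b, K c * deriv v c < 2 * deriv K c * v c) :
    StrictMonoOn (fun c ↦ K c / √(v c)) (Ioo a b) := by
  have hd : ∀ c ∈ Ioo a b, HasDerivAt (fun c ↦ K c / √(v c))
      ((deriv K c * √(v c) - K c * (deriv v c / (2 * √(v c)))) / √(v c) ^ 2) c := fun c hc ↦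
    (hK c).hasDerivAt.div ((hv c hc).hasDerivAt.sqrt (hpos c hc).ne')
      (Real.sqrt_pos.2 (hpos c hc)).ne'
  refine strictMonoOn_of_deriv_pos (convex_Ioo a b)
    (fun c hc ↦ (hd c hc).continuousAt.continuousWithinAt) fun c hc ↦ ?_
  rw [interior_Ioo] at hc
  have hs := Real.sqrt_pos.2 (hpos c hc)
  rw [(hd c hc).deriv]
  refine div_pos ?_ (by positivity)
  have h1 : deriv K c * √(v c) - K c * (deriv v c / (2 * √(v c))) =
      (2 * deriv K c * v c - K c * deriv v c) / (2 * √(v c)) := by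
    have := Real.mul_self_sqrt (hpos c hc).le
    field_simp
    rw [Real.sq_sqrt (hpos c hc).le]
    ring
  rw [h1]
  exact div_pos (by linarith [h c hc]) (by positivity)

end Profiles

/-! ### Recognition of the sphere. -/

section SphereRecognition

variable {N : Type*} [TopologicalSpace N] [ChartedSpace (EuclideanSpace ℝ (Fin 2)) N]
  [IsManifold (𝓡 2) ∞ N]

theorem ContMDiff.eventually_surjective {G : N → ℂ} (hG : ContMDiff (𝓡 2) 𝓘(ℝ, ℂ) ∞ G) {w : N}
    (hbij : Bijective (mvfderiv (𝓡 2) G w)) : ∀ᶠ y in 𝓝 w, Surjective (mvfderiv (𝓡 2) G y) := by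
  obtain ⟨g, hg, hgG, hGg⟩ := (hG w).exists_local_inverse (by simp) hbij
  have : IsManifold (𝓡 2) 1 N := IsManifold.of_le (m := 1) (n := ∞) (by simp)
  have h1 : ContMDiffAt 𝓘(ℝ, ℂ) (𝓡 2) 1 g (G w) := hg.of_le (by simp)
  have h2 := (contMDiffAt_iff_contMDiffAt_nhds (by simp)).1 h1
  have h3 := hG.continuous.continuousAt.eventually (h2.and hGg.eventually_nhds)
  filter_upwards [h3, hgG] with y ⟨hy, hy'⟩ hgy
  have hd := (hG.mdifferentiable (by simp) (g (G y))).hasMFDerivAt.comp (G y)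
    (hy.mdifferentiableAt (by simp)).hasMFDerivAt
  have hid : HasMFDerivAt 𝓘(ℝ, ℂ) 𝓘(ℝ, ℂ) (G ∘ g) (G y) (ContinuousLinearMap.id ℝ ℂ) :=
    (hasMFDerivAt_id (I := 𝓘(ℝ, ℂ)) (G y)).congr_of_eventuallyEq hy'
  have heq := hasMFDerivAt_unique hd hid
  have h4 : ∀ y', y' = y → (∀ z : ℂ, ∃ v, mvfderiv (𝓡 2) G y' v = z) →
      Surjective (mvfderiv (𝓡 2) G y) := by
    rintro _ rfl h
    exact h
  exact h4 _ hgy fun z ↦ ⟨mfderiv 𝓘(ℝ, ℂ) (𝓡 2) g (G y) z, DFunLike.congr_fun heq z⟩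

omit [IsManifold (𝓡 2) ∞ N] in
theorem mvfderiv_normSq_comp {G : N → ℂ} {x : N} (hG : MDifferentiableAt (𝓡 2) 𝓘(ℝ, ℂ) G x)
    (v : TangentSpace (𝓡 2) x) :
    mvfderiv (𝓡 2) (fun y ↦ ‖G y‖ ^ 2) x v = 2 * inner ℝ (G x) (mvfderiv (𝓡 2) G x v) := by
  have h1 := ((hasStrictFDerivAt_norm_sq (G x)).hasFDerivAt.hasMFDerivAt).comp x hG.hasMFDerivAt
  refine (DFunLike.congr_fun h1.mfderiv v).trans ?_
  change (2 • innerSL ℝ (G x)) (mvfderiv (𝓡 2) G x v) = _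
  rw [smul_apply, innerSL_apply_apply, nsmul_eq_mul, Nat.cast_ofNat]

theorem SymplecticForm.exists_smul_hamiltonianVectorField (Ω : SymplecticForm N) {H : N → ℝ} {x : N}
    (hx : x ∈ regularSet H) {v : TangentSpace (𝓡 2) x} (hv : mvfderiv (𝓡 2) H x v = 0) :
    ∃ c : ℝ, v = c • Ω.hamiltonianVectorField H x := by
  obtain ⟨u, hu⟩ : ∃ u, mvfderiv (𝓡 2) H x u ≠ 0 := by
    by_contra hcon
    push Not at hcon
    exact hx (ContinuousLinearMap.ext hcon)
  have h1 := Ω.cramer x (Ω.hamiltonianVectorField H x) u v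
    (by rw [Ω.form_hamiltonianVectorField_left]; exact neg_ne_zero.2 hu)
  rw [Ω.form_hamiltonianVectorField_left H x v, hv, neg_zero, zero_div, zero_smul, add_zero] at h1
  exact ⟨_, h1⟩

variable [T2Space N] {Ω : SymplecticForm N} {H : N → ℝ}

omit [T2Space N] in
theorem SmoothFlow.mvfderiv_of_equivariant (Φ : SmoothFlow (Ω.hamiltonianVectorField H))
    {G : N → ℂ} (hG : ContMDiff (𝓡 2) 𝓘(ℝ, ℂ) ∞ G) {τ : ℝ}
    (heq : ∀ x t, G (Φ.toFun t x) = Complex.exp ((2 * Real.pi * t / τ : ℝ) * Complex.I) * G x)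
    (x : N) : mvfderiv (𝓡 2) G x (Ω.hamiltonianVectorField H x) =
      ((2 * Real.pi / τ : ℝ) * Complex.I) * G x := by
  have h1 := (Φ.isMIntegralCurve x 0).hasDerivAt_comp (hG.mdifferentiable (by simp) _)
  have h2 : HasDerivAt (fun t : ℝ ↦ Complex.exp ((2 * Real.pi * t / τ : ℝ) * Complex.I) * G x)
      (((2 * Real.pi / τ : ℝ) * Complex.I) * G x) 0 := by
    have h3 : HasDerivAt (fun t : ℝ ↦ 2 * Real.pi * t / τ) (2 * Real.pi / τ) 0 := by
      have := ((hasDerivAt_id (0 : ℝ)).const_mul (2 * Real.pi)).div_const τ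
      rwa [mul_one] at this
    have h4 := ((h3.ofReal_comp.mul_const Complex.I).cexp).mul_const (G x)
    simpa using h4
  simp only [heq] at h1
  have h5 : ∀ y, y = x → mvfderiv (𝓡 2) G y (Ω.hamiltonianVectorField H y) =
      ((2 * Real.pi / τ : ℝ) * Complex.I) * G x → mvfderiv (𝓡 2) G x
        (Ω.hamiltonianVectorField H x) = ((2 * Real.pi / τ : ℝ) * Complex.I) * G x := by
    rintro _ rfl h
    exact h
  exact h5 _ (Φ.map_zero x) (h1.unique h2)

namespace SmoothFlow.IsResonantFamily

variable {Φ : SmoothFlow (Ω.hamiltonianVectorField H)} {Y : TransversalField H}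
  {U : Set N} {s : ℝ → N} {a b τ : ℝ} (h : Φ.IsResonantFamily Y U s a b τ)
  (hH : ContMDiff (𝓡 2) 𝓘(ℝ, ℝ) ∞ H)

include h hH

/-- A surface filled by a resonant family and two fixed points is a sphere. -/
theorem nonempty_diffeomorph_sphere (hproper : IsProperMap H) {zmax zmin : N} (hb : H zmax = b)
    (ha : H zmin = a) (hmax : zmax ∉ U) (hmin : zmin ∉ U)
    (huniv : insert zmax (insert zmin U) = univ) (hcl : closure U = univ)
    {G : N → ℂ} (hG : ContMDiff (𝓡 2) 𝓘(ℝ, ℂ) ∞ G)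
    (heq : ∀ x t, G (Φ.toFun t x) = Complex.exp ((2 * Real.pi * t / τ : ℝ) * Complex.I) * G x)
    (hne : ∀ x ∈ U, G x ≠ 0) (h0max : G zmax = 0) (h0min : G zmin = 0)
    (hbmax : Bijective (mvfderiv (𝓡 2) G zmax)) (hbmin : Bijective (mvfderiv (𝓡 2) G zmin)) :
    Nonempty (N ≃ₘ^∞⟮𝓡 2, 𝓡 2⟯ Metric.sphere (0 : EuclideanSpace ℝ (Fin 3)) 1) := by
  have hcases : ∀ x, x = zmax ∨ x = zmin ∨ x ∈ U := fun x ↦ by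
    have hx : x ∈ insert zmax (insert zmin U) := huniv ▸ mem_univ x
    exact hx
  have hcl' : ∀ x, x ∈ closure U := fun x ↦ hcl ▸ mem_univ x
  -- By equivariance |G| is constant on orbits, so on U its square is the function v of H alone.
  let v : ℝ → ℝ := fun c ↦ ‖G (s c)‖ ^ 2
  have hv : ∀ c ∈ Ioo a b, ContDiffAt ℝ ∞ v c := fun c hc ↦
    ((contDiff_norm_sq ℝ).contMDiff.contMDiffAt.comp c
      ((hG (s c)).comp c (h.contMDiffAt_section hc))).contDiffAt
  have hpos : ∀ c ∈ Ioo a b, 0 < v c := fun c hc ↦ by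
    have := hne _ (h.section_mem hc)
    positivity
  have hnorm : ∀ x ∈ U, ‖G x‖ ^ 2 = v (H x) := by
    intro x hx
    obtain ⟨t, -, ht⟩ := h.exists_time_section hH hx
    simp only [v]
    conv_lhs => rw [← ht, heq, norm_mul, Complex.norm_exp_ofReal_mul_I, one_mul]
  have hdv : ∀ x ∈ U, ∀ u : TangentSpace (𝓡 2) x, 2 * inner ℝ (G x) (mvfderiv (𝓡 2) G x u) =
      deriv v (H x) * mvfderiv (𝓡 2) H x u := by
    intro x hx u
    rw [← mvfderiv_normSq_comp (hG.mdifferentiable (by simp) x)]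
    have hc := ((h.mem_iff x).1 hx).1
    have h1 : (fun y ↦ ‖G y‖ ^ 2) =ᶠ[𝓝 x] v ∘ H := by
      filter_upwards [h.isOpen.mem_nhds hx] with y hy using hnorm y hy
    have h2 := (((hv _ hc).differentiableAt (by simp)).hasDerivAt.hasFDerivAt.hasMFDerivAt.comp x
      (hH.mdifferentiable (by simp) x).hasMFDerivAt).congr_of_eventuallyEq h1
    refine (DFunLike.congr_fun h2.mfderiv u).trans ?_
    exact mul_comm (mvfderiv (𝓡 2) H x u) _
  have hdv0 : ∀ w, w ∉ U → G w = 0 → Bijective (mvfderiv (𝓡 2) G w) →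
      (∀ᶠ c in 𝓝[Ioo a b] (H w), deriv v c ≠ 0) ∧
        Filter.Tendsto v (𝓝[Ioo a b] (H w)) (𝓝 0) := by
    intro w hwU hw0 hwbij
    have ht := h.tendsto_section hH (hcl' w) hwU
    constructor
    -- Near a pole dG is still surjective, so some tangent vector is sent to G itself. It changes
    -- |G|² to first order, which forces v' ≠ 0.
    · filter_upwards [ht.eventually (hG.eventually_surjective hwbij), self_mem_nhdsWithin]
        with c hc hcI h0
      have hcU := h.section_mem hcI
      obtain ⟨u, hu⟩ := hc (G (s c))
      have h1 := hdv _ hcU u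
      rw [hu, h.isSection.apply_eq c hcI, h0, zero_mul, real_inner_self_eq_norm_sq] at h1
      have := hne _ hcU
      have h2 : 0 < ‖G (s c)‖ ^ 2 := by positivity
      linarith
    · have h1 : Filter.Tendsto (fun y ↦ ‖G y‖ ^ 2) (𝓝 w) (𝓝 0) := by
        have h2 : Filter.Tendsto (fun y ↦ ‖G y‖ ^ 2) (𝓝 w) (𝓝 (‖G w‖ ^ 2)) :=
          (hG.continuous.norm.pow 2).tendsto w
        rwa [hw0, norm_zero, zero_pow two_ne_zero] at h2
      exact h1.comp ht
  have ea : 𝓝[Ioo a b] a = 𝓝[>] a := nhdsWithin_Ioo_eq_nhdsGT h.lt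
  have eb : 𝓝[Ioo a b] b = 𝓝[<] b := nhdsWithin_Ioo_eq_nhdsLT h.lt
  have hva := hdv0 zmin hmin h0min hbmin
  have hvb := hdv0 zmax hmax h0max hbmax
  rw [ha, ea] at hva
  rw [hb, eb] at hvb
  obtain ⟨K, hK, hKa, hKb, hKv⟩ := exists_height h.lt hv hpos hva.1 hvb.1 hva.2 hvb.2
  have hKd : Differentiable ℝ K := hK.differentiable (by simp)
  have hmono := strictMonoOn_div_sqrt (fun c hc ↦ (hv c hc).differentiableAt (by simp)) hpos hKd hKv
  let L : (ℂ × ℝ) ≃L[ℝ] EuclideanSpace ℝ (Fin 3) := ContinuousLinearEquiv.ofFinrankEq (by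
    rw [Module.finrank_prod, Complex.finrank_real_complex, Module.finrank_self,
      finrank_euclideanSpace_fin])
  have hKH : ContMDiff (𝓡 2) 𝓘(ℝ, ℝ) ∞ (fun x ↦ K (H x)) := hK.contMDiff.comp hH
  -- The candidate map to three-space: G as horizontal part and K ∘ H as height.
  have hP : ContMDiff (𝓡 2) 𝓘(ℝ, ℂ × ℝ) ∞ (fun x ↦ (G x, K (H x))) := hG.prodMk_space hKH
  have hcompact : CompactSpace N := by
    refine ⟨?_⟩
    have h1 : (univ : Set N) = H ⁻¹' Icc a b :=
      (eq_univ_of_forall fun x ↦ h.apply_mem_Icc hH (hcl' x)).symm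
    rw [h1]
    exact hproper.isCompact_preimage isCompact_Icc
  have : Nonempty N := ⟨zmax⟩
  refine ContMDiff.nonempty_diffeomorph_sphere (A := fun x ↦ L (G x, K (H x)))
    (L.contDiff.contMDiff.comp hP) (fun x hx ↦ ?_) (fun x y μ hμ hxy ↦ ?_) (fun x u l hu ↦ ?_)
  · have h1 : (G x, K (H x)) = 0 := L.map_eq_zero_iff.1 hx
    obtain ⟨h2, h3⟩ := Prod.mk_eq_zero.1 h1
    rcases hcases x with rfl | rfl | hxU
    · rw [hb] at h3
      exact hKb.ne' h3
    · rw [ha] at h3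
      exact hKa.ne h3
    · exact hne x hxU h2
  · rw [← map_smul] at hxy
    obtain ⟨h1, h2⟩ := Prod.mk.inj (L.injective hxy)
    change G x = μ • G y at h1
    change K (H x) = μ * K (H y) at h2
    by_cases hyU : y ∈ U
    · have hxU : x ∈ U := by
        have h3 : G x ≠ 0 := by
          rw [h1]
          exact smul_ne_zero hμ.ne' (hne y hyU)
        rcases hcases x with rfl | rfl | hxU
        · exact absurd h0max h3
        · exact absurd h0min h3
        · exact hxU
      have hcx := ((h.mem_iff x).1 hxU).1
      have hcy := ((h.mem_iff y).1 hyU).1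
      -- Points on a common ray have the same value of K/√v, hence the same level; this gives μ = 1,
      -- and equality of the phases identifies the points.
      have hvx : √(v (H x)) = μ * √(v (H y)) := by
        rw [← hnorm x hxU, ← hnorm y hyU, Real.sqrt_sq (norm_nonneg _),
          Real.sqrt_sq (norm_nonneg _), h1, norm_smul, Real.norm_eq_abs, abs_of_pos hμ]
      have hHxy : H x = H y := by
        refine hmono.injOn hcx hcy ?_
        rw [h2, hvx, mul_div_mul_left _ _ hμ.ne']
      have hμ1 : μ = 1 := by
        rw [hHxy] at hvx
        have := Real.sqrt_pos.2 (hpos _ hcy)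
        exact (mul_right_cancel₀ this.ne' ((one_mul _).trans hvx)).symm
      rw [hμ1, one_smul] at h1
      obtain ⟨t, -, ht⟩ := h.exists_time_section hH hxU
      obtain ⟨t', -, ht'⟩ := h.exists_time_section hH hyU
      rw [hHxy] at ht
      have key : ∀ c ∈ Ioo a b, Φ.toFun t (s c) = x → Φ.toFun t' (s c) = y → x = y := by
        rintro c hc rfl rfl
        rw [heq, heq] at h1
        have hsU := h.section_mem hc
        exact h.apply_eq_of_exp_eq_exp hH hsU (mul_right_cancel₀ (hne _ hsU) h1)
      exact key _ hcy ht ht'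
    · have hGy : G y = 0 := by
        rcases hcases y with rfl | rfl | hy
        · exact h0max
        · exact h0min
        · exact absurd hy hyU
      have hxU : x ∉ U := fun hx ↦ hne x hx (by rw [h1, hGy, smul_zero])
      rcases hcases x with rfl | rfl | hx <;> rcases hcases y with rfl | rfl | hy
      · rfl
      · rw [ha, hb] at h2
        nlinarith [mul_neg_of_pos_of_neg hμ hKa]
      · exact absurd hy hyU
      · rw [ha, hb] at h2
        nlinarith [mul_pos hμ hKb]
      · rfl
      · exact absurd hy hyU
      all_goals exact absurd hx hxU
  · have h1 : mvfderiv (𝓡 2) (fun x ↦ L (G x, K (H x))) x u =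
        L (mvfderiv (𝓡 2) G x u, deriv K (H x) * mvfderiv (𝓡 2) H x u) := by
      have h2 := (((hKd (H x)).hasDerivAt.hasFDerivAt.hasMFDerivAt).comp x
        (hH.mdifferentiable (by simp) x).hasMFDerivAt)
      have hPx := hP.mdifferentiable (by simp) x
      have h3 := mvfderiv_clm_comp (ContinuousLinearMap.fst ℝ ℂ ℝ) hPx u
      have h4 := mvfderiv_clm_comp (ContinuousLinearMap.snd ℝ ℂ ℝ) hPx u
      have h5 := (DFunLike.congr_fun h2.mfderiv u).trans (mul_comm (mvfderiv (𝓡 2) H x u) _)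
      refine (mvfderiv_clm_comp (L : (ℂ × ℝ) →L[ℝ] EuclideanSpace ℝ (Fin 3))
        hPx u).trans ?_
      exact congrArg L (Prod.ext h3.symm (h4.symm.trans h5))
    rw [h1, ← map_smul] at hu
    obtain ⟨h2, h3⟩ := Prod.mk.inj (L.injective hu)
    change mvfderiv (𝓡 2) G x u = l • G x at h2
    change deriv K (H x) * mvfderiv (𝓡 2) H x u = l * K (H x) at h3
    by_cases hxU : x ∈ U
    · have hc := ((h.mem_iff x).1 hxU).1
      have h4 := hdv x hxU u
      rw [h2, real_inner_smul_right, real_inner_self_eq_norm_sq, hnorm x hxU] at h4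
      -- Eliminating l between the horizontal and vertical parts leaves the nonzero factor from the
      -- height inequality times dH(u). So u is tangent to the orbit, and there equivariance makes
      -- dG injective.
      have h5 : (2 * deriv K (H x) * v (H x) - K (H x) * deriv v (H x)) *
          mvfderiv (𝓡 2) H x u = 0 := by
        linear_combination 2 * v (H x) * h3 + K (H x) * h4
      have h6 : mvfderiv (𝓡 2) H x u = 0 :=
        (mul_eq_zero.1 h5).resolve_left (by linarith [hKv _ hc])
      have h7 : l = 0 := by
        rw [h6, mul_zero] at h4
        have := hpos _ hc
        have h8 : l * v (H x) = 0 := by linarith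
        exact (mul_eq_zero.1 h8).resolve_right this.ne'
      obtain ⟨c, rfl⟩ := Ω.exists_smul_hamiltonianVectorField
        (h.mem_periodicSet_of_mem hxU).1 h6
      rw [map_smul, Φ.mvfderiv_of_equivariant hG heq, h7, zero_smul] at h2
      have h9 : ((2 * Real.pi / τ : ℝ) * Complex.I) * G x ≠ 0 := by
        refine mul_ne_zero (mul_ne_zero (Complex.ofReal_ne_zero.2 ?_) Complex.I_ne_zero)
          (hne x hxU)
        have := h.pos
        positivity
      rw [(smul_eq_zero.1 h2).resolve_right h9, zero_smul]
    · have h4 : G x = 0 ∧ Bijective (mvfderiv (𝓡 2) G x) := by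
        rcases hcases x with rfl | rfl | hx
        · exact ⟨h0max, hbmax⟩
        · exact ⟨h0min, hbmin⟩
        · exact absurd hx hxU
      rw [h4.1, smul_zero] at h2
      exact h4.2.1 (h2.trans (_root_.map_zero _).symm)

end SmoothFlow.IsResonantFamily

end SphereRecognition

/-! ### The dichotomy. -/

theorem theorem2p9 {N : Type*} [TopologicalSpace N] [T2Space N] [SecondCountableTopology N]
    [ConnectedSpace N] [ChartedSpace (EuclideanSpace ℝ (Fin 2)) N] [IsManifold (𝓡 2) ∞ N]
    (Ω : SymplecticForm N) (hΩ : Ω.area < ⊤)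
    (H : N → ℝ) (hH : ContMDiff (𝓡 2) 𝓘(ℝ, ℝ) ∞ H) (hproper : IsProperMap H)
    (hnonconst : ∃ x y : N, H x ≠ H y) :
    (∃ Γ : OrbitCylinder Ω H, IsMax Γ) ∧
    Xor
      (∀ Γ : OrbitCylinder Ω H, IsMax Γ → Γ.IsNonresonant)
      (∃ Γ : OrbitCylinder Ω H, IsMax Γ ∧ (∀ Γ' : OrbitCylinder Ω H, IsMax Γ' → Γ' = Γ) ∧
        Γ.IsResonant ∧
        Nonempty (N ≃ₘ^∞⟮𝓡 2, 𝓡 2⟯ Metric.sphere (0 : EuclideanSpace ℝ (Fin 3)) 1) ∧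
        ∃ zmax zmin : N,
          (∀ z, z ≠ zmax → H z < H zmax) ∧ (∀ z, z ≠ zmin → H zmin < H z) ∧
          Γ.support ∪ {zmax, zmin} = univ ∧
          IsNondegenerateCriticalPoint H zmax ∧ IsNondegenerateCriticalPoint H zmin ∧
          InducesHamiltonianCircleAction Ω H {zmax, zmin}) := by
  obtain ⟨Φ⟩ := Ω.nonempty_hamiltonianFlow hH hproper
  obtain ⟨Y⟩ := Ω.nonempty_transversalField hH
  obtain ⟨x₀, hx₀⟩ := Φ.periodicSet_nonempty Y hH hnonconst hΩ
  obtain ⟨Γ₀, -, hΓ₀, -⟩ := Φ.exists_isMax Y hH hx₀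
  refine ⟨⟨Γ₀, hΓ₀⟩, ?_⟩
  by_cases hall : ∀ Γ : OrbitCylinder Ω H, IsMax Γ → Γ.IsNonresonant
  · refine Or.inl ⟨hall, ?_⟩
    rintro ⟨Γ, hΓ, -, hres, -⟩
    obtain ⟨c, hc, hcn⟩ := hall Γ hΓ
    exact hres c hc hcn
  · refine Or.inr ⟨?_, hall⟩
    push Not at hall
    obtain ⟨Γ, hΓ, hnot⟩ := hall
    have hres : Γ.IsResonant := fun c hc hcn ↦ hnot ⟨c, hc, hcn⟩
    obtain ⟨s, a, b, τ, h⟩ := Φ.exists_isResonantFamily Y hH hΩ hΓ hres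
    obtain ⟨zmax, zmin, hb, ha, hmax, hmin, huniv, hcl⟩ := h.exists_extrema hH hproper
    have hcases : ∀ x, x = zmax ∨ x = zmin ∨ x ∈ Γ.support := fun x ↦ by
      have hx : x ∈ insert zmax (insert zmin Γ.support) := huniv ▸ mem_univ x
      exact hx
    have hcl' : ∀ x, x ∈ closure Γ.support := fun x ↦ hcl ▸ mem_univ x
    have hne : zmax ≠ zmin := fun e ↦ h.lt.ne (by rw [← ha, ← hb, e])
    have hH' : ∀ x ∈ Γ.support, H x ∈ Ioo a b := fun x hx ↦ ((h.mem_iff x).1 hx).1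
    obtain ⟨G, hG, heq, hG0, h0max, h0min, hbmax, hbmin⟩ :=
      h.exists_equivariant hH hmax hmin hne huniv hcl
    have hk : ((2 * Real.pi / τ : ℝ) * Complex.I) ≠ 0 := by
      refine mul_ne_zero (Complex.ofReal_ne_zero.2 ?_) Complex.I_ne_zero
      have := h.pos
      positivity
    -- Points outside the support are critical, and differentiating the equivariance of G at time 0
    -- gives dG(X) = (2πi/τ) G, the input for nondegeneracy.
    have hcrit : ∀ z, z ∉ Γ.support → Bijective (mvfderiv (𝓡 2) G z) →
        IsNondegenerateCriticalPoint H z := fun z hz hbij ↦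
      Ω.isNondegenerateCriticalPoint hH (not_not.1 (h.notMem_regularSet (hcl' z) hz)) hG hbij hk
        (Φ.mvfderiv_of_equivariant hG heq)
    refine ⟨Γ, hΓ, fun Γ' hΓ' ↦ ?_, hres,
      h.nonempty_diffeomorph_sphere hH hproper hb ha hmax hmin huniv hcl hG heq hG0 h0max h0min
        hbmax hbmin, zmax, zmin, fun z hz ↦ ?_, fun z hz ↦ ?_, ?_, hcrit _ hmax hbmax,
      hcrit _ hmin hbmin, ?_⟩
    -- Any other maximal cylinder consists of regular points; these all lie in the dense support of
    -- Γ, so the two cylinders meet.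
    · obtain ⟨c, hc⟩ := Γ'.nontrivial.nonempty
      obtain ⟨x, hx, -, hcirc⟩ := Φ.exists_mem_periodicSet_circle Y hH Γ' hc
      have hx' : x ∈ Γ'.support :=
        mem_iUnion₂.2 ⟨c, hc, hcirc ▸ Φ.mem_orbit_self x⟩
      exact Φ.eq_of_mem_support Y hH hΓ' hΓ hx' (h.closure_inter x (hcl' x) hx.1)
    · rcases hcases z with rfl | rfl | hzU
      · exact absurd rfl hz
      · rw [ha, hb]
        exact h.lt
      · rw [hb]
        exact (hH' z hzU).2
    · rcases hcases z with rfl | rfl | hzU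
      · rw [ha, hb]
        exact h.lt
      · exact absurd rfl hz
      · rw [ha]
        exact (hH' z hzU).1
    · refine eq_univ_of_forall fun x ↦ ?_
      rcases hcases x with rfl | rfl | hx
      · exact Or.inr (Or.inl rfl)
      · exact Or.inr (Or.inr rfl)
      · exact Or.inl hx
    · have h1 := Φ.inducesHamiltonianCircleAction h.pos fun x ↦ h.apply_period hH (hcl' x)
      have h2 : {x | ∀ t, Φ.toFun t x = x} = {zmax, zmin} := by
        ext x
        constructor
        · intro hx
          rcases hcases x with rfl | rfl | hxU
          · exact Or.inl rfl
          · exact Or.inr rfl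
          · have := h.pos
            exact absurd (hx (τ / 2)) (h.apply_ne hH hxU ⟨by linarith, by linarith⟩)
        · rintro (rfl | rfl)
          · exact h.fixed (hcl' _) hmax
          · exact h.fixed (hcl' _) hmin
      rwa [h2] at h1
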